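/- **Setting.** Let $X=\mathbb A^3_{\mathbb C}$ with coordinates $x_1,x_2,x_3$, $S=\mathbb A^1_{\mathbb C}$ with coordinate $t$, and $f:X\to S$, $t=x_1x_2x_3$ (the local model of a semistable degeneration at a triple point of its special fibre). Put $Y_i=\{x_i=0\}$, $Y_{ij}=Y_i\cap Y_j$, $Y_{123}=Y_1\cap Y_2\cap Y_3$. Then $W=X\times_S X$ is the hypersurface $z_1z_2z_3=w_1w_2w_3$ in $\mathbb A^6_{\mathbb C}$, with projections $p_1=(z_i)$ and $p_2=(w_i)$; it contains $Y_i\times Y_j=\{z_i=w_j=0\}$ and the diagonals $\Delta_{ij}:Y_{ij}\to Y_{ij}\times Y_{ij}$, $\Delta_{123}:Y_{123}\to Y_{123}\times Y_{123}$. The three successive blow-ups of $W$ along $z_1=0=w_1$, then (the inverse image of) $z_2=0=w_2$, then (the inverse image of) $z_3=0=w_3$ exist; let $\sigma:Z\to W$ be their composite, $h:Z\to S$ the resulting morphism and $T=h^{-1}(0)$. For $i\ne j$ let $(Y_i\times Y_j)^{\sim}\subset Z$ be the strict transform of $Y_i\times Y_j$ under the three blow-ups, and let $T_1=(Y_1\times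 Y_2)^\sim$, $T_2=(Y_1\times Y_3)^\sim$, $T_3=(Y_2\times Y_1)^\sim$, $T_4=(Y_2\times Y_3)^\sim$, $T_5=(Y_3\times Y_1)^\sim$, $T_6=(Y_3\times Y_2)^\sim$. Let $T_7,T_8,T_9$ be the (strict transforms in $Z$ of the) exceptional divisors of the first, second and third blow-up. All $T_k$ carry the reduced structure; $T_{k_1\cdots k_m}$ is the scheme-theoretic intersection $T_{k_1}\cap\dots\cap T_{k_m}$. Let $\tilde T^{(m)}$ be the disjoint union of the $m$-fold intersections of distinct irreducible components of $T$. **Lemma.** 1. The degeneration $h:Z\to S$ is normal-crossings: $Z$ is nonsingular, $h$ is surjective and is smooth over $S\setminus\{0\}$, and at each closed point of $T$ the function $t$ is, up to a unit, a monomial in a regular system of parameters of the local ring of $Z$. 2. $T=\bigcup_{k=1}^9T_k$, and $T_1,\dots,T_9$ are pairwise distinct and are exactly the irreducible components of $T$. For $i=1,2,3$, $T_{6+i}=(Y_i\times Y_i)^\sim$, i.e. it is the closure of the inverse image of the part of $Y_i\times Y_i$ over which $\sigma$ is an isomorphism. For every $m$, $\tilde T^{(m)}=\coprod_{k_1<\dots<k_m}T_{k_1\cdots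 k_m}$ over $Z$; in particular $\tilde T^{(1)}=\coprod_k T_k$. 3. $Z$ is covered by eight affine open charts, one for each subset $A\subset\{1,2,3\}$ with complement $B$. The chart of $A$ is $\operatorname{Spec}\mathbb C[s_1,s_2,s_3,b_1,b_2,b_3]/(\prod_{i\in A}s_i-\prod_{i\in B}s_i)$ (empty products are $1$), where $b_i=z_i$, $s_i=w_i/z_i$ (so $w_i=s_ib_i$) for $i\in A$ and $b_i=w_i$, $s_i=z_i/w_i$ (so $z_i=s_ib_i$) for $i\in B$. On it $T_{6+i}$ has ideal $(b_i)$, and for $i\neq j$ the component $(Y_i\times Y_j)^\sim$ has ideal $(s_i,s_j)$ if $i\in B$, $j\in A$, and is empty otherwise. At most five of the $T_k$ meet each chart. 4. For each ordered pair $i\ne j$ there is a closed subscheme $D_{ij}\subset Z$ (a "diagonal" curve) which on the chart of $A$ has ideal $(s_i,s_j,b_i,b_j,s_l-1)$, $\{i,j,l\}=\{1,2,3\}$, if $i\in B$ and $j\in A$, and is empty otherwise; $\sigma$ maps $D_{ij}$ isomorphically onto the diagonal $\Delta_{ij}(Y_{ij})$. Writing $\tilde\delta_{ij}=D_{ij}$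 and $\delta_{ij}=D_{ji}$ for $i<j$, one has $\tilde\delta_{12}\subset T_{178}$, $\delta_{12}\subset T_{378}$, $\tilde\delta_{13}\subset T_{279}$, $\delta_{13}\subset T_{579}$, $\tilde\delta_{23}\subset T_{489}$, $\delta_{23}\subset T_{689}$. 5. The surface $T_{789}$ is isomorphic over $\mathbb C$ to the blow-up of $\mathbb P^1\times\mathbb P^1$ at the two (reduced) points $(0,1)\times(1,0)$ and $(1,0)\times(0,1)$. 6. $\tilde T^{(5)}$ is the disjoint union of the six subschemes $T_{12789}$, $T_{16789}$, $T_{24789}$, $T_{34789}$, $T_{35789}$, $T_{56789}$, and each of them is a point mapped isomorphically by $\sigma$ onto the diagonal point $\Delta_{123}(Y_{123})$. -/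

import Mathlib

open CategoryTheory CategoryTheory.Limits AlgebraicGeometry TopologicalSpace

universe u

namespace TriplePoint

noncomputable section

/-! ### Blow-ups, strict transforms, strata of a closed subset -/

/-- An ideal sheaf is invertible (it defines an effective Cartier divisor) if locally it is
generated by one element which is not a zero divisor. -/
def IsInvertible {X : Scheme.{u}} (I : X.IdealSheafData) : Prop :=
  ∀ x : X, ∃ U : X.affineOpens, x ∈ U.1 ∧
    ∃ a ∈ nonZeroDivisors Γ(X, U.1), I.ideal U = Ideal.span {a}

/-- `π : Y ⟶ X` is the blow-up of `X` along the closed subscheme with ideal sheaf `I`: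
the inverse image ideal sheaf `I · 𝒪_Y` is invertible, and `π` is universal for this property. -/
structure IsBlowup {X Y : Scheme.{u}} (I : X.IdealSheafData) (π : Y ⟶ X) : Prop where
  invertible : IsInvertible (I.comap π)
  existsUnique_lift : ∀ (V : Scheme.{u}) (g : V ⟶ X), IsInvertible (I.comap g) →
    ∃! l : V ⟶ Y, l ≫ π = g

/-- The strict transform of a closed subset `V` of `X` under a blow-up `π : Y ⟶ X` with
centre `C`: the closure of the inverse image of `V \ C`. -/
def strictTransform {X Y : Scheme.{u}} (π : Y ⟶ X) (C : X.IdealSheafData) (V : Closeds X) :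
    Closeds Y :=
  Closeds.closure (π ⁻¹' ((V : Set X) \ (C.support : Set X)))

/-- The largest open subset of the target over which `σ` is an isomorphism. -/
def isoLocus {X Y : Scheme.{u}} (σ : Y ⟶ X) : X.Opens :=
  sSup {U : X.Opens | IsIso (σ ∣_ U)}

/-- The proper transform of a closed subset `V` of `X` under a birational morphism `σ`: the
closure of the inverse image of the part of `V` over which `σ` is an isomorphism. -/
def properTransform {X Y : Scheme.{u}} (σ : Y ⟶ X) (V : Closeds X) : Closeds Y :=
  Closeds.closure (σ ⁻¹' ((V : Set X) ∩ (isoLocus σ : Set X)))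

/-- The irreducible components of a closed subset. -/
def components {Z : Scheme.{u}} (A : Closeds Z) : Set (Closeds Z) :=
  {C | Maximal (fun s : Closeds Z => IsIrreducible (s : Set Z) ∧ s ≤ A) C}

/-- The index set of the `m`-fold intersections of irreducible components of `A`. -/
abbrev StratumIndex {Z : Scheme.{u}} (A : Closeds Z) (m : ℕ) : Type u :=
  {s : Finset (Closeds Z) // s.card = m ∧ ∀ C ∈ s, C ∈ components A}

/-- The scheme `Ã^(m)`: the disjoint union of the (scheme-theoretic) `m`-fold intersections
of the irreducible components of `A`, each component with its reduced structure. -/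
def stratum {Z : Scheme.{u}} (A : Closeds Z) (m : ℕ) : Scheme.{u} :=
  ∐ fun s : StratumIndex A m =>
    (⨆ C ∈ s.1, Scheme.IdealSheafData.vanishingIdeal C).subscheme

/-- The natural morphism `Ã^(m) ⟶ Z`. -/
def stratumMap {Z : Scheme.{u}} (A : Closeds Z) (m : ℕ) : stratum A m ⟶ Z :=
  Sigma.desc fun s : StratumIndex A m =>
    (⨆ C ∈ s.1, Scheme.IdealSheafData.vanishingIdeal C).subschemeι

/-- The ideal sheaf on `Spec R` given by an ideal of `R`. -/
def idealSheaf (R : Type u) [CommRing R] (I : Ideal R) :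
    (Spec (CommRingCat.of R)).IdealSheafData :=
  Scheme.IdealSheafData.ofIdealTop (I.map (Scheme.ΓSpecIso (CommRingCat.of R)).inv.hom)

/-! ### Normal-crossings degenerations over the line `S` -/

/-- `Spec ℂ`. -/
abbrev SpecC : Scheme.{0} := Spec (CommRingCat.of ℂ)

/-- The base `S = Spec ℂ[t]`. -/
abbrev S : Scheme.{0} := Spec (CommRingCat.of (Polynomial ℂ))

/-- The structure morphism of the base. -/
def SToC : S ⟶ SpecC := Spec.map (CommRingCat.ofHom (algebraMap ℂ (Polynomial ℂ)))

/-- The ideal sheaf of the origin `t = 0` of `S`. -/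
def origin : S.IdealSheafData := idealSheaf (Polynomial ℂ) (Ideal.span {Polynomial.X})

/-- The complement `S^*` of the origin. -/
def punctured : S.Opens := origin.support.compl

/-- The pullback to `Z` of the parameter `t`. -/
def parameter {Z : Scheme.{0}} (h : Z ⟶ S) : Γ(Z, ⊤) :=
  h.appTop.hom ((Scheme.ΓSpecIso (CommRingCat.of (Polynomial ℂ))).inv.hom Polynomial.X)

/-- The special fibre `h⁻¹(0)`, as a closed subset. -/
def specialFibre {Z : Scheme.{0}} (h : Z ⟶ S) : Closeds Z := (origin.comap h).support

/-- `h : Z ⟶ S` is a (local, hence not necessarily proper) normal-crossings degeneration: `Z` is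
nonsingular, `h` is surjective and smooth over `S^*`, and at every closed point of the
special fibre there is a regular system of parameters `u₁, …, uₙ` of the local ring in which
`t` is, up to a unit, a monomial `u₁^e₁ ⋯ uₙ^eₙ`. -/
structure IsNormalCrossingsDegeneration {Z : Scheme.{0}} (h : Z ⟶ S) : Prop where
  nonsingular : Smooth (h ≫ SToC)
  surjective : Surjective h
  smooth_punctured : Smooth (h ∣_ punctured)
  local_form : ∀ x : Z, IsClosed ({x} : Set Z) → x ∈ specialFibre h →
    ∃ (n : ℕ) (u : Fin n → Z.presheaf.stalk x) (e : Fin n → ℕ) (ε : (Z.presheaf.stalk x)ˣ),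
      ringKrullDim (Z.presheaf.stalk x) = n ∧
      Ideal.span (Set.range u) = IsLocalRing.maximalIdeal (Z.presheaf.stalk x) ∧
      (Z.presheaf.germ ⊤ x trivial).hom (parameter h) = ε * ∏ i, u i ^ e i

/-! ### The triple point and its fibre product

The indices `1, 2, 3` of the mathematical notation are `0, 1, 2 : Fin 3`. -/

/-- `X = Spec ℂ[x₁, x₂, x₃]`. -/
abbrev X : Scheme.{0} := Spec (CommRingCat.of (MvPolynomial (Fin 3) ℂ))

/-- `f : X ⟶ S`, `t = x₁x₂x₃`. -/
def f : X ⟶ S :=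
  Spec.map (CommRingCat.ofHom
    (Polynomial.aeval (∏ i, MvPolynomial.X i : MvPolynomial (Fin 3) ℂ)).toRingHom)

/-- The ideal sheaf of `Y_I = ⋂_{i ∈ I} {x_i = 0}` in `X`. -/
def Y (I : Finset (Fin 3)) : X.IdealSheafData :=
  idealSheaf (MvPolynomial (Fin 3) ℂ) (Ideal.span (MvPolynomial.X '' (I : Set (Fin 3))))

/-- The polynomial `z₁z₂z₃ - w₁w₂w₃`, where `z_i = X (inl i)` and `w_i = X (inr i)`. -/
def eqn : MvPolynomial (Fin 3 ⊕ Fin 3) ℂ :=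
  ∏ i, MvPolynomial.X (Sum.inl i) - ∏ i, MvPolynomial.X (Sum.inr i)

/-- `ℂ[z, w] / (z₁z₂z₃ - w₁w₂w₃)`. -/
abbrev RingW : Type := MvPolynomial (Fin 3 ⊕ Fin 3) ℂ ⧸ Ideal.span {eqn}

/-- The coordinate function `z_i`. -/
def z (i : Fin 3) : RingW := Ideal.Quotient.mk _ (MvPolynomial.X (Sum.inl i))

/-- The coordinate function `w_i`. -/
def w (i : Fin 3) : RingW := Ideal.Quotient.mk _ (MvPolynomial.X (Sum.inr i))

/-- The hypersurface `z₁z₂z₃ = w₁w₂w₃`. -/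
abbrev W : Scheme.{0} := Spec (CommRingCat.of RingW)

/-- The first projection `W ⟶ X`, with coordinates `z`. -/
def p₁ : W ⟶ X := Spec.map (CommRingCat.ofHom (MvPolynomial.aeval (R := ℂ) z).toRingHom)

/-- The second projection `W ⟶ X`, with coordinates `w`. -/
def p₂ : W ⟶ X := Spec.map (CommRingCat.ofHom (MvPolynomial.aeval (R := ℂ) w).toRingHom)

/-- The morphism of `ℂ`-algebras out of `RingW` given by the images of the `z_i` and `w_i`. -/
def liftW {A : Type} [CommRing A] [Algebra ℂ A] (a b : Fin 3 → A)
    (hab : ∏ i, a i = ∏ i, b i) : RingW →ₐ[ℂ] A :=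
  Ideal.Quotient.liftₐ _ (MvPolynomial.aeval (Sum.elim a b)) (by
    intro p hp
    rw [Ideal.mem_span_singleton] at hp
    obtain ⟨q, rfl⟩ := hp
    simp [eqn, hab])

/-- The diagonal `X ⟶ X ×_S X`. -/
def diagonal : X ⟶ W :=
  Spec.map (CommRingCat.ofHom
    (liftW (A := MvPolynomial (Fin 3) ℂ) MvPolynomial.X MvPolynomial.X rfl).toRingHom)

/-- The diagonal `Δ_I : Y_I ⟶ Y_I × Y_I ⊆ W`. -/
def Δ (I : Finset (Fin 3)) : (Y I).subscheme ⟶ W := (Y I).subschemeι ≫ diagonal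

/-- The ideal sheaf of `Y_i × Y_j = {z_i = 0 = w_j}` in `W`. -/
def prodY (i j : Fin 3) : W.IdealSheafData := idealSheaf RingW (Ideal.span {z i, w j})

/-! ### The three blow-ups -/

/-- Three successive blow-ups of `W`, with centres `z_i = 0 = w_i` for `i = 1, 2, 3`. -/
structure BlowupTower where
  Z₁ : Scheme.{0}
  Z₂ : Scheme.{0}
  Z : Scheme.{0}
  σ₁ : Z₁ ⟶ W
  σ₂ : Z₂ ⟶ Z₁
  σ₃ : Z ⟶ Z₂
  isBlowup₁ : IsBlowup (prodY 0 0) σ₁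
  isBlowup₂ : IsBlowup ((prodY 1 1).comap σ₁) σ₂
  isBlowup₃ : IsBlowup ((prodY 2 2).comap (σ₂ ≫ σ₁)) σ₃

namespace BlowupTower

variable (B : BlowupTower)

/-- The centre of the second blow-up. -/
def C₂ : B.Z₁.IdealSheafData := (prodY 1 1).comap B.σ₁

/-- The centre of the third blow-up. -/
def C₃ : B.Z₂.IdealSheafData := (prodY 2 2).comap (B.σ₂ ≫ B.σ₁)

/-- The composite `Z ⟶ W`. -/
def σ : B.Z ⟶ W := B.σ₃ ≫ B.σ₂ ≫ B.σ₁

/-- The degeneration `h : Z ⟶ S`. -/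
def h : B.Z ⟶ S := B.σ ≫ p₁ ≫ f

/-- The special fibre of `h`. -/
def fibre : Closeds B.Z := specialFibre B.h

/-- The strict transform of `Y_i × Y_j` under the three blow-ups. -/
def strict (i j : Fin 3) : Closeds B.Z :=
  strictTransform B.σ₃ B.C₃ (strictTransform B.σ₂ B.C₂
    (strictTransform B.σ₁ (prodY 0 0) (prodY i j).support))

/-- The exceptional divisor of the first blow-up, strictly transformed to `Z`. -/
def exc₁ : Closeds B.Z :=
  strictTransform B.σ₃ B.C₃ (strictTransform B.σ₂ B.C₂ ((prodY 0 0).comap B.σ₁).support)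

/-- The exceptional divisor of the second blow-up, strictly transformed to `Z`. -/
def exc₂ : Closeds B.Z := strictTransform B.σ₃ B.C₃ (B.C₂.comap B.σ₂).support

/-- The exceptional divisor of the third blow-up. -/
def exc₃ : Closeds B.Z := (B.C₃.comap B.σ₃).support

/-- The divisors `T₁, …, T₉`, in their standard numbering. -/
def T : ℕ → Closeds B.Z
  | 1 => B.strict 0 1
  | 2 => B.strict 0 2
  | 3 => B.strict 1 0
  | 4 => B.strict 1 2
  | 5 => B.strict 2 0
  | 6 => B.strict 2 1
  | 7 => B.exc₁
  | 8 => B.exc₂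
  | 9 => B.exc₃
  | _ => ⊥

/-- The ideal sheaf of the scheme-theoretic intersection `T_J = ⋂_{k ∈ J} T_k`, each `T_k`
with its reduced structure. -/
def inter (J : Finset ℕ) : B.Z.IdealSheafData :=
  ⨆ k ∈ J, Scheme.IdealSheafData.vanishingIdeal (B.T k)

/-- The disjoint union of the intersections `T_J`, for `J` in a set `𝒥` of sets of labels. -/
def interSum (𝒥 : Finset (Finset ℕ)) : Scheme.{0} :=
  ∐ fun J : {J // J ∈ 𝒥} => (B.inter J.1).subscheme

/-- The natural morphism from the disjoint union of the `T_J` to `Z`. -/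
def interSumMap (𝒥 : Finset (Finset ℕ)) : B.interSum 𝒥 ⟶ B.Z :=
  Sigma.desc fun J : {J // J ∈ 𝒥} => (B.inter J.1).subschemeι

end BlowupTower

/-- The labels of the six points of the fifth stratum. -/
def sixPoints : Finset (Finset ℕ) :=
  {{1, 2, 7, 8, 9}, {1, 6, 7, 8, 9}, {2, 4, 7, 8, 9}, {3, 4, 7, 8, 9}, {3, 5, 7, 8, 9},
    {5, 6, 7, 8, 9}}

/-! ### The eight charts

A chart is given by `ε : Fin 3 → Bool`. If `ε i = true`, its `i`-th pair of coordinates is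
`s_i = w_i' = w_i / z_i`, `b_i = z_i`; if `ε i = false`, it is `s_i = z_i' = z_i / w_i`,
`b_i = w_i`. The relation is
`∏_{ε i = true} w_i' = ∏_{ε i = false} z_i'`, an empty product being `1`. -/

/-- The relation between the coordinates of a chart. -/
def chartEqn (ε : Fin 3 → Bool) : MvPolynomial (Fin 3 ⊕ Fin 3) ℂ :=
  (∏ i, if ε i = true then MvPolynomial.X (Sum.inl i) else 1) -
    ∏ i, if ε i = true then 1 else MvPolynomial.X (Sum.inl i)

/-- The coordinate ring of a chart. -/
abbrev RingU (ε : Fin 3 → Bool) : Type :=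
  MvPolynomial (Fin 3 ⊕ Fin 3) ℂ ⧸ Ideal.span {chartEqn ε}

/-- The coordinate `s_i`: `w_i / z_i` or `z_i / w_i`. -/
def s (ε : Fin 3 → Bool) (i : Fin 3) : RingU ε :=
  Ideal.Quotient.mk _ (MvPolynomial.X (Sum.inl i))

/-- The coordinate `b_i`: `z_i` or `w_i`. -/
def b (ε : Fin 3 → Bool) (i : Fin 3) : RingU ε :=
  Ideal.Quotient.mk _ (MvPolynomial.X (Sum.inr i))

theorem chart_relation (ε : Fin 3 → Bool) :
    (∏ i, if ε i = true then s ε i else 1) = ∏ i, if ε i = true then 1 else s ε i := by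
  have h : (Ideal.Quotient.mk (Ideal.span {chartEqn ε}))
      ((∏ i, if ε i = true then MvPolynomial.X (Sum.inl i) else 1) -
        ∏ i, if ε i = true then 1 else MvPolynomial.X (Sum.inl i)) = 0 :=
    Ideal.Quotient.eq_zero_iff_mem.2 (Ideal.subset_span rfl)
  rw [map_sub, map_prod, map_prod, sub_eq_zero] at h
  have h1 : ∀ (c : Bool) (p q : MvPolynomial (Fin 3 ⊕ Fin 3) ℂ),
      Ideal.Quotient.mk (Ideal.span {chartEqn ε}) (if c = true then p else q) =
        if c = true then Ideal.Quotient.mk _ p else Ideal.Quotient.mk _ q := by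
    intro c p q; split_ifs <;> rfl
  simp only [h1, map_one] at h
  exact h

/-- The expressions of the `z_i` in a chart. -/
def chartZ (ε : Fin 3 → Bool) (i : Fin 3) : RingU ε :=
  if ε i = true then b ε i else s ε i * b ε i

/-- The expressions of the `w_i` in a chart. -/
def chartW (ε : Fin 3 → Bool) (i : Fin 3) : RingU ε :=
  if ε i = true then s ε i * b ε i else b ε i

theorem chart_compatible (ε : Fin 3 → Bool) : ∏ i, chartZ ε i = ∏ i, chartW ε i := by
  have h1 : ∀ i, chartZ ε i = (if ε i = true then 1 else s ε i) * b ε i := by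
    intro i; unfold chartZ; split_ifs <;> simp
  have h2 : ∀ i, chartW ε i = (if ε i = true then s ε i else 1) * b ε i := by
    intro i; unfold chartW; split_ifs <;> simp
  simp only [h1, h2, Finset.prod_mul_distrib, chart_relation]

/-- The chart with coordinate ring `RingU ε`. -/
abbrev U (ε : Fin 3 → Bool) : Scheme.{0} := Spec (CommRingCat.of (RingU ε))

/-- The morphism to `W` given on a chart by the expressions for the `z_i` and `w_i`. -/
def chartMap (ε : Fin 3 → Bool) : U ε ⟶ W :=
  Spec.map (CommRingCat.ofHom (liftW (chartZ ε) (chartW ε) (chart_compatible ε)).toRingHom)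

/-- The ideal of the strict transform of `Y_i × Y_j` (`i ≠ j`) on a chart: it is
`{s_i = s_j = 0}` if `s_i = z_i'` and `s_j = w_j'`, and is empty otherwise. (If `i` is the only
index with `ε i = false`, then `s_i` is a multiple of `s_j` and the equation is `s_j = 0`; if `j` is
the only index with `ε j = true`, it is `s_i = 0`; one of these two cases always occurs.) -/
def chartStrict (ε : Fin 3 → Bool) (i j : Fin 3) : Ideal (RingU ε) :=
  if ε i = false ∧ ε j = true then Ideal.span {s ε i, s ε j} else ⊤

/-- The ideals of the divisors `T₁, …, T₉` on a chart. -/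
def chartT (ε : Fin 3 → Bool) : ℕ → Ideal (RingU ε)
  | 1 => chartStrict ε 0 1
  | 2 => chartStrict ε 0 2
  | 3 => chartStrict ε 1 0
  | 4 => chartStrict ε 1 2
  | 5 => chartStrict ε 2 0
  | 6 => chartStrict ε 2 1
  | 7 => Ideal.span {b ε 0}
  | 8 => Ideal.span {b ε 1}
  | 9 => Ideal.span {b ε 2}
  | _ => ⊤

/-- The ideal of the diagonal curve with indices `i ≠ j` on a chart: it is
`z_i' = w_j' = b_i = b_j = 0`, `s_l = 1` for the third index `l`, if `s_i = z_i'` and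
`s_j = w_j'`, and is empty otherwise. -/
def chartDelta (ε : Fin 3 → Bool) (i j : Fin 3) : Ideal (RingU ε) :=
  if ε i = false ∧ ε j = true then
    Ideal.span ({s ε i, s ε j, b ε i, b ε j} ∪ {a | ∃ l, l ≠ i ∧ l ≠ j ∧ a = s ε l - 1})
  else ⊤

/-! ### The blow-up of `ℙ¹ × ℙ¹` at two points -/

/-- The grading of `ℂ[x₀, x₁]`. -/
abbrev grading : ℕ → Submodule ℂ (MvPolynomial (Fin 2) ℂ) :=
  MvPolynomial.homogeneousSubmodule (Fin 2) ℂ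

instance : GradedAlgebra grading := MvPolynomial.gradedAlgebra

/-- The projective line. -/
abbrev P1 : Scheme.{0} := Proj grading

/-- The structure morphism of the projective line. -/
def P1ToC : P1 ⟶ SpecC :=
  Proj.toSpecZero grading ≫ Spec.map (CommRingCat.ofHom (algebraMap ℂ (grading 0)))

/-- `ℙ¹ × ℙ¹` over `Spec ℂ`. -/
abbrev P1P1 : Scheme.{0} := pullback P1ToC P1ToC

/-- The point of `ℙ¹` where the homogeneous coordinate `x_i` vanishes, as a closed subset:
it is `(0, 1)` for `i = 0` and `(1, 0)` for `i = 1`. -/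
def pointP1 (i : Fin 2) : Closeds P1 :=
  ⟨ProjectiveSpectrum.zeroLocus grading {MvPolynomial.X i},
    ProjectiveSpectrum.isClosed_zeroLocus _ _⟩

/-- The ideal sheaf of the reduced closed subscheme of `ℙ¹ × ℙ¹` with the two points
`(0, 1) × (1, 0)` and `(1, 0) × (0, 1)`. -/
def twoPoints : P1P1.IdealSheafData :=
  Scheme.IdealSheafData.vanishingIdeal
    (((pointP1 0).preimage (pullback.fst P1ToC P1ToC).continuous ⊓
        (pointP1 1).preimage (pullback.snd P1ToC P1ToC).continuous) ⊔
      ((pointP1 1).preimage (pullback.fst P1ToC P1ToC).continuous ⊓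
        (pointP1 0).preimage (pullback.snd P1ToC P1ToC).continuous))

end

end TriplePoint

/-!
# The resolution of `X ×_S X` at a triple point

The whole computation rests on describing `Z` by the functor it represents. In a local ring an
ideal `(a, b)` is generated by a nonzerodivisor exactly if one of `a`, `b` is a nonzerodivisor
dividing the other; call this condition `Principal a b`, and `Divides a b` the half of it in which
`a` is the divisor. Both are conditions on the points of a scheme `V` with a morphism to a given
base (`PointCondition`), and `IsUniversal` says that a scheme over the base is terminal among those
that satisfy a condition everywhere. The blow-up of `(a, b)` is the universal object for
`Principal a b` (`isBlowup_iff`). Where `(a, b)` is principal, `Divides a b` is an open condition,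
compatible with all morphisms (`Divides.isOpenIn`), and over `Spec R` it is represented by
`Spec R[b / a]`. Gluing over the two conditions and over affine open subsets gives the blow-up of
every quasi-compact scheme (`IsUniversal.exists_union`, `exists_isUniversal_principal_over`). Such
blow-ups preserve nonzerodivisors, so that an ideal made invertible at one stage of the tower stays
invertible at the later ones: the composite `σ : Z ⟶ W` is universal for the condition that the
three ideals `(z_i, w_i)` are principal simultaneously (`BlowupTower.isUniversal`).

Choosing in each pair `z_i`, `w_i` which element divides the other cuts this condition into eight
open ones, and each is represented by one of the given rings (`isUniversal_chartMap`): the quotients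
`s_i` satisfy the relation of the chart because the `b_i` can be cancelled from
`z₁z₂z₃ = w₁w₂w₃`. Hence the open immersions `BlowupTower.φ` of the eight charts.

Each chart is a localization of a polynomial ring in five variables, obtained by solving the
relation for one of the `s_l` (`chartEquiv`), and `t` is a monomial in the variables
(`prod_chartZ`); this gives the normal-crossings property. Strict transforms are closures of inverse
images of sets disjoint from the centres (`strict_eq`, `exc₁_eq`, `exc₂_eq`), and closures can be
computed in charts; so each `T_k` has the stated prime ideal in the charts it meets
(`vanishingIdeal_T_comap`). The points with coordinates `0` and `1` in `testS`, `testB` lie on a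
single component and in all charts that the component meets, which makes the nine components
distinct and irreducible (`bijOn_T`). Which components meet is then a finite check on the charts,
and the diagonal curves and the six points, each contained in one chart, are computed from their
ideals there (`exists_iso_Y`).

On `T₇₈₉` all `b_i` vanish, and a chart of it has as coordinates the three quotients `s_i` with the
relation of the chart. The functions `[z₁ : w₁]` and `[z₂ : w₂]` define a morphism to `ℙ¹ × ℙ¹`
(`toP1P1`). Over a product of two standard charts the two forms `z₁z₂` and `w₁w₂` generate the
ideal of the two points (`twoPoints_comap_chart`), and the relation says precisely that the third
ratio `[z₃ : w₃]` is `[w₁w₂ : z₁z₂]`. So the third coordinate of a chart is the adjoined quotient of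
the two generators (`isUniversal_planeToT`), and `T₇₈₉` has the universal property of the blow-up of
the two points (`isBlowup_toP1P1`).
-/

namespace TriplePoint

noncomputable section

/-! ### Pointwise conditions on morphisms and the objects representing them -/

/-- A pointwise condition on schemes over `X`: for each `g : V ⟶ X` the set of points of `V`
at which it holds. -/
abbrev PointCondition (X : Scheme.{u}) := ∀ ⦃V : Scheme.{u}⦄, (V ⟶ X) → Set V

/-- A pointwise condition is local if it is compatible with open immersions into the source. -/
def PointCondition.IsLocal {X : Scheme.{u}} (p : PointCondition X) : Prop :=
  ∀ ⦃V' V : Scheme.{u}⦄ (j : V' ⟶ V) [IsOpenImmersion j] (g : V ⟶ X), p (j ≫ g) = j ⁻¹' p g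

/-- `π : Y ⟶ X` is terminal among the schemes over `X` that satisfy the condition `p` at all
their points. -/
structure IsUniversal {X Y : Scheme.{u}} (p : PointCondition X) (π : Y ⟶ X) : Prop where
  self : p π = Set.univ
  existsUnique : ∀ {V : Scheme.{u}} (g : V ⟶ X), p g = Set.univ → ∃! l : V ⟶ Y, l ≫ π = g

/-- `q` is an open subcondition of `p`: among schemes satisfying `p` everywhere, the locus of `q`
is open and compatible with all morphisms. -/
structure PointCondition.IsOpenIn {X : Scheme.{u}} (q p : PointCondition X) : Prop where
  isLocal : q.IsLocal
  isOpen : ∀ {V : Scheme.{u}} (g : V ⟶ X), p g = Set.univ → IsOpen (q g)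
  preimage : ∀ {V Y : Scheme.{u}} (l : V ⟶ Y) (π : Y ⟶ X), p π = Set.univ →
    p (l ≫ π) = Set.univ → q (l ≫ π) = l ⁻¹' q π

theorem IsUniversal.hom_ext {X Y V : Scheme.{u}} {p : PointCondition X} {π : Y ⟶ X}
    (h : IsUniversal p π) {l l' : V ⟶ Y} (hp : p (l ≫ π) = Set.univ) (e : l ≫ π = l' ≫ π) :
    l = l' :=
  (h.existsUnique _ hp).unique rfl e.symm

theorem IsUniversal.congr {X Y : Scheme.{u}} {p q : PointCondition X} {π : Y ⟶ X}
    (h : IsUniversal p π) (e : ∀ {V : Scheme.{u}} (g : V ⟶ X), p g = Set.univ ↔ q g = Set.univ) :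
    IsUniversal q π :=
  ⟨(e π).1 h.self, fun g hg ↦ h.existsUnique g ((e g).2 hg)⟩

/-- Lifts exist if they exist locally on the source and are unique. -/
theorem exists_lift_of_locally {X Y V : Scheme.{u}} {p : PointCondition X} (hp : p.IsLocal)
    {π : Y ⟶ X}
    (huniq : ∀ {V : Scheme.{u}} (l l' : V ⟶ Y), p (l ≫ π) = Set.univ → l ≫ π = l' ≫ π → l = l')
    (g : V ⟶ X) (hg : p g = Set.univ)
    (H : ∀ v : V, ∃ U : V.Opens, v ∈ U ∧ ∃ l : U.toScheme ⟶ Y, l ≫ π = U.ι ≫ g) :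
    ∃ l : V ⟶ Y, l ≫ π = g := by
  choose U hU l hl using H
  let 𝒰 : V.OpenCover := {
    I₀ := V, X i := (U i), f i := (U i).ι,
    mem₀ := by
      rw [Scheme.presieve₀_mem_precoverage_iff]
      refine ⟨fun x ↦ ⟨x, by simpa using hU x⟩, inferInstance⟩ }
  have hc : ∀ x y, pullback.fst (𝒰.f x) (𝒰.f y) ≫ l x = pullback.snd (𝒰.f x) (𝒰.f y) ≫ l y := by
    intro x y
    have e1 : (pullback.fst (𝒰.f x) (𝒰.f y) ≫ l x) ≫ π =
        (pullback.fst (𝒰.f x) (𝒰.f y) ≫ 𝒰.f x) ≫ g := by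
      rw [Category.assoc, hl, Category.assoc]
    have e2 : (pullback.snd (𝒰.f x) (𝒰.f y) ≫ l y) ≫ π =
        (pullback.snd (𝒰.f x) (𝒰.f y) ≫ 𝒰.f y) ≫ g := by
      rw [Category.assoc, hl, Category.assoc]
    refine huniq _ _ ?_ ?_
    · rw [e1]
      have : IsOpenImmersion (pullback.fst (𝒰.f x) (𝒰.f y) ≫ 𝒰.f x) := inferInstance
      rw [hp, hg, Set.preimage_univ]
    · rw [e1, e2, pullback.condition]
  refine ⟨𝒰.glueMorphisms l hc, 𝒰.hom_ext _ _ fun x ↦ ?_⟩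
  rw [Scheme.Cover.ι_glueMorphisms_assoc]
  exact hl x

/-- A morphism `π : Y ⟶ X` is universal for `p` if `Y` is covered by open subschemes that are
universal for conditions `p c` which together cover `p`. -/
theorem IsUniversal.of_cover {X Y : Scheme.{u}} {ι : Type*} {p : PointCondition X}
    (hp : p.IsLocal) (pc : ι → PointCondition X) (hpc : ∀ c, (pc c).IsLocal)
    (hopen : ∀ {V : Scheme.{u}} (g : V ⟶ X), p g = Set.univ → ∀ c, IsOpen (pc c g))
    (hcover : ∀ {V : Scheme.{u}} (g : V ⟶ X), p g = Set.univ → ∀ v, ∃ c, v ∈ pc c g)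
    {π : Y ⟶ X} (hπ : p π = Set.univ) (O : ι → Y.Opens)
    (hO : ∀ c, IsUniversal (pc c) ((O c).ι ≫ π))
    (htrans : ∀ {V : Scheme.{u}} (l : V ⟶ Y) c, p (l ≫ π) = Set.univ →
      pc c (l ≫ π) ⊆ l ⁻¹' (O c : Set Y)) :
    IsUniversal p π := by
  have huniq : ∀ {V : Scheme.{u}} (l l' : V ⟶ Y), p (l ≫ π) = Set.univ →
      l ≫ π = l' ≫ π → l = l' := by
    intro V l l' hl e
    refine Scheme.hom_ext_of_forall _ _ fun v ↦ ?_
    obtain ⟨c, hc⟩ := hcover _ hl v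
    let U : V.Opens := ⟨pc c (l ≫ π), hopen _ hl c⟩
    have h1 : Set.range (U.ι ≫ l) ⊆ Set.range (O c).ι := by
      rintro _ ⟨x, rfl⟩
      rw [Scheme.Opens.range_ι]
      exact htrans l c hl x.2
    have h2 : Set.range (U.ι ≫ l') ⊆ Set.range (O c).ι := by
      rintro _ ⟨x, rfl⟩
      rw [Scheme.Opens.range_ι]
      exact htrans l' c (e ▸ hl) (show x.1 ∈ pc c (l' ≫ π) from e ▸ x.2)
    refine ⟨U, hc, ?_⟩
    have key : IsOpenImmersion.lift (O c).ι (U.ι ≫ l) h1 =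
        IsOpenImmersion.lift (O c).ι (U.ι ≫ l') h2 := by
      refine (hO c).hom_ext ?_ ?_
      · rw [IsOpenImmersion.lift_fac_assoc, Category.assoc, hpc c]
        ext x
        simp only [Set.mem_preimage, Set.mem_univ, iff_true]
        exact x.2
      · rw [IsOpenImmersion.lift_fac_assoc, IsOpenImmersion.lift_fac_assoc, Category.assoc, e,
          Category.assoc]
    rw [← IsOpenImmersion.lift_fac (O c).ι (U.ι ≫ l) h1, key, IsOpenImmersion.lift_fac]
  refine ⟨hπ, fun {V} g hg ↦ ?_⟩
  obtain ⟨l, hl⟩ := exists_lift_of_locally hp huniq g hg fun v ↦ by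
    obtain ⟨c, hc⟩ := hcover _ hg v
    let U : V.Opens := ⟨pc c g, hopen _ hg c⟩
    obtain ⟨l, hl, -⟩ := (hO c).existsUnique (U.ι ≫ g) (by
      rw [hpc c]
      ext x
      simp only [Set.mem_preimage, Set.mem_univ, iff_true]
      exact x.2)
    exact ⟨U, hc, l ≫ (O c).ι, by rw [Category.assoc, hl]⟩
  exact ⟨l, hl, fun l' hl' ↦ huniq _ _ (by rw [hl']; exact hg) (hl'.trans hl.symm)⟩

/-- Two universal objects for the same condition are isomorphic. -/
theorem IsUniversal.exists_iso {X Y Y' : Scheme.{u}} {p : PointCondition X} {π : Y ⟶ X}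
    {π' : Y' ⟶ X} (h : IsUniversal p π) (h' : IsUniversal p π') :
    ∃ e : Y ≅ Y', e.hom ≫ π' = π := by
  obtain ⟨a, ha, -⟩ := h'.existsUnique π h.self
  obtain ⟨b, hb, -⟩ := h.existsUnique π' h'.self
  refine ⟨⟨a, b, ?_, ?_⟩, ha⟩
  · exact h.hom_ext (by rw [Category.assoc, hb, ha, h.self]) (by simp [ha, hb])
  · exact h'.hom_ext (by rw [Category.assoc, ha, hb, h'.self]) (by simp [ha, hb])

/-- The open subscheme of a universal object on which an open subcondition holds is universal
for that subcondition. -/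
theorem IsUniversal.restrict {X Y : Scheme.{u}} {p q : PointCondition X} {π : Y ⟶ X}
    (h : IsUniversal p π) (hqp : q.IsOpenIn p)
    (hle : ∀ {V : Scheme.{u}} (g : V ⟶ X), q g = Set.univ → p g = Set.univ)
    (O : Y.Opens) (hO : (O : Set Y) = q π) : IsUniversal q (O.ι ≫ π) := by
  refine ⟨?_, fun {V} g hg ↦ ?_⟩
  · rw [hqp.isLocal, ← hO]
    ext x
    simp only [Set.mem_preimage, Set.mem_univ, iff_true]
    exact x.2
  · obtain ⟨l, rfl, hu⟩ := h.existsUnique g (hle g hg)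
    have hr : Set.range l ⊆ Set.range O.ι := by
      rintro _ ⟨v, rfl⟩
      have := hqp.preimage l π h.self (hle _ hg)
      rw [hg] at this
      rw [Scheme.Opens.range_ι, hO]
      exact this.le (Set.mem_univ v)
    refine ⟨IsOpenImmersion.lift O.ι l hr, by simp, fun m hm ↦ ?_⟩
    rw [← cancel_mono O.ι, IsOpenImmersion.lift_fac]
    exact hu _ (by simpa using hm)

/-- A universal object for an open subcondition is an open subscheme of the universal object. -/
theorem IsUniversal.exists_isOpenImmersion {X Y U : Scheme.{u}} {p q : PointCondition X}
    {π : Y ⟶ X} {ψ : U ⟶ X} (h : IsUniversal p π) (h' : IsUniversal q ψ) (hqp : q.IsOpenIn p)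
    (hle : ∀ {V : Scheme.{u}} (g : V ⟶ X), q g = Set.univ → p g = Set.univ) :
    ∃ φ : U ⟶ Y, IsOpenImmersion φ ∧ φ ≫ π = ψ ∧ Set.range φ = q π := by
  let O : Y.Opens := ⟨q π, hqp.isOpen π h.self⟩
  obtain ⟨e, he⟩ := h'.exists_iso (h.restrict hqp hle O rfl)
  refine ⟨e.hom ≫ O.ι, inferInstance, by simpa using he, ?_⟩
  rw [← Scheme.Hom.coe_opensRange, Scheme.Hom.opensRange_comp_of_isIso, Scheme.Opens.opensRange_ι]
  rfl

theorem IsUniversal.of_iso {X Y Y' : Scheme.{u}} {p : PointCondition X} (hp : p.IsLocal)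
    {π : Y ⟶ X} (h : IsUniversal p π) (e : Y' ≅ Y) : IsUniversal p (e.hom ≫ π) := by
  refine ⟨by rw [hp, h.self, Set.preimage_univ], fun {V} g hg ↦ ?_⟩
  obtain ⟨l, rfl, hu⟩ := h.existsUnique g hg
  refine ⟨l ≫ e.inv, by simp, fun m hm ↦ ?_⟩
  rw [← hu (m ≫ e.hom) (by simpa using hm)]
  simp

theorem PointCondition.IsLocal.inter {X : Scheme.{u}} {p q : PointCondition X} (hp : p.IsLocal)
    (hq : q.IsLocal) : PointCondition.IsLocal (fun _ g ↦ p g ∩ q g : PointCondition X) := by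
  intro V' V j _ g
  exact (congrArg₂ (· ∩ ·) (hp j g) (hq j g))

theorem PointCondition.IsLocal.union {X : Scheme.{u}} {p q : PointCondition X} (hp : p.IsLocal)
    (hq : q.IsLocal) : PointCondition.IsLocal (fun _ g ↦ p g ∪ q g : PointCondition X) := by
  intro V' V j _ g
  exact (congrArg₂ (· ∪ ·) (hp j g) (hq j g))

/-- Universal objects for two open subconditions of their disjunction glue to a universal object
for the disjunction: the loci where both conditions hold are canonically isomorphic. -/
theorem IsUniversal.exists_union {X Y₁ Y₂ : Scheme.{u}} {p₁ p₂ : PointCondition X}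
    {π₁ : Y₁ ⟶ X} {π₂ : Y₂ ⟶ X} (h₁ : IsUniversal p₁ π₁) (h₂ : IsUniversal p₂ π₂)
    (hp₁ : p₁.IsOpenIn fun _ g ↦ p₁ g ∪ p₂ g) (hp₂ : p₂.IsOpenIn fun _ g ↦ p₁ g ∪ p₂ g) :
    ∃ (Y : Scheme.{u}) (π : Y ⟶ X) (i₁ : Y₁ ⟶ Y) (i₂ : Y₂ ⟶ Y),
      IsUniversal (fun _ g ↦ p₁ g ∪ p₂ g) π ∧ IsOpenImmersion i₁ ∧ IsOpenImmersion i₂ ∧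
      i₁ ≫ π = π₁ ∧ i₂ ≫ π = π₂ ∧ ∀ y : Y, y ∈ Set.range i₁ ∨ y ∈ Set.range i₂ := by
  have l₁ := hp₁.isLocal
  have l₂ := hp₂.isLocal
  have u₁ : ∀ {V : Scheme.{u}} (g : V ⟶ X), p₁ g = Set.univ → p₁ g ∪ p₂ g = Set.univ :=
    fun g hg ↦ by rw [hg, Set.univ_union]
  have u₂ : ∀ {V : Scheme.{u}} (g : V ⟶ X), p₂ g = Set.univ → p₁ g ∪ p₂ g = Set.univ :=
    fun g hg ↦ by rw [hg, Set.union_univ]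
  have o₁ : PointCondition.IsOpenIn (fun _ g ↦ p₁ g ∩ p₂ g) p₁ :=
    ⟨l₁.inter l₂, fun g hg ↦ (hp₁.isOpen g (u₁ g hg)).inter (hp₂.isOpen g (u₁ g hg)),
      fun l π hπ hl ↦ by
        rw [hp₁.preimage l π (u₁ _ hπ) (u₁ _ hl), hp₂.preimage l π (u₁ _ hπ) (u₁ _ hl),
          Set.preimage_inter]⟩
  have o₂ : PointCondition.IsOpenIn (fun _ g ↦ p₁ g ∩ p₂ g) p₂ :=
    ⟨l₁.inter l₂, fun g hg ↦ (hp₁.isOpen g (u₂ g hg)).inter (hp₂.isOpen g (u₂ g hg)),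
      fun l π hπ hl ↦ by
        rw [hp₁.preimage l π (u₂ _ hπ) (u₂ _ hl), hp₂.preimage l π (u₂ _ hπ) (u₂ _ hl),
          Set.preimage_inter]⟩
  let O₁ : Y₁.Opens := ⟨p₁ π₁ ∩ p₂ π₁, o₁.isOpen π₁ h₁.self⟩
  have r₁ := h₁.restrict o₁ (fun g hg ↦ Set.univ_subset_iff.1 (hg ▸ Set.inter_subset_left)) O₁ rfl
  obtain ⟨j, hj, hjπ, hjr⟩ := h₂.exists_isOpenImmersion r₁ o₂
    (fun g hg ↦ Set.univ_subset_iff.1 (hg ▸ Set.inter_subset_right))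
  let Y := pushout O₁.ι j
  let i₁ : Y₁ ⟶ Y := pushout.inl O₁.ι j
  let i₂ : Y₂ ⟶ Y := pushout.inr O₁.ι j
  have oi₁ : IsOpenImmersion i₁ :=
    inferInstanceAs (IsOpenImmersion (colimit.ι (span O₁.ι j) WalkingSpan.left))
  have oi₂ : IsOpenImmersion i₂ :=
    inferInstanceAs (IsOpenImmersion (colimit.ι (span O₁.ι j) WalkingSpan.right))
  let π : Y ⟶ X := pushout.desc π₁ π₂ hjπ.symm
  have e₁ : i₁ ≫ π = π₁ := pushout.inl_desc _ _ _
  have e₂ : i₂ ≫ π = π₂ := pushout.inr_desc _ _ _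
  have hsurj : ∀ y : Y, y ∈ Set.range i₁ ∨ y ∈ Set.range i₂ := by
    intro y
    obtain ⟨i, x, rfl⟩ := Scheme.IsLocallyDirected.ι_jointly_surjective (span O₁.ι j) y
    rcases i with _ | _ | _
    · exact Or.inl ⟨O₁.ι x, congr($(colimit.w (span O₁.ι j) WalkingSpan.Hom.fst) x)⟩
    · exact Or.inl ⟨x, rfl⟩
    · exact Or.inr ⟨x, rfl⟩
  have hself : p₁ π ∪ p₂ π = Set.univ := by
    refine Set.eq_univ_of_forall fun y ↦ ?_
    rcases hsurj y with ⟨x, rfl⟩ | ⟨x, rfl⟩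
    · refine Or.inl ?_
      change x ∈ i₁ ⁻¹' p₁ π
      rw [← l₁, e₁, h₁.self]
      trivial
    · refine Or.inr ?_
      change x ∈ i₂ ⁻¹' p₂ π
      rw [← l₂, e₂, h₂.self]
      trivial
  refine ⟨Y, π, i₁, i₂, ?_, oi₁, oi₂, e₁, e₂, hsurj⟩
  refine IsUniversal.of_cover (ι := Bool) (l₁.union l₂) (fun c ↦ bif c then p₁ else p₂)
    (by rintro (_ | _) <;> assumption)
    (by rintro V g hg (_ | _); exacts [hp₂.isOpen g hg, hp₁.isOpen g hg])
    (fun g hg v ↦ (show v ∈ p₁ g ∪ p₂ g from hg ▸ Set.mem_univ v).elim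
      (fun h ↦ ⟨true, h⟩) fun h ↦ ⟨false, h⟩) hself
    (fun c ↦ bif c then i₁.opensRange else i₂.opensRange) ?_ ?_
  · rintro (_ | _)
    · have := h₂.of_iso l₂ i₂.isoOpensRange.symm
      rw [← e₂, Iso.symm_hom, Scheme.Hom.isoOpensRange_inv_comp_assoc] at this
      exact this
    · have := h₁.of_iso l₁ i₁.isoOpensRange.symm
      rw [← e₁, Iso.symm_hom, Scheme.Hom.isoOpensRange_inv_comp_assoc] at this
      exact this
  · rintro V l (_ | _) hl v hv
    · have hv : l v ∈ p₂ π := (hp₂.preimage l π hself hl).le hv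
      rcases hsurj (l v) with ⟨x, hx⟩ | h
      · have hx2 : x ∈ p₂ π₁ := by
          rw [← e₁, l₂]
          simpa [hx] using hv
        let x' : O₁ := ⟨x, h₁.self ▸ Set.mem_univ x, hx2⟩
        refine ⟨j x', ?_⟩
        rw [← hx]
        exact congr($(pushout.condition (f := O₁.ι) (g := j)) x').symm
      · exact h
    · have hv : l v ∈ p₁ π := (hp₁.preimage l π hself hl).le hv
      rcases hsurj (l v) with h | ⟨x, hx⟩
      · exact h
      · have hx1 : x ∈ p₁ π₂ := by
          rw [← e₂, l₁]
          simpa [hx] using hv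
        obtain ⟨x', rfl⟩ := hjr.ge ⟨hx1, h₂.self ▸ Set.mem_univ x⟩
        refine ⟨O₁.ι x', ?_⟩
        rw [← hx]
        exact congr($(pushout.condition (f := O₁.ι) (g := j)) x')

/-! ### Functions of an affine target in the stalks of the source -/

/-- The ring homomorphism from `R` to the global sections given by a morphism to `Spec R`. -/
def sections {R : CommRingCat.{u}} {V : Scheme.{u}} (g : V ⟶ Spec R) : R →+* Γ(V, ⊤) :=
  ((Scheme.ΓSpecIso R).inv ≫ g.appTop).hom

/-- The ring homomorphism from `R` to the stalk at a point given by a morphism to `Spec R`. -/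
def stalkHom {R : CommRingCat.{u}} {V : Scheme.{u}} (g : V ⟶ Spec R) (v : V) :
    R →+* V.presheaf.stalk v :=
  (V.presheaf.germ ⊤ v (Opens.mem_top v)).hom.comp (sections g)

theorem stalkHom_apply {R : CommRingCat.{u}} {V : Scheme.{u}} (g : V ⟶ Spec R) (v : V) (r : R) :
    stalkHom g v r = V.presheaf.germ ⊤ v (Opens.mem_top v) (sections g r) := rfl

theorem sections_comp {R : CommRingCat.{u}} {V' V : Scheme.{u}} (h : V' ⟶ V) (g : V ⟶ Spec R) :
    sections (h ≫ g) = h.appTop.hom.comp (sections g) := rfl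

theorem stalkHom_comp {R : CommRingCat.{u}} {V' V : Scheme.{u}} (h : V' ⟶ V) (g : V ⟶ Spec R)
    (v : V') (r : R) : stalkHom (h ≫ g) v r = h.stalkMap v (stalkHom g (h v) r) := by
  rw [stalkHom_apply, stalkHom_apply]
  exact (Scheme.Hom.germ_stalkMap_apply h ⊤ v (Opens.mem_top _) _).symm

theorem sections_comp_map {R A : CommRingCat.{u}} {V : Scheme.{u}} (g : V ⟶ Spec A) (φ : R ⟶ A) :
    sections (g ≫ Spec.map φ) = (sections g).comp φ.hom := by
  have : (Scheme.ΓSpecIso R).inv ≫ (Spec.map φ).appTop = φ ≫ (Scheme.ΓSpecIso A).inv :=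
    (Scheme.ΓSpecIso_inv_naturality φ).symm
  rw [sections, Scheme.Hom.comp_appTop, reassoc_of% this]
  rfl

theorem stalkHom_comp_map {R A : CommRingCat.{u}} {V : Scheme.{u}} (g : V ⟶ Spec A) (φ : R ⟶ A)
    (v : V) (r : R) : stalkHom (g ≫ Spec.map φ) v r = stalkHom g v (φ r) := by
  rw [stalkHom_apply, sections_comp_map]
  rfl

theorem stalkHom_map {R A : Type u} [CommRing R] [CommRing A] (φ : R →+* A)
    (x : Spec (CommRingCat.of A)) (r : R) :
    stalkHom (Spec.map (CommRingCat.ofHom φ)) x r =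
      stalkHom (𝟙 (Spec (CommRingCat.of A))) x (φ r) := by
  have := stalkHom_comp_map (𝟙 (Spec (CommRingCat.of A))) (CommRingCat.ofHom φ) x r
  rwa [Category.id_comp] at this

theorem isLocalization_stalkHom_id {R : CommRingCat.{u}} (x : PrimeSpectrum R) :
    letI := (stalkHom (𝟙 (Spec R)) x).toAlgebra
    IsLocalization.AtPrime ((Spec R).presheaf.stalk x) x.asIdeal := by
  have e : stalkHom (𝟙 (Spec R)) x =
      @algebraMap R ((Spec R).presheaf.stalk x) _ _ (StructureSheaf.stalkAlgebra R x) := by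
    ext r
    simp [stalkHom, sections]
    rfl
  rw [e]
  convert! StructureSheaf.IsLocalization.to_stalk R x

theorem hom_ext_sections {R : Type u} [CommRing R] {V : Scheme.{u}}
    {g g' : V ⟶ Spec (CommRingCat.of R)} (h : sections g = sections g') : g = g' :=
  ext_to_Spec (CommRingCat.hom_ext h)

theorem exists_sections_eq {R : Type u} [CommRing R] {V : Scheme.{u}} (χ : R →+* Γ(V, ⊤)) :
    ∃ g : V ⟶ Spec (CommRingCat.of R), sections g = χ := by
  refine ⟨V.toSpecΓ ≫ Spec.map (CommRingCat.ofHom χ), ?_⟩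
  rw [sections_comp_map]
  ext r
  simp [sections]

/-! ### Nonzerodivisors and divisibility in stalks -/

theorem mem_nonZeroDivisors_of_germ {V : Scheme.{u}} {U : V.Opens} (a : Γ(V, U))
    (h : ∀ x (hx : x ∈ U), V.presheaf.germ U x hx a ∈ nonZeroDivisors (V.presheaf.stalk x)) :
    a ∈ nonZeroDivisors Γ(V, U) := by
  rw [mem_nonZeroDivisors_iff_right]
  intro s hs
  refine TopCat.Presheaf.section_ext V.sheaf U s 0 fun x hx ↦ ?_
  have := congr(V.presheaf.germ U x hx $hs)
  rw [map_mul, map_zero] at this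
  exact (((mem_nonZeroDivisors_iff_right.1 (h x hx)) _ this).trans
    (map_zero (V.presheaf.germ U x hx).hom).symm)

theorem germ_mem_nonZeroDivisors {V : Scheme.{u}} {U : V.Opens} (hU : IsAffineOpen U)
    {a : Γ(V, U)} (ha : a ∈ nonZeroDivisors Γ(V, U)) (x : V) (hx : x ∈ U) :
    V.presheaf.germ U x hx a ∈ nonZeroDivisors (V.presheaf.stalk x) := by
  let := TopCat.Presheaf.algebra_section_stalk V.presheaf (⟨x, hx⟩ : U)
  have : IsLocalization.AtPrime (V.presheaf.stalk x) (hU.primeIdealOf ⟨x, hx⟩).asIdeal :=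
    hU.isLocalization_stalk ⟨x, hx⟩
  exact IsLocalization.map_nonZeroDivisors_le (hU.primeIdealOf ⟨x, hx⟩).asIdeal.primeCompl _
    ⟨a, ha, rfl⟩

/-- Divisibility by a section that is a nonzerodivisor in all stalks can be checked in the
stalks, as the quotients are unique. -/
theorem dvd_of_germ_dvd {V : Scheme.{u}} (a b : Γ(V, ⊤))
    (ha : ∀ x, V.presheaf.germ ⊤ x (Opens.mem_top x) a ∈ nonZeroDivisors (V.presheaf.stalk x))
    (h : ∀ x, V.presheaf.germ ⊤ x (Opens.mem_top x) a ∣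
      V.presheaf.germ ⊤ x (Opens.mem_top x) b) : a ∣ b := by
  have hloc : ∀ x : V, ∃ (U : V.Opens) (_ : x ∈ U) (s : Γ(V, U)), ∀ y (hy : y ∈ U),
      V.presheaf.germ ⊤ y (Opens.mem_top y) b =
        V.presheaf.germ ⊤ y (Opens.mem_top y) a * V.presheaf.germ U y hy s := by
    intro x
    obtain ⟨t, ht⟩ := h x
    obtain ⟨U, hxU, s, rfl⟩ := V.presheaf.exists_germ_eq t
    have : V.presheaf.germ U x hxU (V.presheaf.map (homOfLE le_top).op b) =
        V.presheaf.germ U x hxU (V.presheaf.map (homOfLE le_top).op a * s) := by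
      rw [map_mul, TopCat.Presheaf.germ_res_apply, TopCat.Presheaf.germ_res_apply]
      exact ht
    obtain ⟨W, hxW, i, i', e⟩ := V.presheaf.germ_eq x hxU hxU _ _ this
    refine ⟨W, hxW, V.presheaf.map i.op s, fun y hy ↦ ?_⟩
    have e' := congr(V.presheaf.germ W y hy $e)
    rw [TopCat.Presheaf.germ_res_apply, TopCat.Presheaf.germ_res_apply, map_mul, map_mul,
      TopCat.Presheaf.germ_res_apply, TopCat.Presheaf.germ_res_apply,
      TopCat.Presheaf.germ_res_apply] at e'
    rw [TopCat.Presheaf.germ_res_apply]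
    exact e'
  choose U hU s hs using hloc
  have hcomp : TopCat.Presheaf.IsCompatible V.presheaf U s := by
    intro x y
    refine TopCat.Presheaf.section_ext V.sheaf _ _ _ fun z hz ↦ ?_
    erw [TopCat.Presheaf.germ_res_apply, TopCat.Presheaf.germ_res_apply]
    exact (mul_cancel_left_mem_nonZeroDivisors (ha z)).1
      ((hs x z hz.1).symm.trans (hs y z hz.2))
  obtain ⟨t, ht, -⟩ := V.sheaf.existsUnique_gluing' U ⊤ (fun x ↦ homOfLE le_top)
    (fun x _ ↦ Opens.mem_iSup.2 ⟨x, hU x⟩) s hcomp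
  refine ⟨t, TopCat.Presheaf.section_ext V.sheaf ⊤ _ _ fun x hx ↦ ?_⟩
  have e : V.presheaf.germ ⊤ x (Opens.mem_top x) t = V.presheaf.germ (U x) x (hU x) (s x) := by
    rw [← ht x]
    exact (TopCat.Presheaf.germ_res_apply V.presheaf (homOfLE le_top) x (hU x) t).symm
  refine (hs x x (hU x)).trans ?_
  rw [← e]
  exact (map_mul _ _ _).symm

theorem mem_nonZeroDivisors_equiv_iff {A B : Type*} [CommRing A] [CommRing B] (e : A ≃+* B)
    {a : A} : e a ∈ nonZeroDivisors B ↔ a ∈ nonZeroDivisors A := by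
  rw [← MulEquivClass.map_nonZeroDivisors e]
  exact ⟨fun ⟨x, hx, h⟩ ↦ e.injective h ▸ hx, fun h ↦ ⟨a, h, rfl⟩⟩

/-- The condition that `a` is a nonzerodivisor dividing `b`. -/
def Divides {R : Type u} [CommRing R] (a b : R) : PointCondition (Spec (CommRingCat.of R)) :=
  fun _ g ↦ {v | stalkHom g v a ∈ nonZeroDivisors _ ∧ stalkHom g v a ∣ stalkHom g v b}

/-- The condition that the ideal `(a, b)` is generated by a nonzerodivisor, in the form it takes
in local rings: one of `a`, `b` is a nonzerodivisor dividing the other. -/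
def Principal {R : Type u} [CommRing R] (a b : R) : PointCondition (Spec (CommRingCat.of R)) :=
  fun _ g ↦ Divides a b g ∪ Divides b a g

theorem Divides.isLocal {R : Type u} [CommRing R] (a b : R) : (Divides a b).IsLocal := by
  intro V' V j _ g
  ext v
  let e := (asIso (j.stalkMap v)).commRingCatIsoToRingEquiv
  have he : ∀ r, stalkHom (j ≫ g) v r = e (stalkHom g (j v) r) := fun r ↦ stalkHom_comp j g v r
  change _ ∧ _ ↔ _ ∧ _
  rw [he, he, mem_nonZeroDivisors_equiv_iff, map_dvd_iff]

theorem Principal.isLocal {R : Type u} [CommRing R] (a b : R) : (Principal a b).IsLocal :=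
  (Divides.isLocal a b).union (Divides.isLocal b a)

theorem Divides.dvd {R : Type u} [CommRing R] {a b : R} {V : Scheme.{u}}
    {g : V ⟶ Spec (CommRingCat.of R)} (h : Divides a b g = Set.univ) :
    sections g a ∈ nonZeroDivisors _ ∧ sections g a ∣ sections g b :=
  ⟨mem_nonZeroDivisors_of_germ _ fun x _ ↦ (h.ge (Set.mem_univ x)).1,
    dvd_of_germ_dvd _ _ (fun x ↦ (h.ge (Set.mem_univ x)).1) fun x ↦ (h.ge (Set.mem_univ x)).2⟩

theorem mem_nonZeroDivisors_of_dvd {A : Type*} [CommRing A] {a b : A} (h : a ∣ b)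
    (hb : b ∈ nonZeroDivisors A) : a ∈ nonZeroDivisors A := by
  obtain ⟨c, rfl⟩ := h
  exact (mul_mem_nonZeroDivisors.1 hb).1

/-- Where `(a, b)` is principal, divisibility of `b` by `a` already forces `a` to be a
nonzerodivisor. -/
theorem mem_divides_of_dvd {R : Type u} [CommRing R] {a b : R} {V : Scheme.{u}}
    {g : V ⟶ Spec (CommRingCat.of R)} {v : V} (h : v ∈ Principal a b g)
    (hv : stalkHom g v a ∣ stalkHom g v b) : v ∈ Divides a b g :=
  h.elim id fun h ↦ ⟨mem_nonZeroDivisors_of_dvd hv h.1, hv⟩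

/-- Where `(a, b)` is principal, the locus where `a` generates it is open and compatible with
arbitrary morphisms: pulling back a relation `a = c b` along a local homomorphism, a common
generator forces `c` to be a unit. -/
theorem Divides.isOpenIn {R : Type u} [CommRing R] (a b : R) :
    (Divides a b).IsOpenIn (Principal a b) where
  isLocal := Divides.isLocal a b
  isOpen {V} g hg := by
    rw [isOpen_iff_forall_mem_open]
    rintro x ⟨hx, t, ht⟩
    obtain ⟨U, hxU, s, rfl⟩ := V.presheaf.exists_germ_eq t
    have : V.presheaf.germ U x hxU (V.presheaf.map (homOfLE le_top).op (sections g b)) =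
        V.presheaf.germ U x hxU (V.presheaf.map (homOfLE le_top).op (sections g a) * s) := by
      rw [map_mul, TopCat.Presheaf.germ_res_apply, TopCat.Presheaf.germ_res_apply]
      exact ht
    obtain ⟨W, hxW, i, i', e⟩ := V.presheaf.germ_eq x hxU hxU _ _ this
    refine ⟨W, fun y hy ↦ mem_divides_of_dvd (hg.ge (Set.mem_univ y)) ?_, W.isOpen, hxW⟩
    have e' := congr(V.presheaf.germ W y hy $e)
    rw [TopCat.Presheaf.germ_res_apply, TopCat.Presheaf.germ_res_apply, map_mul, map_mul,
      TopCat.Presheaf.germ_res_apply, TopCat.Presheaf.germ_res_apply] at e'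
    exact ⟨_, e'⟩
  preimage {V Y} l π hπ hl := by
    ext v
    refine ⟨fun ⟨h1, h2⟩ ↦ ?_, fun ⟨h1, h2⟩ ↦ ?_⟩
    · rcases hπ.ge (Set.mem_univ (l v)) with h | ⟨h3, c, hc⟩
      · exact h
      · refine ⟨?_, ?_⟩
        all_goals
          have hu : IsUnit c := by
            refine isUnit_of_map_unit (l.stalkMap v).hom c ?_
            obtain ⟨d, hd⟩ := h2
            have e := stalkHom_comp l π v a
            rw [hc, map_mul, ← stalkHom_comp, hd, mul_assoc] at e
            refine IsUnit.of_mul_eq_one_right d ((mul_cancel_left_mem_nonZeroDivisors h1).1 ?_)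
            rw [← e, mul_one]
        · rw [hc]
          exact mul_mem h3 hu.mem_nonZeroDivisors
        · rw [hc]
          obtain ⟨u, rfl⟩ := hu
          exact ⟨↑u⁻¹, by rw [mul_assoc, Units.mul_inv, mul_one]⟩
    · refine mem_divides_of_dvd (hl.ge (Set.mem_univ v)) ?_
      rw [stalkHom_comp, stalkHom_comp]
      exact map_dvd (l.stalkMap v).hom h2

/-- A ring with the universal property of adjoining the quotients `b i / a i` represents the
condition that each `a i` is a nonzerodivisor dividing `b i`. -/
theorem isUniversal_Spec {R A : Type u} [CommRing R] [CommRing A] {ι : Type*} (φ : R →+* A)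
    (a b : ι → R) (h₁ : ∀ i, φ (a i) ∈ nonZeroDivisors A) (h₂ : ∀ i, φ (a i) ∣ φ (b i))
    (h₃ : ∀ (B : Type u) [CommRing B] (ψ : R →+* B), (∀ i, ψ (a i) ∈ nonZeroDivisors B) →
      (∀ i, ψ (a i) ∣ ψ (b i)) → ∃! χ : A →+* B, χ.comp φ = ψ) :
    IsUniversal (fun _ g ↦ {v | ∀ i, v ∈ Divides (a i) (b i) g})
      (Spec.map (CommRingCat.ofHom φ)) := by
  constructor
  · refine Set.eq_univ_of_forall fun x i ↦ ?_
    change _ ∧ _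
    rw [stalkHom_map, stalkHom_map]
    refine ⟨?_, map_dvd _ (h₂ i)⟩
    let := (stalkHom (𝟙 (Spec (CommRingCat.of A))) x).toAlgebra
    let x' : PrimeSpectrum A := x
    have := isLocalization_stalkHom_id (R := CommRingCat.of A) x'
    exact IsLocalization.map_nonZeroDivisors_le x'.asIdeal.primeCompl _ ⟨_, h₁ i, rfl⟩
  · intro V g hg
    have hd := fun i ↦ Divides.dvd (g := g) (a := a i) (b := b i)
      (Set.eq_univ_of_forall fun v ↦ hg.ge (Set.mem_univ v) i)
    obtain ⟨χ, hχ, hu⟩ := h₃ _ (sections g) (fun i ↦ (hd i).1) fun i ↦ (hd i).2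
    obtain ⟨l, hl⟩ := exists_sections_eq χ
    refine ⟨l, hom_ext_sections ?_, fun m hm ↦ hom_ext_sections ?_⟩
    · rw [sections_comp_map, hl]
      exact hχ
    · rw [hl]
      refine hu _ ?_
      change _ = sections g
      rw [← hm, sections_comp_map]
      rfl

/-! ### Ideal sheaves on affine schemes and their pullbacks -/

theorem idealSheaf_ideal_top {R : Type u} [CommRing R] (I : Ideal R) :
    (idealSheaf R I).ideal ⟨⊤, isAffineOpen_top _⟩ =
      I.map (Scheme.ΓSpecIso (CommRingCat.of R)).inv.hom := by
  simp [idealSheaf]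

theorem comap_idealSheaf {R : Type u} [CommRing R] (I : Ideal R) {V : Scheme.{u}} [IsAffine V]
    (g : V ⟶ Spec (CommRingCat.of R)) :
    (idealSheaf R I).comap g = Scheme.IdealSheafData.ofIdealTop (I.map (sections g)) := by
  refine eq_of_forall_ge_iff fun J ↦ ?_
  rw [← Scheme.IdealSheafData.le_map_iff_comap_le]
  have h1 : ∀ J' : (Spec (CommRingCat.of R)).IdealSheafData, idealSheaf R I ≤ J' ↔
      I.map (Scheme.ΓSpecIso (CommRingCat.of R)).inv.hom ≤ J'.ideal ⟨⊤, isAffineOpen_top _⟩ :=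
    fun J' ↦ ⟨fun h ↦ by rw [← idealSheaf_ideal_top]; exact h _,
      fun h ↦ Scheme.IdealSheafData.le_of_isAffine (by rw [idealSheaf_ideal_top]; exact h)⟩
  have h2 : Scheme.IdealSheafData.ofIdealTop (I.map (sections g)) ≤ J ↔
      I.map (sections g) ≤ J.ideal ⟨⊤, isAffineOpen_top _⟩ :=
    ⟨fun h ↦ by simpa using h ⟨⊤, isAffineOpen_top _⟩,
      fun h ↦ Scheme.IdealSheafData.le_of_isAffine (by simpa using h)⟩
  rw [h1, h2, Scheme.IdealSheafData.ideal_map_of_isAffineHom, Ideal.map_le_iff_le_comap,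
    Ideal.map_le_iff_le_comap, Ideal.comap_comap]
  rfl

theorem sections_map {R A : Type u} [CommRing R] [CommRing A] (φ : R →+* A) :
    sections (Spec.map (CommRingCat.ofHom φ)) =
      (Scheme.ΓSpecIso (CommRingCat.of A)).inv.hom.comp φ := by
  have := sections_comp_map (𝟙 (Spec (CommRingCat.of A))) (CommRingCat.ofHom φ)
  rw [Category.id_comp] at this
  rw [this]
  ext r
  simp [sections]

theorem comap_idealSheaf_map {R A : Type u} [CommRing R] [CommRing A] (I : Ideal R) (φ : R →+* A) :
    (idealSheaf R I).comap (Spec.map (CommRingCat.ofHom φ)) = idealSheaf A (I.map φ) := by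
  rw [comap_idealSheaf, sections_map, ← Ideal.map_map]
  rfl

theorem idealSheaf_injective {R : Type u} [CommRing R] : Function.Injective (idealSheaf R) := by
  intro I J h
  have := congrArg (fun K ↦ K.ideal ⟨⊤, isAffineOpen_top _⟩) h
  simp only [idealSheaf_ideal_top] at this
  have e := congrArg (Ideal.comap (Scheme.ΓSpecIso (CommRingCat.of R)).inv.hom) this
  have hb := ConcreteCategory.bijective_of_isIso (Scheme.ΓSpecIso (CommRingCat.of R)).inv
  rwa [Ideal.comap_map_of_bijective _ hb, Ideal.comap_map_of_bijective _ hb] at e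

theorem idealSheaf_support {R : Type u} [CommRing R] (I : Ideal R) :
    ((idealSheaf R I).support : Set (Spec (CommRingCat.of R))) = PrimeSpectrum.zeroLocus I := by
  rw [idealSheaf, Scheme.IdealSheafData.coe_support_ofIdealTop, Ideal.map, Scheme.zeroLocus_span]
  exact Spec_zeroLocus_eq_zeroLocus _

theorem idealSheaf_mono {R : Type u} [CommRing R] {I J : Ideal R} (h : I ≤ J) :
    idealSheaf R I ≤ idealSheaf R J :=
  Scheme.IdealSheafData.le_of_isAffine (by
    rw [idealSheaf_ideal_top, idealSheaf_ideal_top]; exact Ideal.map_mono h)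

theorem exists_eq_idealSheaf {R : Type u} [CommRing R]
    (I : (Spec (CommRingCat.of R)).IdealSheafData) :
    ∃ J : Ideal R, I = idealSheaf R J := by
  refine ⟨(I.ideal ⟨⊤, isAffineOpen_top _⟩).comap (Scheme.ΓSpecIso (CommRingCat.of R)).inv.hom,
    Scheme.IdealSheafData.ext_of_isAffine ?_⟩
  rw [idealSheaf_ideal_top, Ideal.map_comap_of_surjective]
  exact (ConcreteCategory.bijective_of_isIso (Scheme.ΓSpecIso (CommRingCat.of R)).inv).2

/-- The restriction of an ideal sheaf to an affine open subset, in terms of its sections there. -/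
theorem comap_fromSpec {V : Scheme.{u}} (I : V.IdealSheafData) {U : V.Opens}
    (hU : IsAffineOpen U) : I.comap hU.fromSpec = idealSheaf Γ(V, U) (I.ideal ⟨U, hU⟩) := by
  refine Scheme.IdealSheafData.ext_of_isAffine ?_
  refine (I.ideal_comap_of_isOpenImmersion hU.fromSpec ⟨⊤, isAffineOpen_top _⟩).trans ?_
  refine (Ideal.comap_symm (hU.fromSpec.appIso ⊤).commRingCatIsoToRingEquiv).trans ?_
  have hW : hU.fromSpec ''ᵁ ⊤ = U := by
    rw [Scheme.Hom.image_top_eq_opensRange, hU.opensRange_fromSpec]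
  have e := I.map_ideal' (V := ⟨U, hU⟩)
    (U := ⟨hU.fromSpec ''ᵁ ⊤, (isAffineOpen_top _).image_of_isOpenImmersion _⟩) (eqToHom hW).op
  have e' : V.presheaf.map (eqToHom hW).op ≫ (hU.fromSpec.appIso ⊤).hom =
      (Scheme.ΓSpecIso Γ(V, U)).inv := by
    rw [Scheme.Hom.appIso_hom', Scheme.Hom.map_appLE, Scheme.Hom.appLE, hU.fromSpec_app_self,
      Category.assoc, ← Functor.map_comp]
    exact (congrArg _ ((Spec Γ(V, U)).presheaf.map_id _)).trans (Category.comp_id _)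
  refine (congrArg _ e.symm).trans ((Ideal.map_map _ _).trans ?_)
  rw [idealSheaf_ideal_top]
  exact congrArg (fun ψ ↦ Ideal.map (CommRingCat.Hom.hom ψ) (I.ideal ⟨U, hU⟩)) e'

/-- The ring homomorphism to the sections over an open subset given by a morphism to `Spec R`. -/
def sectionsOn {R : CommRingCat.{u}} {V : Scheme.{u}} (g : V ⟶ Spec R) (U : V.Opens) :
    R →+* Γ(V, U) :=
  (V.presheaf.map (homOfLE le_top).op).hom.comp (sections g)

theorem fromSpec_comp {R : Type u} [CommRing R] {V : Scheme.{u}} (g : V ⟶ Spec (CommRingCat.of R))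
    {U : V.Opens} (hU : IsAffineOpen U) :
    hU.fromSpec ≫ g = Spec.map (CommRingCat.ofHom (sectionsOn g U)) := by
  refine hom_ext_sections ?_
  rw [sections_map, sections_comp]
  have := hU.fromSpec_app_of_le ⊤ le_top
  have e : hU.fromSpec.appTop = V.presheaf.map (homOfLE le_top).op ≫
      (Scheme.ΓSpecIso Γ(V, U)).inv := by
    refine this.trans (congrArg _ ?_)
    exact (congrArg _ ((Spec Γ(V, U)).presheaf.map_id _)).trans (Category.comp_id _)
  rw [e]
  rfl

theorem comap_idealSheaf_ideal {R : Type u} [CommRing R] (I : Ideal R) {V : Scheme.{u}}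
    (g : V ⟶ Spec (CommRingCat.of R)) (U : V.affineOpens) :
    ((idealSheaf R I).comap g).ideal U = I.map (sectionsOn g U.1) := by
  obtain ⟨U, hU⟩ := U
  have hU : IsAffineOpen U := hU
  refine idealSheaf_injective ((comap_fromSpec _ hU).symm.trans ?_)
  rw [← Scheme.IdealSheafData.comap_comp, fromSpec_comp, comap_idealSheaf_map]

theorem vanishingIdeal_comap {V' V : Scheme.{u}} (j : V' ⟶ V) [IsOpenImmersion j] (C : Closeds V) :
    (Scheme.IdealSheafData.vanishingIdeal C).comap j =
      Scheme.IdealSheafData.vanishingIdeal (C.preimage j.continuous) := by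
  have e : ((Scheme.IdealSheafData.vanishingIdeal C).comap j).support =
      C.preimage j.continuous := by
    rw [Scheme.IdealSheafData.support_comap]
    congr 1
  rw [← e, Scheme.IdealSheafData.vanishingIdeal_support]
  ext U : 2
  rw [Scheme.IdealSheafData.radical_ideal, Scheme.IdealSheafData.ideal_comap_of_isOpenImmersion]
  refine (Ideal.IsRadical.comap _ ?_).radical.symm
  rw [Scheme.IdealSheafData.vanishingIdeal_ideal]
  exact PrimeSpectrum.isRadical_vanishingIdeal _

theorem vanishingIdeal_zeroLocus {R : Type u} [CommRing R] {I : Ideal R} (hI : I.IsRadical)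
    (C : Closeds (Spec (CommRingCat.of R)))
    (hC : (C : Set (Spec (CommRingCat.of R))) = PrimeSpectrum.zeroLocus I) :
    Scheme.IdealSheafData.vanishingIdeal C = idealSheaf R I := by
  have : C = (idealSheaf R I).support := by
    ext1
    rw [hC, idealSheaf_support]
  rw [this, Scheme.IdealSheafData.vanishingIdeal_support]
  refine Scheme.IdealSheafData.ext_of_isAffine ?_
  rw [Scheme.IdealSheafData.radical_ideal, idealSheaf_ideal_top]
  refine Ideal.IsRadical.radical ?_
  have := hI.comap (Scheme.ΓSpecIso (CommRingCat.of R)).commRingCatIsoToRingEquiv.toRingHom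
  convert! this using 1
  exact (Ideal.comap_symm (Scheme.ΓSpecIso (CommRingCat.of R)).symm.commRingCatIsoToRingEquiv).symm

/-! ### Invertible ideal sheaves with two generators -/

/-- In a local ring a principal ideal with generators `a`, `b` is generated by one of them; so the
inverse image of the ideal sheaf of `(a, b)` is invertible exactly where `Principal a b` holds. -/
theorem isInvertible_comap_iff {R : Type u} [CommRing R] (a b : R) {V : Scheme.{u}}
    (g : V ⟶ Spec (CommRingCat.of R)) :
    IsInvertible ((idealSheaf R (Ideal.span {a, b})).comap g) ↔ Principal a b g = Set.univ := by
  constructor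
  · intro h
    refine Set.eq_univ_of_forall fun x ↦ ?_
    obtain ⟨U, hxU, c, hc, e⟩ := h x
    rw [comap_idealSheaf_ideal, Ideal.map_span, Set.image_pair] at e
    have hc' := germ_mem_nonZeroDivisors U.2 hc x hxU
    set γ := (V.presheaf.germ U.1 x hxU).hom with hγ
    have hst : ∀ r, γ (sectionsOn g U.1 r) = stalkHom g x r := fun r ↦
      TopCat.Presheaf.germ_res_apply _ _ _ _ _
    have ha : sectionsOn g U.1 a ∈ Ideal.span {c} := e ▸ Ideal.subset_span (by simp)
    have hb : sectionsOn g U.1 b ∈ Ideal.span {c} := e ▸ Ideal.subset_span (by simp)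
    have hcm : c ∈ Ideal.span {sectionsOn g U.1 a, sectionsOn g U.1 b} :=
      e ▸ Ideal.mem_span_singleton_self c
    obtain ⟨α, hα⟩ := Ideal.mem_span_singleton.1 ha
    obtain ⟨β, hβ⟩ := Ideal.mem_span_singleton.1 hb
    obtain ⟨r, t, hrt⟩ := Ideal.mem_span_pair.1 hcm
    have h1 : γ r * γ α + γ t * γ β = 1 := by
      refine (mul_cancel_left_mem_nonZeroDivisors (hc' : γ c ∈ _)).1 ?_
      have := congrArg γ hrt
      rw [hα, hβ] at this
      simp only [map_add, map_mul] at this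
      linear_combination this
    have key : ∀ (p q : R) (u v : V.presheaf.stalk x), IsUnit u → stalkHom g x p = γ c * u →
        stalkHom g x q = γ c * v → x ∈ Divides p q g := by
      intro p q u v hu hp hq
      change _ ∧ _
      rw [hp, hq]
      refine ⟨mul_mem hc' hu.mem_nonZeroDivisors, ?_⟩
      obtain ⟨u, rfl⟩ := hu
      exact ⟨↑u⁻¹ * v, by rw [mul_assoc, Units.mul_inv_cancel_left]⟩
    have hα' : stalkHom g x a = γ c * γ α := by rw [← hst, hα, map_mul]
    have hβ' : stalkHom g x b = γ c * γ β := by rw [← hst, hβ, map_mul]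
    rcases IsLocalRing.isUnit_or_isUnit_of_add_one h1 with h | h
    · exact Or.inl (key a b _ _ (isUnit_of_mul_isUnit_right h) hα' hβ')
    · exact Or.inr (key b a _ _ (isUnit_of_mul_isUnit_right h) hβ' hα')
  · intro h x
    have key : ∀ (p q : R), Principal p q g = Set.univ → x ∈ Divides p q g →
        ∃ U : V.affineOpens, x ∈ U.1 ∧ ∃ a ∈ nonZeroDivisors Γ(V, U.1),
          ((idealSheaf R (Ideal.span {p, q})).comap g).ideal U = Ideal.span {a} := by
      intro p q hpq hx
      obtain ⟨_, ⟨U, hU, rfl⟩, hxU, hUO⟩ := V.isBasis_affineOpens.exists_subset_of_mem_open hx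
        ((Divides.isOpenIn p q).isOpen g hpq)
      have hU : IsAffineOpen U := hU
      have h1 : Divides p q (hU.fromSpec ≫ g) = Set.univ := by
        rw [Divides.isLocal]
        refine Set.eq_univ_of_forall fun y ↦ hUO ?_
        rw [← hU.range_fromSpec]
        exact ⟨y, rfl⟩
      obtain ⟨h2, h3⟩ := Divides.dvd h1
      rw [fromSpec_comp, sections_map] at h2 h3
      have h2 := (mem_nonZeroDivisors_equiv_iff
        (Scheme.ΓSpecIso Γ(V, U)).symm.commRingCatIsoToRingEquiv).1 h2
      have h3 := (map_dvd_iff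
        (Scheme.ΓSpecIso Γ(V, U)).symm.commRingCatIsoToRingEquiv).1 h3
      refine ⟨⟨U, hU⟩, hxU, sectionsOn g U p, h2, ?_⟩
      rw [comap_idealSheaf_ideal, Ideal.map_span, Set.image_pair]
      refine le_antisymm (Ideal.span_le.2 ?_) (Ideal.span_mono (by simp))
      rintro _ (rfl | rfl)
      · exact Ideal.mem_span_singleton_self _
      · exact Ideal.mem_span_singleton.2 h3
    rcases h.ge (Set.mem_univ x) with hx | hx
    · exact key a b h hx
    · rw [Set.pair_comm]
      exact key b a (by rw [← h]; exact Set.union_comm _ _) hx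

/-- Blowing up the inverse image of `(a, b)` amounts to representing the condition that `(a, b)`
becomes principal. -/
theorem isBlowup_iff {R : Type u} [CommRing R] (a b : R) {X Y : Scheme.{u}}
    (ρ : X ⟶ Spec (CommRingCat.of R)) (π : Y ⟶ X) :
    IsBlowup ((idealSheaf R (Ideal.span {a, b})).comap ρ) π ↔
      IsUniversal (fun _ g ↦ Principal a b (g ≫ ρ)) π := by
  have e : ∀ {V : Scheme.{u}} (g : V ⟶ X),
      IsInvertible (((idealSheaf R (Ideal.span {a, b})).comap ρ).comap g) ↔
        Principal a b (g ≫ ρ) = Set.univ := fun g ↦ by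
    rw [← Scheme.IdealSheafData.comap_comp, isInvertible_comap_iff]
  exact ⟨fun h ↦ ⟨(e _).1 h.1, fun g hg ↦ h.2 _ g ((e _).2 hg)⟩,
    fun h ↦ ⟨(e _).2 h.1, fun _ g hg ↦ h.2 g ((e _).1 hg)⟩⟩

/-! ### Adjoining a quotient to a ring -/

open Polynomial in
/-- The polynomials over `R` that vanish after substituting `b / a`: those which become multiples
of `a T - b` after multiplication by a power of `a`. -/
def quotientRelations {R : Type u} [CommRing R] (a b : R) : Ideal R[X] where
  carrier := {p | ∃ n : ℕ, C a ^ n * p ∈ Ideal.span {C a * Polynomial.X - C b}}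
  zero_mem' := ⟨0, by simp⟩
  add_mem' := by
    rintro p q ⟨m, hm⟩ ⟨n, hn⟩
    refine ⟨m + n, ?_⟩
    have := add_mem (Ideal.mul_mem_left _ (C a ^ n) hm) (Ideal.mul_mem_left _ (C a ^ m) hn)
    convert! this using 1
    ring
  smul_mem' := by
    rintro c p ⟨n, hn⟩
    refine ⟨n, ?_⟩
    have := Ideal.mul_mem_left _ c hn
    convert! this using 1
    simp only [smul_eq_mul]
    ring

open Polynomial in
/-- The ring `R[b / a]`, the affine blow-up algebra of `R`. -/
abbrev AdjoinQuotient {R : Type u} [CommRing R] (a b : R) : Type u := R[X] ⧸ quotientRelations a b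

namespace AdjoinQuotient

open Polynomial

variable {R : Type u} [CommRing R] (a b : R)

/-- The structure map of `R[b / a]`. -/
def of : R →+* AdjoinQuotient a b := (Ideal.Quotient.mk _).comp C

theorem of_mul_root : of a b a * Ideal.Quotient.mk _ Polynomial.X = of a b b := by
  change Ideal.Quotient.mk _ (C a) * _ = Ideal.Quotient.mk _ (C b)
  rw [← map_mul, Ideal.Quotient.eq]
  exact ⟨0, by simp⟩

theorem of_mem_nonZeroDivisors : of a b a ∈ nonZeroDivisors (AdjoinQuotient a b) := by
  rw [mem_nonZeroDivisors_iff_right]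
  intro x hx
  obtain ⟨p, rfl⟩ := Ideal.Quotient.mk_surjective x
  change Ideal.Quotient.mk _ p * Ideal.Quotient.mk _ (C a) = 0 at hx
  rw [← map_mul, Ideal.Quotient.eq_zero_iff_mem] at hx
  obtain ⟨n, hn⟩ := hx
  refine Ideal.Quotient.eq_zero_iff_mem.2 ⟨n + 1, ?_⟩
  convert! hn using 1
  ring

theorem existsUnique_lift {B : Type*} [CommRing B] (ψ : R →+* B) (ha : ψ a ∈ nonZeroDivisors B)
    (h : ψ a ∣ ψ b) : ∃! χ : AdjoinQuotient a b →+* B, χ.comp (of a b) = ψ := by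
  obtain ⟨c, hc⟩ := h
  have hker : ∀ p ∈ quotientRelations a b, eval₂RingHom ψ c p = 0 := by
    rintro p ⟨n, hn⟩
    obtain ⟨q, hq⟩ := Ideal.mem_span_singleton.1 hn
    have e := congrArg (eval₂RingHom ψ c) hq
    simp only [map_mul, map_pow, map_sub, coe_eval₂RingHom, eval₂_C, eval₂_X, hc, sub_self,
      zero_mul] at e
    exact (mem_nonZeroDivisors_iff.1 (pow_mem ha n)).1 _ e
  refine ⟨Ideal.Quotient.lift _ (eval₂RingHom ψ c) hker, ?_, ?_⟩
  · ext r
    simp [of]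
  · intro χ hχ
    refine Ideal.Quotient.ringHom_ext (Polynomial.ringHom_ext (fun r ↦ ?_) ?_)
    · have := congr($hχ r)
      simpa [of] using this
    · refine (mul_cancel_left_mem_nonZeroDivisors ha).1 ?_
      have := congrArg χ (of_mul_root a b)
      rw [map_mul] at this
      have h1 : ∀ r, χ (of a b r) = ψ r := fun r ↦ congr($hχ r)
      rw [h1, h1] at this
      simpa [hc] using this

theorem exists_pow_mul_eq (y : AdjoinQuotient a b) : ∃ n r, of a b a ^ n * y = of a b r := by
  obtain ⟨p, rfl⟩ := Ideal.Quotient.mk_surjective y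
  induction p using Polynomial.induction_on with
  | C r => exact ⟨0, r, by rw [pow_zero, one_mul]; rfl⟩
  | add p q hp hq =>
    obtain ⟨m, r, hr⟩ := hp
    obtain ⟨n, s, hs⟩ := hq
    refine ⟨m + n, a ^ n * r + a ^ m * s, ?_⟩
    rw [map_add, map_add, map_mul, map_mul, ← hr, ← hs, map_pow, map_pow]
    ring
  | monomial n r h =>
    obtain ⟨m, s, hs⟩ := h
    refine ⟨m + 1, b * s, ?_⟩
    rw [map_mul (of a b), ← hs, ← of_mul_root, map_mul, map_mul, map_pow, map_pow]
    ring

theorem exists_pow_mul_eq_zero {r : R} (h : of a b r = 0) : ∃ n, a ^ n * r = 0 := by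
  have hu : IsUnit (algebraMap R (Localization.Away a) a) :=
    IsLocalization.map_units _ (⟨a, Submonoid.mem_powers a⟩ : Submonoid.powers a)
  obtain ⟨χ, hχ, -⟩ := existsUnique_lift a b (algebraMap R (Localization.Away a))
    hu.mem_nonZeroDivisors hu.dvd
  have e : algebraMap R (Localization.Away a) r = 0 := by
    rw [← hχ, RingHom.comp_apply, h, map_zero]
  obtain ⟨⟨_, n, rfl⟩, hn⟩ := (IsLocalization.map_eq_zero_iff (Submonoid.powers a) _ r).1 e
  exact ⟨n, hn⟩

/-- Elements of `R` that are nonzerodivisors in a local ring of `R` stay so in the local rings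
of `R[b / a]`, since the latter ring embeds into the localization of `R` at `a`. -/
theorem localization_mem_nonZeroDivisors (q : Ideal (AdjoinQuotient a b)) [q.IsPrime] (r : R)
    {Rp Aq : Type*} [CommRing Rp] [CommRing Aq] [Algebra R Rp] [Algebra (AdjoinQuotient a b) Aq]
    [IsLocalization.AtPrime Rp (q.comap (of a b))] [IsLocalization.AtPrime Aq q]
    (h : algebraMap R Rp r ∈ nonZeroDivisors Rp) :
    algebraMap _ Aq (of a b r) ∈ nonZeroDivisors Aq := by
  rw [mem_nonZeroDivisors_iff_right]
  intro x hx
  obtain ⟨⟨y, s⟩, hy⟩ := IsLocalization.surj q.primeCompl x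
  have h1 : algebraMap _ Aq (y * of a b r) = 0 := by
    rw [map_mul, ← hy, mul_right_comm, hx, zero_mul]
  obtain ⟨⟨s', hs'⟩, h2⟩ := (IsLocalization.map_eq_zero_iff q.primeCompl Aq _).1 h1
  obtain ⟨n, y₀, hy₀⟩ := exists_pow_mul_eq a b y
  obtain ⟨m, s₀, hs₀⟩ := exists_pow_mul_eq a b s'
  have h3 : of a b (s₀ * y₀ * r) = 0 := by
    rw [map_mul, map_mul, ← hy₀, ← hs₀]
    linear_combination of a b a ^ m * of a b a ^ n * h2
  obtain ⟨k, hk⟩ := exists_pow_mul_eq_zero a b h3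
  have h4 : algebraMap R Rp (a ^ k * (s₀ * y₀)) * algebraMap R Rp r = 0 := by
    rw [← map_mul, mul_assoc, hk, map_zero]
  have h5 := (mem_nonZeroDivisors_iff_right.1 h) _ h4
  obtain ⟨⟨t, ht⟩, h6⟩ := (IsLocalization.map_eq_zero_iff (q.comap (of a b)).primeCompl Rp _).1 h5
  have h7 : of a b t * s' * y = 0 := by
    refine (mem_nonZeroDivisors_iff.1 (pow_mem (of_mem_nonZeroDivisors a b) (k + m + n))).1 _ ?_
    have := congrArg (of a b) h6
    simp only [map_mul, map_zero, map_pow, ← hy₀, ← hs₀] at this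
    linear_combination this
  have h8 : algebraMap _ Aq y = 0 :=
    (IsLocalization.map_eq_zero_iff q.primeCompl Aq _).2
      ⟨⟨of a b t * s', q.primeCompl.mul_mem ht hs'⟩, h7⟩
  rw [h8] at hy
  exact (IsLocalization.map_units Aq s).mul_left_eq_zero.1 hy

end AdjoinQuotient

/-! ### Existence of blow-ups of ideals with two generators -/

/-- A morphism that maps nonzerodivisors of the local rings of the target to nonzerodivisors of
the local rings of the source. -/
def PreservesNonZeroDivisors {X Y : Scheme.{u}} (π : Y ⟶ X) : Prop :=
  ∀ (y : Y), ∀ r ∈ nonZeroDivisors (X.presheaf.stalk (π y)),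
    π.stalkMap y r ∈ nonZeroDivisors (Y.presheaf.stalk y)

theorem PreservesNonZeroDivisors.of_isOpenImmersion {X Y : Scheme.{u}} (j : Y ⟶ X)
    [IsOpenImmersion j] : PreservesNonZeroDivisors j := fun y _ hr ↦
  (mem_nonZeroDivisors_equiv_iff (asIso (j.stalkMap y)).commRingCatIsoToRingEquiv).2 hr

theorem PreservesNonZeroDivisors.comp {X Y Z : Scheme.{u}} {π : Y ⟶ X} {π' : Z ⟶ Y}
    (h : PreservesNonZeroDivisors π) (h' : PreservesNonZeroDivisors π') :
    PreservesNonZeroDivisors (π' ≫ π) := by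
  intro z r hr
  rw [Scheme.Hom.stalkMap_comp]
  exact h' z _ (h (π' z) r hr)

theorem PreservesNonZeroDivisors.of_cover {X Y Y₁ Y₂ : Scheme.{u}} {π : Y ⟶ X} (i₁ : Y₁ ⟶ Y)
    (i₂ : Y₂ ⟶ Y) [IsOpenImmersion i₁] [IsOpenImmersion i₂]
    (h : ∀ y : Y, y ∈ Set.range i₁ ∨ y ∈ Set.range i₂)
    (h₁ : PreservesNonZeroDivisors (i₁ ≫ π)) (h₂ : PreservesNonZeroDivisors (i₂ ≫ π)) :
    PreservesNonZeroDivisors π := by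
  have key : ∀ {Y' : Scheme.{u}} (i : Y' ⟶ Y) [IsOpenImmersion i],
      PreservesNonZeroDivisors (i ≫ π) → ∀ x, ∀ r ∈ nonZeroDivisors (X.presheaf.stalk (π (i x))),
        π.stalkMap (i x) r ∈ nonZeroDivisors (Y.presheaf.stalk (i x)) := by
    intro Y' i _ hi x r hr
    have := hi x r hr
    rw [Scheme.Hom.stalkMap_comp] at this
    exact (mem_nonZeroDivisors_equiv_iff (asIso (i.stalkMap x)).commRingCatIsoToRingEquiv).1 this
  intro y
  rcases h y with ⟨x, rfl⟩ | ⟨x, rfl⟩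
  · exact key i₁ h₁ x
  · exact key i₂ h₂ x

theorem PreservesNonZeroDivisors.principal {R : Type u} [CommRing R] {a b : R} {X Y : Scheme.{u}}
    {π : Y ⟶ X} (h : PreservesNonZeroDivisors π) {g : X ⟶ Spec (CommRingCat.of R)}
    (hg : Principal a b g = Set.univ) : Principal a b (π ≫ g) = Set.univ := by
  refine Set.eq_univ_of_forall fun y ↦ (hg.ge (Set.mem_univ (π y))).imp ?_ ?_
  all_goals
    rintro ⟨h1, h2⟩
    refine ⟨?_, ?_⟩
    · rw [stalkHom_comp]
      exact h y _ h1
    · rw [stalkHom_comp, stalkHom_comp]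
      exact map_dvd (π.stalkMap y).hom h2

theorem AdjoinQuotient.preservesNonZeroDivisors {R : Type u} [CommRing R] (a b : R) :
    PreservesNonZeroDivisors (Spec.map (CommRingCat.ofHom (AdjoinQuotient.of a b))) := by
  generalize hπ : Spec.map (CommRingCat.ofHom (AdjoinQuotient.of a b)) = π
  intro y t ht
  let q : PrimeSpectrum (AdjoinQuotient a b) := y
  let p : PrimeSpectrum R := π y
  let _ := (stalkHom (𝟙 (Spec (CommRingCat.of (AdjoinQuotient a b)))) y).toAlgebra
  let _ := (stalkHom (𝟙 (Spec (CommRingCat.of R))) (π y)).toAlgebra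
  have i1 : IsLocalization.AtPrime _ q.asIdeal :=
    isLocalization_stalkHom_id (R := CommRingCat.of (AdjoinQuotient a b)) q
  have i2 : IsLocalization.AtPrime _ p.asIdeal :=
    isLocalization_stalkHom_id (R := CommRingCat.of R) p
  have i2 : IsLocalization.AtPrime ((Spec (CommRingCat.of R)).presheaf.stalk (π y))
    (q.asIdeal.comap (AdjoinQuotient.of a b)) := by subst hπ; exact i2
  obtain ⟨⟨r, s⟩, hrs⟩ := IsLocalization.surj (q.asIdeal.comap (AdjoinQuotient.of a b)).primeCompl t
  have hs := IsLocalization.map_units ((Spec (CommRingCat.of R)).presheaf.stalk (π y)) s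
  have hr : algebraMap R ((Spec (CommRingCat.of R)).presheaf.stalk (π y)) r ∈
      nonZeroDivisors _ := by
    rw [← hrs]
    exact mul_mem ht hs.mem_nonZeroDivisors
  have h1 := AdjoinQuotient.localization_mem_nonZeroDivisors a b q.asIdeal r
    (Aq := (Spec (CommRingCat.of (AdjoinQuotient a b))).presheaf.stalk y) hr
  have e : ∀ r, π.stalkMap y (algebraMap R ((Spec (CommRingCat.of R)).presheaf.stalk (π y)) r) =
      algebraMap _ ((Spec (CommRingCat.of (AdjoinQuotient a b))).presheaf.stalk y)
        (AdjoinQuotient.of a b r) := fun r ↦ by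
    refine (stalkHom_comp π (𝟙 _) y r).symm.trans ?_
    rw [Category.comp_id, ← hπ]
    exact stalkHom_map _ _ _
  rw [← e, ← hrs, map_mul] at h1
  exact (mul_mem_nonZeroDivisors.1 h1).1

theorem principal_comp_map {R R' : Type u} [CommRing R] [CommRing R'] (φ : R →+* R') (a b : R)
    {V : Scheme.{u}} (g : V ⟶ Spec (CommRingCat.of R')) :
    Principal a b (g ≫ Spec.map (CommRingCat.ofHom φ)) = Principal (φ a) (φ b) g := by
  have e := fun v r ↦ stalkHom_comp_map g (CommRingCat.ofHom φ) v r
  ext v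
  change (_ ∧ _) ∨ (_ ∧ _) ↔ _
  rw [e, e]
  rfl

/-- The blow-up of `(a, b)` in an affine scheme: the spectra of `R[b / a]` and `R[a / b]` glued
along the locus where each of `a`, `b` divides the other. -/
theorem exists_isUniversal_principal {R : Type u} [CommRing R] (a b : R) :
    ∃ (Y : Scheme.{u}) (π : Y ⟶ Spec (CommRingCat.of R)), CompactSpace Y ∧
      IsUniversal (Principal a b) π ∧ PreservesNonZeroDivisors π := by
  have key : ∀ a b : R, IsUniversal (Divides a b)
      (Spec.map (CommRingCat.ofHom (AdjoinQuotient.of a b))) := fun a b ↦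
    (isUniversal_Spec (ι := Unit) (AdjoinQuotient.of a b) (fun _ ↦ a) (fun _ ↦ b)
      (fun _ ↦ AdjoinQuotient.of_mem_nonZeroDivisors a b)
      (fun _ ↦ ⟨_, (AdjoinQuotient.of_mul_root a b).symm⟩)
      fun B _ ψ h1 h2 ↦ AdjoinQuotient.existsUnique_lift a b ψ (h1 ()) (h2 ())).congr fun g ↦ by
        simp
  obtain ⟨Y, π, i₁, i₂, hu, _, _, e₁, e₂, hs⟩ := (key a b).exists_union (key b a)
    (Divides.isOpenIn a b) (by
      have : (fun (V : Scheme.{u}) (g : V ⟶ Spec (CommRingCat.of R)) ↦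
          Divides a b g ∪ Divides b a g) = Principal b a := by
        ext V g : 2
        exact Set.union_comm _ _
      rw [this]
      exact Divides.isOpenIn b a)
  refine ⟨Y, π, ⟨?_⟩, hu, .of_cover i₁ i₂ hs ?_ ?_⟩
  · have : (Set.univ : Set Y) = Set.range i₁ ∪ Set.range i₂ :=
      (Set.eq_univ_of_forall hs).symm
    rw [this]
    exact (isCompact_range i₁.continuous).union (isCompact_range i₂.continuous)
  · rw [e₁]
    exact AdjoinQuotient.preservesNonZeroDivisors a b
  · rw [e₂]
    exact AdjoinQuotient.preservesNonZeroDivisors b a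

/-- The part of a condition over an open subset of the base. -/
def PointCondition.over {X : Scheme.{u}} (p : PointCondition X) (U : Set X) : PointCondition X :=
  fun _ g ↦ g ⁻¹' U ∩ p g

theorem PointCondition.IsLocal.over {X : Scheme.{u}} {p : PointCondition X} (hp : p.IsLocal)
    (U : Set X) : (p.over U).IsLocal := by
  intro V' V j _ g
  exact congrArg₂ (· ∩ ·) rfl (hp j g)

theorem PointCondition.isOpenIn_over {X : Scheme.{u}} {p : PointCondition X} (hp : p.IsLocal)
    {U : Set X} (hU : IsOpen U) (U' : Set X) :
    (p.over U).IsOpenIn (p.over U') where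
  isLocal := hp.over U
  isOpen g hg := by
    have : p g = Set.univ := Set.univ_subset_iff.1 (hg ▸ Set.inter_subset_right)
    rw [PointCondition.over, this, Set.inter_univ]
    exact hU.preimage g.continuous
  preimage l π h1 h2 := by
    have h1 : p π = Set.univ := Set.univ_subset_iff.1 (h1 ▸ Set.inter_subset_right)
    have h2 : p (l ≫ π) = Set.univ := Set.univ_subset_iff.1 (h2 ▸ Set.inter_subset_right)
    rw [PointCondition.over, PointCondition.over, h1, h2]
    rfl

/-- Universality over an open subscheme of the base. -/
theorem IsUniversal.comp_isOpenImmersion {X X' Y : Scheme.{u}} {p : PointCondition X}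
    (j : X' ⟶ X) [IsOpenImmersion j] {π : Y ⟶ X'}
    (h : IsUniversal (fun _ g ↦ p (g ≫ j)) π) : IsUniversal (p.over (Set.range j)) (π ≫ j) := by
  refine ⟨?_, fun {V} g hg ↦ ?_⟩
  · rw [PointCondition.over, h.self, Set.inter_univ]
    exact Set.eq_univ_of_forall fun y ↦ ⟨π y, rfl⟩
  · have h1 : p g = Set.univ := Set.univ_subset_iff.1 (hg ▸ Set.inter_subset_right)
    have h2 : Set.range g ⊆ Set.range j := by
      rintro _ ⟨v, rfl⟩
      exact (hg.ge (Set.mem_univ v)).1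
    obtain ⟨l, hl, hu⟩ := h.existsUnique (IsOpenImmersion.lift j g h2) (by simpa using h1)
    refine ⟨l, ?_, fun m hm ↦ hu m ?_⟩
    · change l ≫ π ≫ j = g
      rw [reassoc_of% hl, IsOpenImmersion.lift_fac]
    · change m ≫ π = _
      rw [← cancel_mono j, IsOpenImmersion.lift_fac, Category.assoc]
      exact hm

theorem isLocal_comp {X X' : Scheme.{u}} {p : PointCondition X} (hp : p.IsLocal) (ρ : X' ⟶ X) :
    PointCondition.IsLocal (fun _ g ↦ p (g ≫ ρ) : PointCondition X') := fun _ _ j _ g ↦ by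
  change p ((j ≫ g) ≫ ρ) = j ⁻¹' p (g ≫ ρ)
  rw [← hp, Category.assoc]

/-- The blow-up of the inverse image of `(a, b)` exists on every quasi-compact scheme, as it can be
glued along the affine open subsets of a finite cover. -/
theorem exists_isUniversal_principal_over {R : Type u} [CommRing R] (a b : R) {X : Scheme.{u}}
    [CompactSpace X] (ρ : X ⟶ Spec (CommRingCat.of R)) :
    ∃ (Y : Scheme.{u}) (π : Y ⟶ X), CompactSpace Y ∧
      IsUniversal (fun _ g ↦ Principal a b (g ≫ ρ)) π ∧ PreservesNonZeroDivisors π := by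
  set p : PointCondition X := fun _ g ↦ Principal a b (g ≫ ρ)
  have hp : p.IsLocal := isLocal_comp (Principal.isLocal a b) ρ
  have key : ∀ U : X.Opens, IsCompact (U : Set X) → ∃ (Y : Scheme.{u}) (π : Y ⟶ X),
      CompactSpace Y ∧ IsUniversal (p.over U) π ∧ PreservesNonZeroDivisors π := by
    have aff : ∀ U : X.affineOpens, ∃ (Y : Scheme.{u}) (π : Y ⟶ X),
      CompactSpace Y ∧ IsUniversal (p.over (U.1 : Set X)) π ∧ PreservesNonZeroDivisors π := by
      rintro ⟨U, hU⟩
      have hU : IsAffineOpen U := hU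
      obtain ⟨Y, π, hc, hu, hn⟩ :=
        exists_isUniversal_principal (sectionsOn ρ U a) (sectionsOn ρ U b)
      refine ⟨Y, π ≫ hU.fromSpec, hc, ?_, .comp (.of_isOpenImmersion _) hn⟩
      rw [← hU.range_fromSpec]
      refine IsUniversal.comp_isOpenImmersion _ (hu.congr fun g ↦ ?_)
      change _ ↔ Principal a b ((g ≫ hU.fromSpec) ≫ ρ) = Set.univ
      rw [Category.assoc, fromSpec_comp, principal_comp_map]
    intro U hU
    refine compact_open_induction_on U hU ?_ ?_
    · obtain ⟨Y, π, h1, h2, h3⟩ := aff ⟨⊥, isAffineOpen_bot X⟩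
      exact ⟨Y, π, h1, h2, h3⟩
    · rintro U hU V ⟨Y₁, π₁, c₁, hu₁, n₁⟩
      obtain ⟨Y₂, π₂, c₂, hu₂, n₂⟩ := aff V
      have e : (fun (V' : Scheme.{u}) (g : V' ⟶ X) ↦ p.over U g ∪ p.over (V.1 : Set X) g) =
          p.over (U ⊔ V.1 : X.Opens) := by
        ext V' g : 2
        rw [PointCondition.over, PointCondition.over, PointCondition.over,
          ← Set.union_inter_distrib_right, ← Set.preimage_union]
        rfl
      obtain ⟨Y, π, i₁, i₂, hu, _, _, e₁, e₂, hs⟩ := hu₁.exists_union hu₂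
        (by rw [e]; exact PointCondition.isOpenIn_over hp U.isOpen _)
        (by rw [e]; exact PointCondition.isOpenIn_over hp V.1.isOpen _)
      refine ⟨Y, π, ⟨?_⟩, e ▸ hu, .of_cover i₁ i₂ hs (e₁ ▸ n₁) (e₂ ▸ n₂)⟩
      have : (Set.univ : Set Y) = Set.range i₁ ∪ Set.range i₂ :=
        (Set.eq_univ_of_forall hs).symm
      rw [this]
      exact (isCompact_range i₁.continuous).union (isCompact_range i₂.continuous)
  obtain ⟨Y, π, h1, h2, h3⟩ := key ⊤ isCompact_univ
  refine ⟨Y, π, h1, h2.congr fun g ↦ ?_, h3⟩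
  simp [PointCondition.over]

/-! ### The coordinate rings of the charts -/

/-- The relation satisfied by the coordinates `s_i` of a chart, in an arbitrary ring. -/
def ChartRel {A : Type*} [CommRing A] (ε : Fin 3 → Bool) (s : Fin 3 → A) : Prop :=
  (∏ i, if ε i = true then s i else 1) = ∏ i, if ε i = true then 1 else s i

/-- The morphism of `ℂ`-algebras out of `RingU ε` given by the images of the `s_i` and `b_i`. -/
def liftU {A : Type*} [CommRing A] [Algebra ℂ A] {ε : Fin 3 → Bool} (s b : Fin 3 → A)
    (h : ChartRel ε s) : RingU ε →ₐ[ℂ] A :=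
  Ideal.Quotient.liftₐ _ (MvPolynomial.aeval (Sum.elim s b)) (by
    intro p hp
    rw [Ideal.mem_span_singleton] at hp
    obtain ⟨q, rfl⟩ := hp
    have e : ∀ (c : Bool) (p q : MvPolynomial (Fin 3 ⊕ Fin 3) ℂ),
        MvPolynomial.aeval (Sum.elim s b) (if c = true then p else q) =
          if c = true then MvPolynomial.aeval (Sum.elim s b) p
            else MvPolynomial.aeval (Sum.elim s b) q := by
      intro c p q; split_ifs <;> rfl
    have h' : MvPolynomial.aeval (Sum.elim s b) (chartEqn ε) = 0 := by
      rw [chartEqn, map_sub, map_prod, map_prod]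
      simp only [e, map_one, MvPolynomial.aeval_X, Sum.elim_inl]
      exact sub_eq_zero.2 h
    rw [map_mul, h', zero_mul])

@[simp]
theorem liftU_s {A : Type*} [CommRing A] [Algebra ℂ A] {ε : Fin 3 → Bool} (s' b' : Fin 3 → A)
    (h : ChartRel ε s') (i : Fin 3) : liftU s' b' h (s ε i) = s' i :=
  MvPolynomial.aeval_X (R := ℂ) (Sum.elim s' b') (Sum.inl i)

@[simp]
theorem liftU_b {A : Type*} [CommRing A] [Algebra ℂ A] {ε : Fin 3 → Bool} (s' b' : Fin 3 → A)
    (h : ChartRel ε s') (i : Fin 3) : liftU s' b' h (b ε i) = b' i :=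
  MvPolynomial.aeval_X (R := ℂ) (Sum.elim s' b') (Sum.inr i)

theorem RingU.hom_ext {A : Type*} [Semiring A] {ε : Fin 3 → Bool} {χ χ' : RingU ε →+* A}
    (hc : ∀ c : ℂ, χ (algebraMap ℂ _ c) = χ' (algebraMap ℂ _ c))
    (hs : ∀ i, χ (s ε i) = χ' (s ε i)) (hb : ∀ i, χ (b ε i) = χ' (b ε i)) : χ = χ' := by
  refine Ideal.Quotient.ringHom_ext (MvPolynomial.ringHom_ext hc ?_)
  rintro (i | i)
  · exact hs i
  · exact hb i

theorem RingU.algHom_ext {A : Type*} [Semiring A] [Algebra ℂ A] {ε : Fin 3 → Bool}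
    {χ χ' : RingU ε →ₐ[ℂ] A}
    (hs : ∀ i, χ (s ε i) = χ' (s ε i)) (hb : ∀ i, χ (b ε i) = χ' (b ε i)) : χ = χ' :=
  AlgHom.coe_ringHom_injective (RingU.hom_ext (fun c ↦ by simp) hs hb)

theorem ChartRel.map {A B : Type*} [CommRing A] [CommRing B] {ε : Fin 3 → Bool} {s : Fin 3 → A}
    (h : ChartRel ε s) (χ : A →+* B) : ChartRel ε fun i ↦ χ (s i) := by
  have := congrArg χ h
  rw [map_prod, map_prod] at this
  simp only [apply_ite χ, map_one] at this
  exact this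

/-- Of three indices two are of the same type. -/
theorem exists_lone (ε : Fin 3 → Bool) : ∃ l, ε (l + 1) = ε (l + 2) := by
  revert ε; decide

/-- The relation of a chart, for an index `l` such that the other two indices are of the same
type: it is `s_l = s_i s_j` if `l` is of the other type, and `s_l s_i s_j = 1` otherwise. -/
theorem chartRel_iff {A : Type*} [CommRing A] {ε : Fin 3 → Bool} {l : Fin 3}
    (hl : ε (l + 1) = ε (l + 2)) (s : Fin 3 → A) :
    ChartRel ε s ↔ s l * (if ε l = ε (l + 1) then s (l + 1) * s (l + 2) else 1) =
      if ε l = ε (l + 1) then 1 else s (l + 1) * s (l + 2) := by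
  have h3 : ∀ f : Fin 3 → A, ∏ i, f i = f l * (f (l + 1) * f (l + 2)) := fun f ↦ by
    rw [Fin.prod_univ_three]
    fin_cases l <;> simp <;> ring
  rw [ChartRel, h3, h3]
  rcases h : ε l <;> rcases h' : ε (l + 2) <;> simp [hl, h'] <;> rw [eq_comm]

/-- The function on the indices with values `x`, `y`, `z` at `l`, `l + 1`, `l + 2`. -/
def place {A : Type*} (l : Fin 3) (x y z : A) : Fin 3 → A :=
  fun i ↦ if i = l then x else if i = l + 1 then y else z

@[simp] theorem place_zero {A : Type*} (l : Fin 3) (x y z : A) : place l x y z l = x := by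
  simp [place]

@[simp] theorem place_one {A : Type*} (l : Fin 3) (x y z : A) : place l x y z (l + 1) = y := by
  simp [place]

@[simp] theorem place_two {A : Type*} (l : Fin 3) (x y z : A) : place l x y z (l + 2) = z := by
  simp [place]

theorem forall_fin_three {p : Fin 3 → Prop} (l : Fin 3) :
    (∀ i, p i) ↔ p l ∧ p (l + 1) ∧ p (l + 2) := by
  rw [Fin.forall_fin_succ, Fin.forall_fin_two]
  fin_cases l <;> simp <;> tauto

/-- The polynomial ring in the coordinates of a chart other than `s_l`: the variables `inl` stand
for `s_{l+1}`, `s_{l+2}`, the variables `inr` for the `b_i`. -/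
abbrev RingP : Type := MvPolynomial (Fin 2 ⊕ Fin 3) ℂ

/-- The coefficient of `s_l` in the relation of a chart. -/
def denom (ε : Fin 3 → Bool) (l : Fin 3) : RingP :=
  if ε l = ε (l + 1) then MvPolynomial.X (Sum.inl 0) * MvPolynomial.X (Sum.inl 1) else 1

/-- The value of the product of `s_l` and `denom`, a monomial in the other coordinates. -/
def numer (ε : Fin 3 → Bool) (l : Fin 3) : RingP :=
  if ε l = ε (l + 1) then 1 else MvPolynomial.X (Sum.inl 0) * MvPolynomial.X (Sum.inl 1)

/-- The inclusion of the polynomial ring in the coordinates other than `s_l`. -/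
def polyToU (ε : Fin 3 → Bool) (l : Fin 3) : RingP →ₐ[ℂ] RingU ε :=
  MvPolynomial.aeval (Sum.elim ![s ε (l + 1), s ε (l + 2)] (b ε))

theorem s_mul_denom {ε : Fin 3 → Bool} {l : Fin 3} (hl : ε (l + 1) = ε (l + 2)) :
    s ε l * polyToU ε l (denom ε l) = polyToU ε l (numer ε l) := by
  have := (chartRel_iff hl (s ε)).1 (chart_relation ε)
  unfold denom numer polyToU
  split_ifs at this ⊢ with h <;> simpa [h] using this

theorem isUnit_polyToU_denom {ε : Fin 3 → Bool} {l : Fin 3} (hl : ε (l + 1) = ε (l + 2)) :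
    IsUnit (polyToU ε l (denom ε l)) := by
  have := s_mul_denom hl
  by_cases h : ε l = ε (l + 1)
  · rw [numer, if_pos h, map_one] at this
    exact IsUnit.of_mul_eq_one_right _ this
  · rw [denom, if_neg h, map_one]
    exact isUnit_one

/-- The coordinates `s_i` as elements of the localized polynomial ring. -/
def modelS (ε : Fin 3 → Bool) (l : Fin 3) : Fin 3 → Localization.Away (denom ε l) :=
  place l (IsLocalization.mk' _ (numer ε l) (⟨_, Submonoid.mem_powers _⟩ :
      Submonoid.powers (denom ε l)))
    (algebraMap RingP _ (MvPolynomial.X (Sum.inl 0)))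
    (algebraMap RingP _ (MvPolynomial.X (Sum.inl 1)))

theorem chartRel_modelS {ε : Fin 3 → Bool} {l : Fin 3} (hl : ε (l + 1) = ε (l + 2)) :
    ChartRel ε (modelS ε l) := by
  rw [chartRel_iff hl]
  have := IsLocalization.mk'_spec (Localization.Away (denom ε l)) (numer ε l)
    (⟨_, Submonoid.mem_powers _⟩ : Submonoid.powers (denom ε l))
  by_cases h : ε l = ε (l + 1)
  · simp only [h, if_true, modelS, place_zero, place_one, place_two]
    rw [← map_mul]
    conv at this => rhs; rw [numer, if_pos h, map_one]
    rw [← this]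
    simp [denom, h]
  · simp only [h, if_false, modelS, place_zero, place_one, place_two]
    rw [← map_mul]
    conv at this => rhs; rw [numer, if_neg h]
    rw [← this]
    exact congrArg _ ((congrArg (algebraMap RingP _) (if_neg h)).trans (map_one _)).symm

/-- The coordinate ring of a chart is the localization of a polynomial ring at the coefficient
of `s_l` in the relation. -/
def chartEquiv {ε : Fin 3 → Bool} {l : Fin 3} (hl : ε (l + 1) = ε (l + 2)) :
    RingU ε ≃ₐ[ℂ] Localization.Away (denom ε l) :=
  AlgEquiv.ofAlgHom
    (liftU (modelS ε l) (fun i ↦ algebraMap RingP _ (MvPolynomial.X (Sum.inr i)))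
      (chartRel_modelS hl))
    (IsLocalization.liftAlgHom (M := Submonoid.powers (denom ε l)) (f := polyToU ε l) (by
      rintro ⟨_, n, rfl⟩
      simpa using (isUnit_polyToU_denom hl).pow n))
    (by
      refine AlgHom.coe_ringHom_injective (IsLocalization.ringHom_ext
        (Submonoid.powers (denom ε l)) (MvPolynomial.ringHom_ext (fun c ↦ ?_) ?_))
      · have : algebraMap RingP (Localization.Away (denom ε l)) (MvPolynomial.C c) =
            algebraMap ℂ _ c := (IsScalarTower.algebraMap_apply ℂ RingP _ c).symm
        rw [RingHom.comp_apply, this]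
        simp only [AlgHom.coe_toRingHom, AlgHom.commutes]
        exact this.symm
      · rintro (i | i)
        · fin_cases i
          · simp [polyToU, modelS]
          · simp [polyToU, modelS]
        · simp [polyToU])
    (by
      refine RingU.algHom_ext ?_ fun i ↦ by simp [polyToU]
      rw [forall_fin_three l]
      refine ⟨?_, by simp [polyToU, modelS], by simp [polyToU, modelS]⟩
      simp only [modelS, AlgHom.comp_apply, liftU_s, place_zero, AlgHom.id_apply,
        IsLocalization.liftAlgHom_apply]
      rw [IsLocalization.lift_mk'_spec, mul_comm]
      exact (s_mul_denom hl).symm)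

theorem chartEquiv_polyToU {ε : Fin 3 → Bool} {l : Fin 3} (hl : ε (l + 1) = ε (l + 2)) (p : RingP) :
    chartEquiv hl (polyToU ε l p) = algebraMap _ _ p := by
  rw [← AlgEquiv.eq_symm_apply]
  exact (IsLocalization.lift_eq _ _).symm

theorem denom_ne_zero (ε : Fin 3 → Bool) (l : Fin 3) : denom ε l ≠ 0 := by
  unfold denom
  split_ifs
  · exact mul_ne_zero (MvPolynomial.X_ne_zero _) (MvPolynomial.X_ne_zero _)
  · exact one_ne_zero

instance (ε : Fin 3 → Bool) : IsDomain (RingU ε) := by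
  obtain ⟨l, hl⟩ := exists_lone ε
  have : IsDomain (Localization.Away (denom ε l)) :=
    IsLocalization.isDomain_localization (powers_le_nonZeroDivisors_of_noZeroDivisors
      (denom_ne_zero ε l))
  exact (chartEquiv hl).toMulEquiv.isDomain _

theorem chartRel_one {A : Type*} [CommRing A] (ε : Fin 3 → Bool) : ChartRel ε (1 : Fin 3 → A) := by
  simp [ChartRel]

theorem b_ne_zero (ε : Fin 3 → Bool) (i : Fin 3) : b ε i ≠ 0 := by
  intro h
  have := congrArg (liftU (A := ℂ) 1 1 (chartRel_one ε)) h
  simp at this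

/-! ### The tower of blow-ups and its charts -/

/-- The properties of the blow-ups constructed above hold for all blow-ups, by uniqueness. -/
theorem isUniversal_principal_compact {R : Type u} [CommRing R] {a b : R} {X Y : Scheme.{u}}
    [CompactSpace X] {ρ : X ⟶ Spec (CommRingCat.of R)} {π : Y ⟶ X}
    (h : IsUniversal (fun _ g ↦ Principal a b (g ≫ ρ)) π) :
    CompactSpace Y ∧ PreservesNonZeroDivisors π := by
  obtain ⟨Y', π', hc, hu, hn⟩ := exists_isUniversal_principal_over a b ρ
  obtain ⟨e, rfl⟩ := h.exists_iso hu
  exact ⟨(Scheme.homeoOfIso e).symm.compactSpace, hn.comp (.of_isOpenImmersion _)⟩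

theorem exists_blowupTower : Nonempty BlowupTower := by
  obtain ⟨Z₁, σ₁, _, u₁, -⟩ := exists_isUniversal_principal_over (z 0) (w 0) (𝟙 W)
  obtain ⟨Z₂, σ₂, _, u₂, -⟩ := exists_isUniversal_principal_over (z 1) (w 1) σ₁
  obtain ⟨Z, σ₃, _, u₃, -⟩ := exists_isUniversal_principal_over (z 2) (w 2) (σ₂ ≫ σ₁)
  exact ⟨⟨Z₁, Z₂, Z, σ₁, σ₂, σ₃, by simpa [prodY] using! (isBlowup_iff _ _ _ _).2 u₁,
    (isBlowup_iff _ _ _ _).2 u₂, (isBlowup_iff _ _ _ _).2 u₃⟩⟩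

/-- The condition that all the ideals `(z_i, w_i)` become invertible. -/
def AllPrincipal : PointCondition W := fun _ g ↦ {v | ∀ i, v ∈ Principal (z i) (w i) g}

theorem AllPrincipal.isLocal : AllPrincipal.IsLocal := by
  intro V' V j _ g
  ext v
  exact forall_congr' fun i ↦ Set.ext_iff.1 (Principal.isLocal (z i) (w i) j g) v

theorem allPrincipal_eq_univ {V : Scheme.{0}} {g : V ⟶ W} :
    AllPrincipal g = Set.univ ↔ ∀ i, Principal (z i) (w i) g = Set.univ := by
  simp only [AllPrincipal, Set.eq_univ_iff_forall, Set.mem_ofPred_eq]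
  exact forall_comm

namespace BlowupTower

variable (B : BlowupTower)

theorem isUniversal₁ : IsUniversal (fun _ g ↦ Principal (z 0) (w 0) (g ≫ 𝟙 W)) B.σ₁ :=
  (isBlowup_iff _ _ _ _).1 (by simpa [prodY] using! B.isBlowup₁)

theorem isUniversal₂ : IsUniversal (fun _ g ↦ Principal (z 1) (w 1) (g ≫ B.σ₁)) B.σ₂ :=
  (isBlowup_iff _ _ _ _).1 B.isBlowup₂

theorem isUniversal₃ : IsUniversal (fun _ g ↦ Principal (z 2) (w 2) (g ≫ B.σ₂ ≫ B.σ₁)) B.σ₃ :=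
  (isBlowup_iff _ _ _ _).1 B.isBlowup₃

/-- The composite of the three blow-ups makes the three ideals invertible simultaneously: an
exceptional divisor stays a divisor under the later blow-ups. -/
theorem isUniversal : IsUniversal AllPrincipal B.σ := by
  obtain ⟨_, -⟩ := isUniversal_principal_compact B.isUniversal₁
  obtain ⟨_, n₂⟩ := isUniversal_principal_compact B.isUniversal₂
  obtain ⟨_, n₃⟩ := isUniversal_principal_compact B.isUniversal₃
  have s₁ := B.isUniversal₁.self
  have s₂ := B.isUniversal₂.self
  have s₃ := B.isUniversal₃.self
  simp only [Category.comp_id] at s₁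
  refine ⟨allPrincipal_eq_univ.2 ?_, fun {V} g hg ↦ ?_⟩
  · rw [Fin.forall_fin_succ, Fin.forall_fin_two]
    exact ⟨n₃.principal (n₂.principal s₁), n₃.principal s₂, s₃⟩
  · have hg := allPrincipal_eq_univ.1 hg
    obtain ⟨l₁, rfl, h₁⟩ := B.isUniversal₁.existsUnique g (by simpa using! hg 0)
    obtain ⟨l₂, rfl, h₂⟩ := B.isUniversal₂.existsUnique l₁ (hg 1)
    obtain ⟨l₃, rfl, h₃⟩ := B.isUniversal₃.existsUnique l₂ (by simpa using! hg 2)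
    refine ⟨l₃, by simp [σ], fun m hm ↦ h₃ m (h₂ _ (h₁ _ ?_))⟩
    simpa [σ] using! hm

end BlowupTower

/-- The condition defining a chart: in each pair `z_i`, `w_i` the chosen element divides the
other one. -/
def ChartCondition (ε : Fin 3 → Bool) : PointCondition W := fun _ g ↦
  {v | ∀ i, v ∈ Divides (if ε i = true then z i else w i) (if ε i = true then w i else z i) g}

theorem chartCondition_isOpenIn (ε : Fin 3 → Bool) : (ChartCondition ε).IsOpenIn AllPrincipal := by
  have h : ∀ i, (Divides (if ε i = true then z i else w i)
      (if ε i = true then w i else z i)).IsOpenIn (Principal (z i) (w i)) := by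
    intro i
    split_ifs
    · exact Divides.isOpenIn _ _
    · have : Principal (z i) (w i) = Principal (w i) (z i) := by
        ext V g : 2
        exact Set.union_comm _ _
      rw [this]
      exact Divides.isOpenIn _ _
  refine ⟨?_, fun g hg ↦ ?_, fun l π hπ hl ↦ ?_⟩
  · intro V' V j _ g
    ext v
    exact forall_congr' fun i ↦ Set.ext_iff.1 ((h i).isLocal j g) v
  · have := isOpen_iInter_of_finite fun i ↦ (h i).isOpen g (allPrincipal_eq_univ.1 hg i)
    convert! this using 1
    ext v
    simp [ChartCondition]
  · ext v
    exact forall_congr' fun i ↦ Set.ext_iff.1 ((h i).preimage l π (allPrincipal_eq_univ.1 hπ i)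
      (allPrincipal_eq_univ.1 hl i)) v

theorem chartCondition_le (ε : Fin 3 → Bool) {V : Scheme.{0}} (g : V ⟶ W)
    (h : ChartCondition ε g = Set.univ) : AllPrincipal g = Set.univ := by
  refine Set.eq_univ_of_forall fun v i ↦ ?_
  have := h.ge (Set.mem_univ v) i
  split_ifs at this
  · exact Or.inl this
  · exact Or.inr this

theorem exists_mem_chartCondition {V : Scheme.{0}} (g : V ⟶ W) (h : AllPrincipal g = Set.univ)
    (v : V) : ∃ ε, v ∈ ChartCondition ε g := by
  have : ∀ i, ∃ c : Bool, v ∈ Divides (if c = true then z i else w i)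
      (if c = true then w i else z i) g := fun i ↦
    (h.ge (Set.mem_univ v) i).elim (fun h ↦ ⟨true, by simpa using h⟩)
      fun h ↦ ⟨false, by simpa using h⟩
  choose ε hε using this
  exact ⟨ε, hε⟩

/-- The ring homomorphism of a chart. -/
abbrev chartHom (ε : Fin 3 → Bool) : RingW →ₐ[ℂ] RingU ε :=
  liftW (chartZ ε) (chartW ε) (chart_compatible ε)

@[simp]
theorem liftW_z {A : Type} [CommRing A] [Algebra ℂ A] (a b : Fin 3 → A)
    (hab : ∏ i, a i = ∏ i, b i) (i : Fin 3) : liftW a b hab (z i) = a i :=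
  MvPolynomial.aeval_X (R := ℂ) (Sum.elim a b) (Sum.inl i)

@[simp]
theorem liftW_w {A : Type} [CommRing A] [Algebra ℂ A] (a b : Fin 3 → A)
    (hab : ∏ i, a i = ∏ i, b i) (i : Fin 3) : liftW a b hab (w i) = b i :=
  MvPolynomial.aeval_X (R := ℂ) (Sum.elim a b) (Sum.inr i)

theorem RingW.hom_ext {A : Type*} [Semiring A] {χ χ' : RingW →+* A}
    (hc : ∀ c : ℂ, χ (algebraMap ℂ _ c) = χ' (algebraMap ℂ _ c))
    (hz : ∀ i, χ (z i) = χ' (z i)) (hw : ∀ i, χ (w i) = χ' (w i)) : χ = χ' := by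
  refine Ideal.Quotient.ringHom_ext (MvPolynomial.ringHom_ext hc ?_)
  rintro (i | i)
  · exact hz i
  · exact hw i

theorem prod_z_eq_prod_w : ∏ i, z i = ∏ i, w i := by
  have : (Ideal.Quotient.mk (Ideal.span {eqn})) eqn = 0 :=
    Ideal.Quotient.eq_zero_iff_mem.2 (Ideal.mem_span_singleton_self _)
  rw [eqn, map_sub, map_prod, map_prod, sub_eq_zero] at this
  exact this

theorem chartHom_z (ε : Fin 3 → Bool) (i : Fin 3) :
    (chartHom ε).toRingHom (z i) = chartZ ε i := liftW_z _ _ _ i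

theorem chartHom_w (ε : Fin 3 → Bool) (i : Fin 3) :
    (chartHom ε).toRingHom (w i) = chartW ε i := liftW_w _ _ _ i

theorem chartHom_divisor (ε : Fin 3 → Bool) (i : Fin 3) :
    chartHom ε (if ε i = true then z i else w i) = b ε i := by
  split_ifs with h <;> simp [chartZ, chartW, h]

theorem chartHom_multiple (ε : Fin 3 → Bool) (i : Fin 3) :
    chartHom ε (if ε i = true then w i else z i) = s ε i * b ε i := by
  split_ifs with h <;> simp [chartZ, chartW, h]

/-- A chart represents its condition. -/
theorem isUniversal_chartMap (ε : Fin 3 → Bool) : IsUniversal (ChartCondition ε) (chartMap ε) := by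
  refine isUniversal_Spec (chartHom ε).toRingHom _ _ (fun i ↦ ?_) (fun i ↦ ?_) ?_
  · exact mem_nonZeroDivisors_of_ne_zero ((chartHom_divisor ε i).trans_ne (b_ne_zero ε i))
  · exact ⟨s ε i, (chartHom_multiple ε i).trans
      ((mul_comm _ _).trans (congrArg (· * s ε i) (chartHom_divisor ε i).symm))⟩
  · intro B _ ψ h₁ h₂
    let _ := (ψ.comp (algebraMap ℂ RingW)).toAlgebra
    choose c hc using h₂
    set a : Fin 3 → B := fun i ↦ ψ (if ε i = true then z i else w i) with ha
    have hz : ∀ i, ψ (z i) = (if ε i = true then 1 else c i) * a i := by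
      intro i
      have := hc i
      simp only [ha]
      split_ifs at this ⊢ <;> simp [this, mul_comm]
    have hw : ∀ i, ψ (w i) = (if ε i = true then c i else 1) * a i := by
      intro i
      have := hc i
      simp only [ha]
      split_ifs at this ⊢ <;> simp [this, mul_comm]
    have hrel : ChartRel ε c := by
      have := congrArg ψ prod_z_eq_prod_w
      simp only [map_prod, hz, hw, Finset.prod_mul_distrib] at this
      exact (mul_cancel_right_mem_nonZeroDivisors (prod_mem fun i _ ↦ h₁ i)).1 this.symm
    have hs : ∀ χ : RingU ε →+* B, χ.comp (chartHom ε).toRingHom = ψ →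
        (∀ i, χ (b ε i) = a i) ∧ ∀ i, χ (s ε i) = c i := by
      intro χ hχ
      have hb : ∀ i, χ (b ε i) = a i := fun i ↦ by
        rw [← chartHom_divisor]
        exact congr($hχ _)
      refine ⟨hb, fun i ↦ (mul_cancel_right_mem_nonZeroDivisors (h₁ i)).1 ?_⟩
      have h2 := congr($hχ (if ε i = true then w i else z i))
      have h3 : χ (chartHom ε (if ε i = true then w i else z i)) = _ := h2
      rw [chartHom_multiple, map_mul, hb] at h3
      rw [mul_comm (c i), ← hc i, ← h3]
    have hcalg : ∀ χ : RingU ε →+* B, χ.comp (chartHom ε).toRingHom = ψ → ∀ t : ℂ,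
        χ (algebraMap ℂ _ t) = ψ (algebraMap ℂ _ t) := by
      intro χ hχ t
      rw [← hχ]
      exact congrArg χ ((chartHom ε).commutes t).symm
    obtain ⟨Λ, hΛc, hΛs, hΛb⟩ : ∃ Λ : RingU ε →+* B,
        (∀ t : ℂ, Λ (algebraMap ℂ _ t) = ψ (algebraMap ℂ _ t)) ∧ (∀ i, Λ (s ε i) = c i) ∧
          ∀ i, Λ (b ε i) = a i :=
      ⟨(liftU c a hrel).toRingHom, fun t ↦ (liftU c a hrel).commutes t, liftU_s c a hrel,
        liftU_b c a hrel⟩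
    refine ⟨Λ, ?_, fun χ hχ ↦ ?_⟩
    · have h1 : ∀ t : ℂ, (chartHom ε).toRingHom (algebraMap ℂ _ t) = algebraMap ℂ _ t :=
        (chartHom ε).commutes
      have h2 := chartHom_z ε
      have h3 := chartHom_w ε
      generalize (chartHom ε).toRingHom = κ at h1 h2 h3
      refine RingW.hom_ext (fun t ↦ ?_) (fun i ↦ ?_) fun i ↦ ?_
      · rw [RingHom.comp_apply, h1, hΛc]
      · rw [RingHom.comp_apply, h2, hz, chartZ]
        split_ifs <;> simp [hΛs, hΛb]
      · rw [RingHom.comp_apply, h3, hw, chartW]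
        split_ifs <;> simp [hΛs, hΛb]
    · obtain ⟨h1, h2⟩ := hs χ hχ
      exact RingU.hom_ext (fun t ↦ (hcalg χ hχ t).trans (hΛc t).symm)
        (fun i ↦ (h2 i).trans (hΛs i).symm) fun i ↦ (h1 i).trans (hΛb i).symm

namespace BlowupTower

variable (B : BlowupTower)

theorem exists_chart (ε : Fin 3 → Bool) : ∃ φ : U ε ⟶ B.Z, IsOpenImmersion φ ∧
    φ ≫ B.σ = chartMap ε ∧ Set.range φ = ChartCondition ε B.σ :=
  B.isUniversal.exists_isOpenImmersion (isUniversal_chartMap ε) (chartCondition_isOpenIn ε)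
    (chartCondition_le ε)

/-- The open immersion of a chart. -/
def φ (ε : Fin 3 → Bool) : U ε ⟶ B.Z := (B.exists_chart ε).choose

instance (ε : Fin 3 → Bool) : IsOpenImmersion (B.φ ε) := (B.exists_chart ε).choose_spec.1

theorem φ_σ (ε : Fin 3 → Bool) : B.φ ε ≫ B.σ = chartMap ε := (B.exists_chart ε).choose_spec.2.1

theorem range_φ (ε : Fin 3 → Bool) : Set.range (B.φ ε) = ChartCondition ε B.σ :=
  (B.exists_chart ε).choose_spec.2.2

theorem exists_mem_range_φ (x : B.Z) : ∃ ε, x ∈ Set.range (B.φ ε) := by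
  obtain ⟨ε, h⟩ := exists_mem_chartCondition B.σ B.isUniversal.self x
  exact ⟨ε, B.range_φ ε ▸ h⟩

end BlowupTower

/-! ### Points of affine schemes -/

/-- The prime ideal of a point of an affine scheme. -/
def primeIdeal {R : Type u} [CommRing R] (x : Spec (CommRingCat.of R)) : Ideal R :=
  PrimeSpectrum.asIdeal (R := R) x

/-- The point of an affine scheme with a given prime ideal. -/
def ofPrime {R : Type u} [CommRing R] (p : Ideal R) (hp : p.IsPrime) : Spec (CommRingCat.of R) :=
  (⟨p, hp⟩ : PrimeSpectrum R)

@[simp]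
theorem primeIdeal_ofPrime {R : Type u} [CommRing R] (p : Ideal R) (hp : p.IsPrime) :
    primeIdeal (ofPrime p hp) = p := rfl

theorem isPrime_primeIdeal {R : Type u} [CommRing R] (x : Spec (CommRingCat.of R)) :
    (primeIdeal x).IsPrime :=
  PrimeSpectrum.isPrime (R := R) x

theorem primeIdeal_map {R A : Type u} [CommRing R] [CommRing A] (φ : R →+* A)
    (x : Spec (CommRingCat.of A)) :
    primeIdeal (Spec.map (CommRingCat.ofHom φ) x) = (primeIdeal x).comap φ := rfl

theorem mem_idealSheaf_support {R : Type u} [CommRing R] (I : Ideal R)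
    (x : Spec (CommRingCat.of R)) : x ∈ (idealSheaf R I).support ↔ I ≤ primeIdeal x := by
  rw [← SetLike.mem_coe, idealSheaf_support]
  rfl

theorem mem_closure_ofPrime {R : Type u} [CommRing R] (p : Ideal R) (hp : p.IsPrime)
    (x : Spec (CommRingCat.of R)) : x ∈ closure {ofPrime p hp} ↔ p ≤ primeIdeal x :=
  (PrimeSpectrum.le_iff_mem_closure (⟨p, hp⟩ : PrimeSpectrum R) (x : PrimeSpectrum R)).symm

/-! ### Strict transforms -/

theorem isUnit_stalkHom_iff {R : Type u} [CommRing R] {V : Scheme.{u}}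
    (g : V ⟶ Spec (CommRingCat.of R)) (v : V) (r : R) :
    IsUnit (stalkHom g v r) ↔ r ∉ primeIdeal (g v) := by
  have e := stalkHom_comp g (𝟙 _) v r
  rw [Category.comp_id] at e
  have h1 : IsUnit (stalkHom g v r) ↔ IsUnit (stalkHom (𝟙 (Spec (CommRingCat.of R))) (g v) r) := by
    rw [e]
    exact isUnit_map_iff (g.stalkMap v).hom _
  rw [h1]
  let _ := (stalkHom (𝟙 (Spec (CommRingCat.of R))) (g v)).toAlgebra
  let p : PrimeSpectrum R := g v
  have i : IsLocalization.AtPrime _ p.asIdeal :=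
    isLocalization_stalkHom_id (R := CommRingCat.of R) p
  exact IsLocalization.AtPrime.isUnit_to_map_iff ((Spec (CommRingCat.of R)).presheaf.stalk (g v))
    p.asIdeal r

theorem mem_support_comap {R : Type u} [CommRing R] (I : Ideal R) {V : Scheme.{u}}
    (g : V ⟶ Spec (CommRingCat.of R)) (v : V) :
    v ∈ ((idealSheaf R I).comap g).support ↔ I ≤ primeIdeal (g v) := by
  rw [Scheme.IdealSheafData.support_comap, ← mem_idealSheaf_support]
  rfl

/-- Taking strict transforms commutes with closures, as a blow-up is an isomorphism outside its
centre. -/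
theorem strictTransform_closure {R : Type u} [CommRing R] {a b : R} {X Y : Scheme.{u}}
    {ρ : X ⟶ Spec (CommRingCat.of R)} {π : Y ⟶ X}
    (h : IsUniversal (fun _ g ↦ Principal a b (g ≫ ρ)) π) (A : Set X) :
    strictTransform π ((idealSheaf R (Ideal.span {a, b})).comap ρ) (Closeds.closure A) =
      Closeds.closure
        (π ⁻¹' (A \ (((idealSheaf R (Ideal.span {a, b})).comap ρ).support : Set X))) := by
  set I := (idealSheaf R (Ideal.span {a, b})).comap ρ
  set p : PointCondition X := fun _ g ↦ Principal a b (g ≫ ρ) with hpdef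
  have hp : p.IsLocal := isLocal_comp (Principal.isLocal a b) ρ
  let N : X.Opens := I.support.compl
  have hN : IsUniversal (p.over (Set.range N.ι)) (𝟙 N.toScheme ≫ N.ι) := by
    refine IsUniversal.comp_isOpenImmersion N.ι ?_
    have key : ∀ {V : Scheme.{u}} (g : V ⟶ N), p (g ≫ N.ι) = Set.univ := by
      intro V g
      refine Set.eq_univ_of_forall fun v ↦ ?_
      have hv : (N.ι (g v)) ∉ I.support := (g v).2
      rw [mem_support_comap, Ideal.span_le] at hv
      have : ¬ (a ∈ primeIdeal (ρ (N.ι (g v))) ∧ b ∈ primeIdeal (ρ (N.ι (g v)))) := fun h ↦ hv (by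
        rintro _ (rfl | rfl)
        exacts [h.1, h.2])
      rcases not_and_or.1 this with h | h
      · have := (isUnit_stalkHom_iff ((g ≫ N.ι) ≫ ρ) v a).2 h
        exact Or.inl ⟨this.mem_nonZeroDivisors, this.dvd⟩
      · have := (isUnit_stalkHom_iff ((g ≫ N.ι) ≫ ρ) v b).2 h
        exact Or.inr ⟨this.mem_nonZeroDivisors, this.dvd⟩
    exact ⟨key _, fun g _ ↦ ⟨g, Category.comp_id g, fun m hm ↦ (Category.comp_id m).symm.trans hm⟩⟩
  rw [Category.id_comp, Scheme.Opens.range_ι] at hN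
  have hu : IsUniversal (p.over Set.univ) π := h.congr fun g ↦ by simp [PointCondition.over, hpdef]
  obtain ⟨φ, _, hφ, hr⟩ := hu.exists_isOpenImmersion hN
    (PointCondition.isOpenIn_over hp N.isOpen _) fun g hg ↦ by
      have : p g = Set.univ := Set.univ_subset_iff.1 (hg ▸ Set.inter_subset_right)
      rw [PointCondition.over, this, Set.inter_univ, Set.preimage_univ]
  refine le_antisymm (Closeds.closure_le.2 ?_) (Closeds.closure_le.2 ?_)
  · rintro y ⟨hyA, hyC⟩
    obtain ⟨n, rfl⟩ : y ∈ Set.range φ := by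
      rw [hr, PointCondition.over, show p π = Set.univ from h.self, Set.inter_univ]
      exact hyC
    have hφn : ∀ n, π (φ n) = n.1 := fun n ↦ congr($hφ n)
    refine mem_closure_iff.2 fun O hO hnO ↦ ?_
    have h1 : IsOpen (N.ι '' (φ ⁻¹' O)) :=
      N.ι.isOpenEmbedding.isOpenMap _ (hO.preimage φ.continuous)
    obtain ⟨_, ⟨m, hmO, rfl⟩, hmA⟩ := mem_closure_iff.1 hyA _ h1
      ⟨n, hnO, (hφn n).symm⟩
    refine ⟨φ m, hmO, ?_⟩
    change π (φ m) ∈ A \ (I.support : Set X)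
    rw [hφn]
    exact ⟨hmA, m.2⟩
  · rintro y ⟨hyA, hyC⟩
    exact subset_closure ⟨subset_closure hyA, hyC⟩

namespace BlowupTower

variable (B : BlowupTower)

/-- A strict transform under the tower is the closure of the inverse image of the part outside all
three centres. -/
theorem strict_eq (i j : Fin 3) : B.strict i j = Closeds.closure
    (B.σ ⁻¹' {x | x ∈ (prodY i j).support ∧ ∀ m, x ∉ (prodY m m).support}) := by
  have h1 : strictTransform B.σ₁ (prodY 0 0) (prodY i j).support = Closeds.closure (B.σ₁ ⁻¹'
      (((prodY i j).support : Set W) \ (prodY 0 0).support)) := rfl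
  have h2 := strictTransform_closure B.isUniversal₂
    (B.σ₁ ⁻¹' (((prodY i j).support : Set W) \ (prodY 0 0).support))
  have h3 := strictTransform_closure B.isUniversal₃ (B.σ₂ ⁻¹' ((B.σ₁ ⁻¹'
    (((prodY i j).support : Set W) \ (prodY 0 0).support)) \ B.C₂.support))
  rw [strict, h1]
  refine (congrArg _ h2).trans (h3.trans (congrArg _ ?_))
  ext x
  have c2 : B.σ₂ (B.σ₃ x) ∈ B.C₂.support ↔ B.σ x ∈ (prodY 1 1).support := by
    rw [C₂, Scheme.IdealSheafData.support_comap]; rfl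
  have c3 : B.σ₃ x ∈ B.C₃.support ↔ B.σ x ∈ (prodY 2 2).support := by
    rw [C₃, Scheme.IdealSheafData.support_comap]; rfl
  change (((B.σ x ∈ (prodY i j).support ∧ B.σ x ∉ (prodY 0 0).support) ∧
    B.σ₂ (B.σ₃ x) ∉ B.C₂.support) ∧ B.σ₃ x ∉ B.C₃.support) ↔ B.σ x ∈ (prodY i j).support ∧
      ∀ m, B.σ x ∉ (prodY m m).support
  rw [c2, c3, Fin.forall_fin_succ, Fin.forall_fin_two]
  change _ ↔ _ ∧ _ ∧ B.σ x ∉ (prodY 1 1).support ∧ B.σ x ∉ (prodY 2 2).support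
  tauto

/-- The first exceptional divisor is taken whole; only the two later blow-ups remove their
centres. -/
theorem exc₁_eq : B.exc₁ = Closeds.closure (B.σ ⁻¹' {x | x ∈ (prodY 0 0).support ∧
    x ∉ (prodY 1 1).support ∧ x ∉ (prodY 2 2).support}) := by
  have h1 : ((prodY 0 0).comap B.σ₁).support = Closeds.closure (B.σ₁ ⁻¹'
      ((prodY 0 0).support : Set W)) := by
    rw [Scheme.IdealSheafData.support_comap]
    ext1
    exact ((prodY 0 0).support.preimage B.σ₁.continuous).isClosed.closure_eq.symm
  have h2 := strictTransform_closure B.isUniversal₂ (B.σ₁ ⁻¹' ((prodY 0 0).support : Set W))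
  have h3 := strictTransform_closure B.isUniversal₃ (B.σ₂ ⁻¹' ((B.σ₁ ⁻¹'
    ((prodY 0 0).support : Set W)) \ B.C₂.support))
  rw [exc₁, h1]
  refine (congrArg _ h2).trans (h3.trans (congrArg _ ?_))
  ext x
  have c2 : B.σ₂ (B.σ₃ x) ∈ B.C₂.support ↔ B.σ x ∈ (prodY 1 1).support := by
    rw [C₂, Scheme.IdealSheafData.support_comap]; rfl
  have c3 : B.σ₃ x ∈ B.C₃.support ↔ B.σ x ∈ (prodY 2 2).support := by
    rw [C₃, Scheme.IdealSheafData.support_comap]; rfl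
  change ((B.σ x ∈ (prodY 0 0).support ∧ B.σ₂ (B.σ₃ x) ∉ B.C₂.support) ∧
    B.σ₃ x ∉ B.C₃.support) ↔ B.σ x ∈ (prodY 0 0).support ∧ B.σ x ∉ (prodY 1 1).support ∧
      B.σ x ∉ (prodY 2 2).support
  rw [c2, c3, and_assoc]

theorem exc₂_eq : B.exc₂ = Closeds.closure (B.σ ⁻¹' {x | x ∈ (prodY 1 1).support ∧
    x ∉ (prodY 2 2).support}) := by
  have h1 : (B.C₂.comap B.σ₂).support = Closeds.closure ((B.σ₂ ≫ B.σ₁) ⁻¹'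
      ((prodY 1 1).support : Set W)) := by
    rw [C₂, ← Scheme.IdealSheafData.comap_comp, Scheme.IdealSheafData.support_comap]
    ext1
    exact ((prodY 1 1).support.preimage (B.σ₂ ≫ B.σ₁).continuous).isClosed.closure_eq.symm
  have h3 := strictTransform_closure B.isUniversal₃
    ((B.σ₂ ≫ B.σ₁) ⁻¹' ((prodY 1 1).support : Set W))
  rw [exc₂, h1]
  refine h3.trans (congrArg _ ?_)
  ext x
  have c3 : B.σ₃ x ∈ B.C₃.support ↔ B.σ x ∈ (prodY 2 2).support := by
    rw [C₃, Scheme.IdealSheafData.support_comap]; rfl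
  change (B.σ x ∈ (prodY 1 1).support ∧ B.σ₃ x ∉ B.C₃.support) ↔
    B.σ x ∈ (prodY 1 1).support ∧ B.σ x ∉ (prodY 2 2).support
  rw [c3]

theorem mem_exc₃ (x : B.Z) : x ∈ B.exc₃ ↔ B.σ x ∈ (prodY 2 2).support := by
  rw [exc₃, C₃, Scheme.IdealSheafData.support_comap, Scheme.IdealSheafData.support_comap]
  rfl

end BlowupTower

/-! ### The divisors in the charts -/

/-- An ideal killed by `ψ` is its kernel if the quotient map factors through `ψ`. -/
theorem RingU.ker_eq_of_factor {ε : Fin 3 → Bool} {B : Type*} [CommRing B] [Algebra ℂ B]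
    {I : Ideal (RingU ε)} (ψ : RingU ε →ₐ[ℂ] B) (hψ : I ≤ RingHom.ker ψ.toRingHom)
    (θ : B →ₐ[ℂ] RingU ε ⧸ I) (hs : ∀ i, θ (ψ (s ε i)) = Ideal.Quotient.mk I (s ε i))
    (hb : ∀ i, θ (ψ (b ε i)) = Ideal.Quotient.mk I (b ε i)) : RingHom.ker ψ.toRingHom = I := by
  refine le_antisymm (fun x hx ↦ ?_) hψ
  have h : θ.comp ψ = Ideal.Quotient.mkₐ ℂ I := RingU.algHom_ext hs hb
  have hx : ψ x = 0 := hx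
  rw [← Ideal.Quotient.eq_zero_iff_mem, ← Ideal.Quotient.mkₐ_eq_mk ℂ, ← h, AlgHom.comp_apply, hx,
    map_zero]

/-- The coordinate ring `ℂ[s, b₁, b₂, b₃]` of a strict transform in a chart. -/
abbrev RingV : Type := MvPolynomial (Option (Fin 3)) ℂ

/-- The third index. -/
def third (i j : Fin 3) : Fin 3 := -(i + j)

theorem third_ne {i j : Fin 3} (h : i ≠ j) : third i j ≠ i ∧ third i j ≠ j := by
  revert i j; decide

theorem eq_or_eq_third {i j : Fin 3} (h : i ≠ j) (l : Fin 3) : l = i ∨ l = j ∨ l = third i j := by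
  revert i j l; decide

theorem chartRel_of_zero {A : Type*} [CommRing A] {ε : Fin 3 → Bool} {i j : Fin 3}
    (hi : ε i = false) (hj : ε j = true) {s : Fin 3 → A} (si : s i = 0) (sj : s j = 0) :
    ChartRel ε s := by
  rw [ChartRel, Finset.prod_eq_zero (Finset.mem_univ j) (by simp [hj, sj]),
    Finset.prod_eq_zero (Finset.mem_univ i) (by simp [hi, si])]

theorem ne_of_chart {ε : Fin 3 → Bool} {i j : Fin 3} (hi : ε i = false) (hj : ε j = true) :
    i ≠ j := by
  rintro rfl
  simp [hi] at hj

/-- The restriction of functions to a strict transform in a chart. -/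
def toV {ε : Fin 3 → Bool} {i j : Fin 3} (hi : ε i = false) (hj : ε j = true) :
    RingU ε →ₐ[ℂ] RingV :=
  liftU (fun l ↦ if l = i ∨ l = j then 0 else MvPolynomial.X none)
    (fun l ↦ MvPolynomial.X (some l)) (chartRel_of_zero hi hj (by simp) (by simp))

theorem ker_toV {ε : Fin 3 → Bool} {i j : Fin 3} (hi : ε i = false) (hj : ε j = true) :
    RingHom.ker (toV hi hj).toRingHom = Ideal.span {s ε i, s ε j} := by
  have hij := ne_of_chart hi hj
  refine RingU.ker_eq_of_factor _ ?_ (MvPolynomial.aeval (R := ℂ) fun o : Option (Fin 3) ↦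
    o.elim (Ideal.Quotient.mk (Ideal.span {s ε i, s ε j}) (s ε (third i j)))
    fun l ↦ Ideal.Quotient.mk (Ideal.span {s ε i, s ε j}) (b ε l)) (fun l ↦ ?_) fun l ↦ ?_
  · rw [Ideal.span_le]
    rintro _ (rfl | rfl)
    · exact (liftU_s _ _ _ i).trans (by simp)
    · exact (liftU_s _ _ _ j).trans (by simp)
  · rw [toV, liftU_s]
    rcases eq_or_eq_third hij l with rfl | rfl | rfl
    · simp only [true_or, if_true, map_zero]
      exact (Ideal.Quotient.eq_zero_iff_mem.2 (Ideal.subset_span (by simp))).symm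
    · simp only [or_true, if_true, map_zero]
      exact (Ideal.Quotient.eq_zero_iff_mem.2 (Ideal.subset_span (by simp))).symm
    · simp [third_ne hij]
  · rw [toV, liftU_b]
    simp

theorem isPrime_span_s {ε : Fin 3 → Bool} {i j : Fin 3} (hi : ε i = false) (hj : ε j = true) :
    (Ideal.span {s ε i, s ε j}).IsPrime :=
  ker_toV hi hj ▸ RingHom.ker_isPrime _

theorem chartRel_s (ε : Fin 3 → Bool) : ChartRel ε (s ε) := chart_relation ε

/-- Setting a set of coordinates `b_i` equal to zero. -/
def killB (ε : Fin 3 → Bool) (I : Set (Fin 3)) [DecidablePred (· ∈ I)] : RingU ε →ₐ[ℂ] RingU ε :=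
  liftU (s ε) (fun i ↦ if i ∈ I then 0 else b ε i) (chartRel_s ε)

theorem ker_killB (ε : Fin 3 → Bool) (I : Set (Fin 3)) [DecidablePred (· ∈ I)] :
    RingHom.ker (killB ε I).toRingHom = Ideal.span (b ε '' I) := by
  refine RingU.ker_eq_of_factor _ ?_ (Ideal.Quotient.mkₐ ℂ _) (fun l ↦ ?_) fun l ↦ ?_
  · rw [Ideal.span_le]
    rintro _ ⟨i, hi, rfl⟩
    exact (liftU_b _ _ _ i).trans (if_pos hi)
  · rw [killB, liftU_s, Ideal.Quotient.mkₐ_eq_mk]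
  · rw [killB, liftU_b, Ideal.Quotient.mkₐ_eq_mk]
    split_ifs with h
    · rw [map_zero]
      exact (Ideal.Quotient.eq_zero_iff_mem.2 (Ideal.subset_span (Set.mem_image_of_mem _ h))).symm
    · rfl

theorem isPrime_span_b (ε : Fin 3 → Bool) (I : Set (Fin 3)) :
    (Ideal.span (b ε '' I)).IsPrime := by
  classical
  exact ker_killB ε I ▸ RingHom.ker_isPrime _

/-- The point of a chart with given complex coordinates. -/
def point {ε : Fin 3 → Bool} (s b : Fin 3 → ℂ) (h : ChartRel ε s) : U ε :=
  ofPrime (RingHom.ker (liftU s b h).toRingHom) (RingHom.ker_isPrime _)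

theorem mem_point {ε : Fin 3 → Bool} (s b : Fin 3 → ℂ) (h : ChartRel ε s) (r : RingU ε) :
    r ∈ primeIdeal (point s b h) ↔ liftU s b h r = 0 := by
  rw [point, primeIdeal_ofPrime]
  rfl

theorem b_mem_point {ε : Fin 3 → Bool} (s' b' : Fin 3 → ℂ) (h : ChartRel ε s') (i : Fin 3) :
    b ε i ∈ primeIdeal (point s' b' h) ↔ b' i = 0 := by
  rw [mem_point, liftU_b]

theorem s_mem_point {ε : Fin 3 → Bool} (s' b' : Fin 3 → ℂ) (h : ChartRel ε s') (i : Fin 3) :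
    s ε i ∈ primeIdeal (point s' b' h) ↔ s' i = 0 := by
  rw [mem_point, liftU_s]

/-- The ideal on a chart of the component labelled by the pair `(i, j)`: the strict transform of
`Y_i × Y_j` for `i ≠ j`, an exceptional divisor for `i = j`. -/
def chartI (ε : Fin 3 → Bool) (p : Fin 3 × Fin 3) : Ideal (RingU ε) :=
  if p.1 = p.2 then Ideal.span {b ε p.1} else chartStrict ε p.1 p.2

/-- The pair of indices of a component. -/
def label : ℕ → Fin 3 × Fin 3
  | 1 => (0, 1)
  | 2 => (0, 2)
  | 3 => (1, 0)
  | 4 => (1, 2)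
  | 5 => (2, 0)
  | 6 => (2, 1)
  | 7 => (0, 0)
  | 8 => (1, 1)
  | 9 => (2, 2)
  | _ => (0, 0)

theorem chartT_eq (ε : Fin 3 → Bool) {k : ℕ} (hk : k ∈ Finset.Icc 1 9) :
    chartT ε k = chartI ε (label k) := by
  rw [Finset.mem_Icc] at hk
  obtain ⟨h1, h2⟩ := hk
  interval_cases k <;> simp [chartT, chartI, label]

theorem label_injOn {k k' : ℕ} (hk : k ∈ Finset.Icc 1 9) (hk' : k' ∈ Finset.Icc 1 9)
    (h : label k = label k') : k = k' := by
  have key : ∀ k ∈ Finset.Icc 1 9, ∀ k' ∈ Finset.Icc 1 9, label k = label k' → k = k' := by decide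
  exact key k hk k' hk' h

/-- Whether the component with a given label meets a chart. -/
def Meets (ε : Fin 3 → Bool) (p : Fin 3 × Fin 3) : Prop :=
  p.1 = p.2 ∨ ε p.1 = false ∧ ε p.2 = true

instance (ε : Fin 3 → Bool) (p : Fin 3 × Fin 3) : Decidable (Meets ε p) :=
  inferInstanceAs (Decidable (_ ∨ _ ∧ _))

theorem chartI_of_not_meets {ε : Fin 3 → Bool} {p : Fin 3 × Fin 3} (h : ¬ Meets ε p) :
    chartI ε p = ⊤ := by
  rw [Meets, not_or] at h
  rw [chartI, if_neg h.1, chartStrict, if_neg h.2]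

theorem chartI_isPrime {ε : Fin 3 → Bool} {p : Fin 3 × Fin 3} (h : Meets ε p) :
    (chartI ε p).IsPrime := by
  rw [chartI]
  split_ifs with hp
  · simpa using isPrime_span_b ε {p.1}
  · have h := h.resolve_left hp
    rw [chartStrict, if_pos h]
    exact isPrime_span_s h.1 h.2

theorem chartI_isRadical (ε : Fin 3 → Bool) (p : Fin 3 × Fin 3) : (chartI ε p).IsRadical := by
  by_cases h : Meets ε p
  · exact (chartI_isPrime h).isRadical
  · rw [chartI_of_not_meets h]
    exact fun _ _ ↦ trivial

theorem chartI_le_iff {ε : Fin 3 → Bool} {p : Fin 3 × Fin 3} (x : U ε) :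
    chartI ε p ≤ primeIdeal x ↔ (p.1 = p.2 ∧ b ε p.1 ∈ primeIdeal x) ∨
      (p.1 ≠ p.2 ∧ ε p.1 = false ∧ ε p.2 = true ∧ s ε p.1 ∈ primeIdeal x ∧
        s ε p.2 ∈ primeIdeal x) := by
  rw [chartI]
  split_ifs with hp
  · simp [hp, Ideal.span_le]
  · rw [chartStrict]
    split_ifs with h
    · simp [hp, h, Ideal.span_le, Set.pair_subset_iff]
    · have : ¬ (⊤ : Ideal (RingU ε)) ≤ primeIdeal x := fun h ↦
        (isPrime_primeIdeal x).ne_top (top_le_iff.1 h)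
      simp only [this, hp, false_iff, false_and, false_or]
      rintro ⟨-, h1, h2, -⟩
      exact h ⟨h1, h2⟩

/-- Coordinates of a point lying on the component labelled by `p` and on no other: the `s`
coordinates. -/
def testS (p : Fin 3 × Fin 3) : Fin 3 → ℂ := fun l ↦
  if p.1 ≠ p.2 ∧ (l = p.1 ∨ l = p.2) then 0 else 1

/-- Coordinates of a point lying on the component labelled by `p` and on no other: the `b`
coordinates. -/
def testB (p : Fin 3 × Fin 3) : Fin 3 → ℂ := fun l ↦ if p.1 = p.2 ∧ l = p.1 then 0 else 1

theorem chartRel_testS {ε : Fin 3 → Bool} {p : Fin 3 × Fin 3} (h : Meets ε p) :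
    ChartRel ε (testS p) := by
  by_cases hp : p.1 = p.2
  · have : testS p = 1 := by
      funext l
      simp [testS, hp]
    rw [this]
    exact chartRel_one ε
  · have h := h.resolve_left hp
    exact chartRel_of_zero h.1 h.2 (by simp [testS, hp]) (by simp [testS, hp])

theorem chartI_le_point_iff {ε : Fin 3 → Bool} {p q : Fin 3 × Fin 3} (h : Meets ε p) :
    chartI ε q ≤ primeIdeal (point (testS p) (testB p) (chartRel_testS h)) ↔ p = q := by
  obtain ⟨i, j⟩ := p
  obtain ⟨i', j'⟩ := q
  rw [chartI_le_iff, b_mem_point, s_mem_point, s_mem_point]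
  simp only [testS, testB, Prod.mk.injEq, ite_eq_left_iff, one_ne_zero, imp_false, not_not,
    Meets] at h ⊢
  constructor
  · rintro (⟨rfl, rfl, rfl⟩ | ⟨h1, h2, h3, ⟨h4, h5⟩, -, h6⟩)
    · simp
    · have h := h.resolve_left h4
      rcases h5 with rfl | rfl
      · rcases h6 with rfl | rfl
        · exact absurd rfl h1
        · simp
      · simp [h.2] at h2
  · rintro ⟨rfl, rfl⟩
    rcases eq_or_ne i j with rfl | hij
    · simp
    · have h := h.resolve_left hij
      simp [hij, h]

/-! ### The special fibre and its components -/

theorem chartZ_chartW_mem_iff (ε : Fin 3 → Bool) (m : Fin 3) (x : U ε) :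
    chartZ ε m ∈ primeIdeal x ∧ chartW ε m ∈ primeIdeal x ↔ b ε m ∈ primeIdeal x := by
  unfold chartZ chartW
  split_ifs
  · exact ⟨fun h ↦ h.1, fun h ↦ ⟨h, Ideal.mul_mem_left _ _ h⟩⟩
  · exact ⟨fun h ↦ h.2, fun h ↦ ⟨Ideal.mul_mem_left _ _ h, h⟩⟩

theorem chartMap_mem_support (ε : Fin 3 → Bool) (i j : Fin 3) (x : U ε) :
    chartMap ε x ∈ (prodY i j).support ↔ chartZ ε i ∈ primeIdeal x ∧ chartW ε j ∈ primeIdeal x := by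
  rw [prodY, mem_idealSheaf_support, Ideal.span_le, Set.pair_subset_iff]
  rw [SetLike.mem_coe, SetLike.mem_coe, chartMap, primeIdeal_map, Ideal.mem_comap, Ideal.mem_comap,
    chartHom_z, chartHom_w]

/-- The locus in a chart whose closure is the component labelled by `p`: the inverse image of
`Y_i × Y_j` outside some of the exceptional divisors. -/
def chartLocus (ε : Fin 3 → Bool) (p : Fin 3 × Fin 3) (M : Set (Fin 3)) :
    Set (U ε) :=
  {x | (chartZ ε p.1 ∈ primeIdeal x ∧ chartW ε p.2 ∈ primeIdeal x) ∧ ∀ m ∈ M, b ε m ∉ primeIdeal x}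

/-- The closure in a chart is computed at the generic point of the component, which lies in the
locus since none of the removed divisors contains the component. -/
theorem closure_chartLocus (ε : Fin 3 → Bool) {p : Fin 3 × Fin 3} {M : Set (Fin 3)}
    (h : ∀ m ∈ M, ¬ (p.1 = p.2 ∧ m = p.1)) (h' : p.1 ≠ p.2 → M = Set.univ) :
    closure (chartLocus ε p M) = (idealSheaf _ (chartI ε p)).support := by
  have hle : chartLocus ε p M ⊆ (idealSheaf _ (chartI ε p)).support := by
    rintro x ⟨⟨h1, h2⟩, h3⟩
    rw [SetLike.mem_coe, mem_idealSheaf_support, chartI_le_iff]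
    by_cases hp : p.1 = p.2
    · refine Or.inl ⟨hp, (chartZ_chartW_mem_iff _ _ _).1 ⟨h1, ?_⟩⟩
      rw [hp]
      exact h2
    · rw [h' hp] at h3
      refine Or.inr ⟨hp, ?_⟩
      unfold chartZ at h1
      unfold chartW at h2
      split_ifs at h1 with h4
      · exact absurd h1 (h3 _ trivial)
      · split_ifs at h2 with h5
        · exact ⟨by simpa using h4, h5,
            ((isPrime_primeIdeal x).mem_or_mem h1).resolve_right (h3 _ trivial),
            ((isPrime_primeIdeal x).mem_or_mem h2).resolve_right (h3 _ trivial)⟩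
        · exact absurd h2 (h3 _ trivial)
  by_cases hm : Meets ε p
  · let η : U ε := ofPrime (chartI ε p) (chartI_isPrime hm)
    have hη : η ∈ chartLocus ε p M := by
      refine ⟨?_, fun m hmM hb ↦ ?_⟩
      · change chartZ ε p.1 ∈ chartI ε p ∧ chartW ε p.2 ∈ chartI ε p
        rw [chartI]
        split_ifs with hp
        · have : b ε p.1 ∈ Ideal.span {b ε p.1} := Ideal.mem_span_singleton_self _
          unfold chartZ chartW
          rw [← hp]
          split_ifs
          · exact ⟨this, Ideal.mul_mem_left _ _ this⟩
          · exact ⟨Ideal.mul_mem_left _ _ this, this⟩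
        · have h4 := hm.resolve_left hp
          rw [chartStrict, if_pos h4, chartZ, chartW, if_neg (by simp [h4.1]), if_pos h4.2]
          exact ⟨Ideal.mul_mem_right _ _ (Ideal.subset_span (by simp)),
            Ideal.mul_mem_right _ _ (Ideal.subset_span (by simp))⟩
      · have h5 := (chartI_le_point_iff hm).2 rfl hb
        rw [b_mem_point] at h5
        simp only [testB, ite_eq_left_iff, one_ne_zero, imp_false, not_not] at h5
        exact h m hmM h5
    refine le_antisymm (closure_minimal hle (Closeds.isClosed _)) ?_
    intro x hx
    have : x ∈ closure {η} := (mem_closure_ofPrime _ _ x).2 ((mem_idealSheaf_support _ x).1 hx)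
    exact closure_mono (Set.singleton_subset_iff.2 hη) this
  · rw [chartI_of_not_meets hm] at hle ⊢
    have e : ((idealSheaf (RingU ε) ⊤).support : Set (U ε)) = ∅ := by
      rw [idealSheaf_support]
      exact PrimeSpectrum.zeroLocus_empty_iff_eq_top.2 rfl
    rw [e] at hle ⊢
    rw [Set.subset_empty_iff.1 hle, closure_empty]

namespace BlowupTower

variable (B : BlowupTower)

theorem σ_φ (ε : Fin 3 → Bool) (x : U ε) : B.σ (B.φ ε x) = chartMap ε x :=
  (Scheme.Hom.comp_apply (B.φ ε) B.σ x).symm.trans congr($(B.φ_σ ε) x)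

theorem φ_preimage_closure (ε : Fin 3 → Bool) (A : Set W) :
    B.φ ε ⁻¹' (Closeds.closure (B.σ ⁻¹' A) : Closeds B.Z) = closure (chartMap ε ⁻¹' A) := by
  rw [Closeds.coe_closure, (B.φ ε).isOpenEmbedding.isOpenMap.preimage_closure_eq_closure_preimage
    (B.φ ε).continuous]
  congr 1
  ext x
  rw [Set.mem_preimage, Set.mem_preimage, Set.mem_preimage, σ_φ]

theorem φ_preimage_strict (ε : Fin 3 → Bool) {i j : Fin 3} (h : i ≠ j) :
    B.φ ε ⁻¹' B.strict i j = (idealSheaf _ (chartI ε (i, j))).support := by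
  rw [strict_eq, φ_preimage_closure, ← closure_chartLocus ε (p := (i, j)) (M := Set.univ)
    (by rintro m - ⟨h1, -⟩; exact h h1) fun _ ↦ rfl]
  congr 1
  ext x
  refine and_congr (chartMap_mem_support ε i j x) ?_
  refine forall_congr' fun m ↦ (not_congr ((chartMap_mem_support ε m m x).trans
    (chartZ_chartW_mem_iff ε m x))).trans ?_
  simp

theorem φ_preimage_exc₁ (ε : Fin 3 → Bool) :
    B.φ ε ⁻¹' B.exc₁ = (idealSheaf _ (chartI ε (0, 0))).support := by
  rw [exc₁_eq, φ_preimage_closure, ← closure_chartLocus ε (p := (0, 0)) (M := {1, 2})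
    (by rintro m (rfl | rfl) <;> simp) (by simp)]
  congr 1
  ext x
  have key := fun m ↦ not_congr ((chartMap_mem_support ε m m x).trans (chartZ_chartW_mem_iff ε m x))
  refine and_congr (chartMap_mem_support ε 0 0 x) ((and_congr (key 1) (key 2)).trans ?_)
  simp

theorem φ_preimage_exc₂ (ε : Fin 3 → Bool) :
    B.φ ε ⁻¹' B.exc₂ = (idealSheaf _ (chartI ε (1, 1))).support := by
  rw [exc₂_eq, φ_preimage_closure, ← closure_chartLocus ε (p := (1, 1)) (M := {2})
    (by rintro m rfl; simp) (by simp)]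
  congr 1
  ext x
  have key := fun m ↦ not_congr ((chartMap_mem_support ε m m x).trans (chartZ_chartW_mem_iff ε m x))
  refine and_congr (chartMap_mem_support ε 1 1 x) ((key 2).trans ?_)
  simp

theorem φ_preimage_exc₃ (ε : Fin 3 → Bool) :
    B.φ ε ⁻¹' B.exc₃ = (idealSheaf _ (chartI ε (2, 2))).support := by
  ext x
  rw [Set.mem_preimage, SetLike.mem_coe, mem_exc₃, σ_φ, chartMap_mem_support,
    chartZ_chartW_mem_iff, SetLike.mem_coe, mem_idealSheaf_support, chartI_le_iff]
  simp

theorem φ_preimage_T (ε : Fin 3 → Bool) {k : ℕ} (hk : k ∈ Finset.Icc 1 9) :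
    B.φ ε ⁻¹' B.T k = (idealSheaf _ (chartI ε (label k))).support := by
  rw [Finset.mem_Icc] at hk
  obtain ⟨h1, h2⟩ := hk
  interval_cases k
  · exact B.φ_preimage_strict ε (by decide)
  · exact B.φ_preimage_strict ε (by decide)
  · exact B.φ_preimage_strict ε (by decide)
  · exact B.φ_preimage_strict ε (by decide)
  · exact B.φ_preimage_strict ε (by decide)
  · exact B.φ_preimage_strict ε (by decide)
  · exact B.φ_preimage_exc₁ ε
  · exact B.φ_preimage_exc₂ ε
  · exact B.φ_preimage_exc₃ ε

theorem φ_mem_T (ε : Fin 3 → Bool) {k : ℕ} (hk : k ∈ Finset.Icc 1 9) (x : U ε) :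
    B.φ ε x ∈ B.T k ↔ chartI ε (label k) ≤ primeIdeal x :=
  (Set.ext_iff.1 (B.φ_preimage_T ε hk) x).trans (mem_idealSheaf_support _ x)

theorem vanishingIdeal_T_comap (ε : Fin 3 → Bool) {k : ℕ} (hk : k ∈ Finset.Icc 1 9) :
    (Scheme.IdealSheafData.vanishingIdeal (B.T k)).comap (B.φ ε) =
      idealSheaf (RingU ε) (chartT ε k) := by
  rw [vanishingIdeal_comap, chartT_eq ε hk]
  exact vanishingIdeal_zeroLocus (chartI_isRadical _ _) _
    ((B.φ_preimage_T ε hk).trans (idealSheaf_support _))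

/-- In a chart the morphism to `S` is given by `t = ∏ z_i`. -/
theorem φ_h (ε : Fin 3 → Bool) : B.φ ε ≫ B.h =
    Spec.map (CommRingCat.ofHom (Polynomial.aeval (R := ℂ) (∏ i, chartZ ε i)).toRingHom) := by
  have e : (chartHom ε).comp ((MvPolynomial.aeval (R := ℂ) z).comp
      (Polynomial.aeval (∏ i, MvPolynomial.X i : MvPolynomial (Fin 3) ℂ))) =
        Polynomial.aeval (R := ℂ) (∏ i, chartZ ε i) := by
    refine Polynomial.algHom_ext ?_
    rw [AlgHom.comp_apply, AlgHom.comp_apply, Polynomial.aeval_X, Polynomial.aeval_X, map_prod,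
      map_prod]
    refine Finset.prod_congr rfl fun i _ ↦ ?_
    rw [MvPolynomial.aeval_X]
    exact chartHom_z ε i
  rw [← e, h, ← Category.assoc, φ_σ, chartMap, p₁, f, ← Spec.map_comp, ← Spec.map_comp]
  rfl

theorem φ_mem_fibre (ε : Fin 3 → Bool) (x : U ε) :
    B.φ ε x ∈ B.fibre ↔ ∏ i, chartZ ε i ∈ primeIdeal x := by
  have h1 : B.φ ε x ∈ B.fibre ↔ x ∈ (origin.comap (B.φ ε ≫ B.h)).support := by
    rw [Scheme.IdealSheafData.comap_comp, Scheme.IdealSheafData.support_comap]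
    rfl
  rw [h1, φ_h, origin, comap_idealSheaf_map, mem_idealSheaf_support, Ideal.map_span,
    Set.image_singleton, Ideal.span_le, Set.singleton_subset_iff, SetLike.mem_coe]
  have e : (Polynomial.aeval (R := ℂ) (∏ i, chartZ ε i)).toRingHom Polynomial.X =
    ∏ i, chartZ ε i := Polynomial.aeval_X _
  rw [e]

end BlowupTower

/-- A set covered by open pieces that are irreducible and pairwise meet is irreducible. -/
theorem isIrreducible_of_openCover {X ι : Type*} [TopologicalSpace X] {T : Set X} {O : ι → Set X}
    (hO : ∀ i, IsOpen (O i)) (hT : T ⊆ ⋃ i, O i) (hne : T.Nonempty)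
    (hirr : ∀ i, IsPreirreducible (T ∩ O i))
    (hmeet : ∀ i j, (T ∩ O i).Nonempty → (T ∩ O j).Nonempty → (T ∩ O i ∩ O j).Nonempty) :
    IsIrreducible T := by
  refine ⟨hne, fun u v hu hv ⟨x, hxT, hxu⟩ ⟨y, hyT, hyv⟩ ↦ ?_⟩
  obtain ⟨i, hi⟩ := Set.mem_iUnion.1 (hT hxT)
  obtain ⟨j, hj⟩ := Set.mem_iUnion.1 (hT hyT)
  obtain ⟨a, ⟨haT, hai⟩, haj⟩ := hmeet i j ⟨x, hxT, hi⟩ ⟨y, hyT, hj⟩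
  obtain ⟨c, ⟨hcT, hci⟩, hcu, hcj⟩ := hirr i u (O j) hu (hO j) ⟨x, ⟨hxT, hi⟩, hxu⟩
    ⟨a, ⟨haT, hai⟩, haj⟩
  obtain ⟨d, ⟨hdT, hdj⟩, ⟨hdu, hdi⟩, hdv⟩ := hirr j (u ∩ O i) v (hu.inter (hO i)) hv
    ⟨c, ⟨hcT, hcj⟩, hcu, hci⟩ ⟨y, ⟨hyT, hj⟩, hyv⟩
  exact ⟨d, hdT, hdu, hdv⟩

/-- If a closed set is a finite union of irreducible closed sets without inclusions, then these
are its irreducible components. -/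
theorem bijOn_components {Z : Scheme.{u}} {A : Closeds Z} {ι : Type*} (s : Finset ι)
    (T : ι → Closeds Z) (irr : ∀ k ∈ s, IsIrreducible (T k : Set Z))
    (hA : (A : Set Z) = ⋃ k ∈ s, (T k : Set Z))
    (inc : ∀ k ∈ s, ∀ l ∈ s, T k ≤ T l → k = l) : Set.BijOn T s (components A) := by
  classical
  have hle : ∀ k ∈ s, T k ≤ A := fun k hk x hx ↦ by
    change x ∈ (A : Set Z)
    rw [hA]
    exact Set.mem_biUnion hk hx
  have hsub : ∀ C : Closeds Z, IsIrreducible (C : Set Z) → C ≤ A → ∃ k ∈ s, C ≤ T k := by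
    intro C hC hCA
    have h1 : (C : Set Z) ⊆ ⋃₀ (s.image fun k ↦ (T k : Set Z)) := by
      refine (show (C : Set Z) ⊆ A from hCA).trans ?_
      rw [hA]
      intro x hx
      obtain ⟨k, hk, hx⟩ := Set.mem_iUnion₂.1 hx
      exact ⟨T k, by simpa using ⟨k, hk, rfl⟩, hx⟩
    obtain ⟨t, ht, hCt⟩ := isIrreducible_iff_sUnion_isClosed.1 hC _ (by
      simp only [Finset.mem_image, forall_exists_index, and_imp, forall_apply_eq_imp_iff₂]
      exact fun k _ ↦ (T k).isClosed) h1
    obtain ⟨k, hk, rfl⟩ := Finset.mem_image.1 ht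
    exact ⟨k, hk, hCt⟩
  refine ⟨fun k hk ↦ ⟨⟨irr k hk, hle k hk⟩, fun C hC hkC ↦ ?_⟩, fun k hk l hl h ↦
    inc k hk l hl h.le, fun C hC ↦ ?_⟩
  · obtain ⟨l, hl, hCl⟩ := hsub C hC.1 hC.2
    rwa [inc k hk l hl (hkC.trans hCl)]
  · obtain ⟨k, hk, hCk⟩ := hsub C hC.1.1 hC.1.2
    exact ⟨k, hk, le_antisymm (hC.2 ⟨irr k hk, hle k hk⟩ hCk) hCk⟩

theorem stalkHom_id_mem_nonZeroDivisors {R : Type u} [CommRing R] {r : R}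
    (hr : r ∈ nonZeroDivisors R) (x : Spec (CommRingCat.of R)) :
    stalkHom (𝟙 (Spec (CommRingCat.of R))) x r ∈ nonZeroDivisors _ := by
  let := (stalkHom (𝟙 (Spec (CommRingCat.of R))) x).toAlgebra
  let x' : PrimeSpectrum R := x
  have := isLocalization_stalkHom_id (R := CommRingCat.of R) x'
  exact IsLocalization.map_nonZeroDivisors_le x'.asIdeal.primeCompl _ ⟨_, hr, rfl⟩

theorem isUnit_stalkHom_id_iff {R : Type u} [CommRing R] (x : Spec (CommRingCat.of R)) (r : R) :
    IsUnit (stalkHom (𝟙 (Spec (CommRingCat.of R))) x r) ↔ r ∉ primeIdeal x :=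
  isUnit_stalkHom_iff (𝟙 (Spec (CommRingCat.of R))) x r

theorem meets_of_mem {ε : Fin 3 → Bool} {p : Fin 3 × Fin 3} {x : U ε}
    (h : chartI ε p ≤ primeIdeal x) : Meets ε p := by
  by_contra hm
  rw [chartI_of_not_meets hm] at h
  exact (isPrime_primeIdeal x).ne_top (top_le_iff.1 h)

theorem exists_meets (p : Fin 3 × Fin 3) : ∃ ε, Meets ε p := by
  revert p; decide

theorem exists_label (p : Fin 3 × Fin 3) : ∃ k ∈ Finset.Icc 1 9, label k = p := by
  revert p; decide

/-- At most five components meet a chart. -/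
theorem card_meets_le (ε : Fin 3 → Bool) :
    ((Finset.Icc 1 9).filter fun k ↦ Meets ε (label k)).card ≤ 5 := by
  revert ε; decide

/-- If five components meet a chart, their labels are among the six listed sets. -/
theorem meets_mem_sixPoints (ε : Fin 3 → Bool) :
    ((Finset.Icc 1 9).filter fun k ↦ Meets ε (label k)).card = 5 →
      (Finset.Icc 1 9).filter (fun k ↦ Meets ε (label k)) ∈ sixPoints := by
  revert ε; decide

namespace BlowupTower

variable (B : BlowupTower)

/-- A point of one chart lies in another one if the coordinates `s_l` that have to be inverted
do not vanish at it. -/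
theorem φ_mem_range {ε ε' : Fin 3 → Bool} {x : U ε}
    (h : ∀ l, ε l ≠ ε' l → s ε l ∉ primeIdeal x) : B.φ ε x ∈ Set.range (B.φ ε') := by
  rw [range_φ]
  change x ∈ B.φ ε ⁻¹' ChartCondition ε' B.σ
  rw [← (chartCondition_isOpenIn ε').isLocal, φ_σ]
  intro i
  have h1 := (isUniversal_chartMap ε).self.ge (Set.mem_univ x) i
  by_cases hi : ε i = ε' i
  · rwa [← hi]
  · have hu := (isUnit_stalkHom_id_iff x _).2 (h i hi)
    have ha : stalkHom (chartMap ε) x (if ε i = true then z i else w i) =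
        stalkHom (𝟙 (U ε)) x (b ε i) := by
      rw [chartMap, stalkHom_map]
      exact congrArg _ (chartHom_divisor ε i)
    have hc : stalkHom (chartMap ε) x (if ε i = true then w i else z i) =
        stalkHom (𝟙 (U ε)) x (s ε i) * stalkHom (𝟙 (U ε)) x (b ε i) := by
      rw [← map_mul, chartMap, stalkHom_map]
      exact congrArg _ (chartHom_multiple ε i)
    have h2 : ε' i = !ε i := by
      revert hi; cases ε i <;> cases ε' i <;> simp
    have h3 : x ∈ Divides (if ε i = true then w i else z i) (if ε i = true then z i else w i)
        (chartMap ε) := by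
      obtain ⟨h4, -⟩ := h1
      refine ⟨?_, ?_⟩
      · rw [hc, ← ha]
        exact mul_mem hu.mem_nonZeroDivisors h4
      · rw [hc, ha]
        exact (hu.dvd_mul_left.1 (dvd_refl _) : _)
    rw [h2]
    revert h3
    cases ε i <;> exact id

theorem exists_φ_eq (x : B.Z) : ∃ ε, ∃ y : U ε, B.φ ε y = x := B.exists_mem_range_φ x

theorem fibre_eq : (B.fibre : Set B.Z) = ⋃ k ∈ Finset.Icc 1 9, (B.T k : Set B.Z) := by
  ext x
  obtain ⟨ε, y, rfl⟩ := B.exists_φ_eq x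
  rw [SetLike.mem_coe, φ_mem_fibre, Set.mem_iUnion₂]
  have hp := isPrime_primeIdeal y
  constructor
  · intro h
    suffices ∃ p, chartI ε p ≤ primeIdeal y by
      obtain ⟨p, h⟩ := this
      obtain ⟨k, hk, rfl⟩ := exists_label p
      exact ⟨k, hk, (B.φ_mem_T ε hk y).2 h⟩
    obtain ⟨i, -, hi⟩ := (hp.prod_mem_iff).1 h
    by_cases hb : b ε i ∈ primeIdeal y
    · exact ⟨(i, i), (chartI_le_iff y).2 (Or.inl ⟨rfl, hb⟩)⟩
    · unfold chartZ at hi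
      split_ifs at hi with hεi
      · exact absurd hi hb
      · have hs := (hp.mem_or_mem hi).resolve_right hb
        have h1 : (∏ i, if ε i = true then s ε i else 1) ∈ primeIdeal y := by
          rw [chart_relation]
          exact Ideal.mem_of_dvd _ (Finset.dvd_prod_of_mem _ (Finset.mem_univ i))
            (by simpa [hεi] using hs)
        obtain ⟨j, -, hj⟩ := (hp.prod_mem_iff).1 h1
        split_ifs at hj with hεj
        · have hεi : ε i = false := by simpa using hεi
          exact ⟨(i, j), (chartI_le_iff y).2 (Or.inr ⟨ne_of_chart hεi hεj, hεi, hεj, hs, hj⟩)⟩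
        · exact absurd ((Ideal.eq_top_iff_one _).2 hj) hp.ne_top
  · rintro ⟨k, hk, h⟩
    have h := (B.φ_mem_T ε hk y).1 h
    rw [chartI_le_iff] at h
    rcases h with ⟨-, h⟩ | ⟨-, h1, -, h2, -⟩
    · refine Ideal.mem_of_dvd _ (Finset.dvd_prod_of_mem _ (Finset.mem_univ (label k).1)) ?_
      unfold chartZ
      split_ifs
      · exact h
      · exact Ideal.mul_mem_left _ _ h
    · refine Ideal.mem_of_dvd _ (Finset.dvd_prod_of_mem _ (Finset.mem_univ (label k).1)) ?_
      rw [chartZ, if_neg (by simp [h1])]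
      exact Ideal.mul_mem_right _ _ h2

/-- A point of `Z` on the component with a given label and on no other. -/
theorem exists_test_point (p : Fin 3 × Fin 3) :
    ∃ x : B.Z, ∀ k ∈ Finset.Icc 1 9, x ∈ B.T k ↔ p = label k := by
  obtain ⟨ε, h⟩ := exists_meets p
  exact ⟨B.φ ε (point (testS p) (testB p) (chartRel_testS h)), fun k hk ↦
    (B.φ_mem_T ε hk _).trans (chartI_le_point_iff h)⟩

/-- The components are not contained in each other, since each has a point on no other one. -/
theorem T_inj {k l : ℕ} (hk : k ∈ Finset.Icc 1 9) (hl : l ∈ Finset.Icc 1 9) (h : B.T k ≤ B.T l) :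
    k = l := by
  obtain ⟨x, hx⟩ := B.exists_test_point (label k)
  exact label_injOn hk hl ((hx l hl).1 (h ((hx k hk).2 rfl)))

/-- A component is irreducible in each chart that it meets, and its pieces in two charts meet in the
point with the test coordinates. -/
theorem isIrreducible_T {k : ℕ} (hk : k ∈ Finset.Icc 1 9) : IsIrreducible (B.T k : Set B.Z) := by
  have hI : ∀ ε, (B.T k : Set B.Z) ∩ Set.range (B.φ ε) =
      B.φ ε '' (idealSheaf _ (chartI ε (label k))).support := fun ε ↦ by
    rw [← B.φ_preimage_T ε hk, Set.image_preimage_eq_inter_range]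
  have hM : ∀ ε, ((B.T k : Set B.Z) ∩ Set.range (B.φ ε)).Nonempty → Meets ε (label k) := by
    rintro ε ⟨_, hx, y, rfl⟩
    exact meets_of_mem ((B.φ_mem_T ε hk y).1 hx)
  refine isIrreducible_of_openCover (fun ε ↦ (B.φ ε).isOpenEmbedding.isOpen_range)
    (fun x _ ↦ Set.mem_iUnion.2 (B.exists_mem_range_φ x)) ?_ (fun ε ↦ ?_) fun ε ε' h1 h2 ↦ ?_
  · obtain ⟨x, hx⟩ := B.exists_test_point (label k)
    exact ⟨x, (hx k hk).2 rfl⟩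
  · rw [hI]
    refine IsPreirreducible.image ?_ _ (B.φ ε).continuous.continuousOn
    by_cases hm : Meets ε (label k)
    · have : ((idealSheaf _ (chartI ε (label k))).support : Set (U ε)) =
          closure {ofPrime _ (chartI_isPrime hm)} := by
        ext x
        rw [mem_closure_ofPrime, SetLike.mem_coe, mem_idealSheaf_support]
      rw [this]
      exact isPreirreducible_singleton.closure
    · convert isPreirreducible_empty
      refine Set.eq_empty_of_forall_notMem fun x hx ↦ hm (meets_of_mem
        ((mem_idealSheaf_support _ x).1 hx))
  · have m1 := hM ε h1
    have m2 := hM ε' h2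
    refine ⟨B.φ ε (point (testS (label k)) (testB (label k)) (chartRel_testS m1)),
      ⟨(B.φ_mem_T ε hk _).2 ((chartI_le_point_iff m1).2 rfl), ⟨_, rfl⟩⟩,
      B.φ_mem_range fun l hl ↦ ?_⟩
    rw [s_mem_point]
    simp only [testS, ite_eq_left_iff, one_ne_zero, imp_false, not_not]
    rintro ⟨h3, h4⟩
    have m1 := m1.resolve_left h3
    have m2 := m2.resolve_left h3
    rcases h4 with rfl | rfl
    · exact hl (m1.1.trans m2.1.symm)
    · exact hl (m1.2.trans m2.2.symm)

theorem bijOn_T : Set.BijOn B.T (Finset.Icc 1 9 : Finset ℕ) (components B.fibre) :=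
  bijOn_components _ _ (fun _ hk ↦ B.isIrreducible_T hk) B.fibre_eq
    fun _ hk _ hl h ↦ B.T_inj hk hl h

theorem ncard_le_five (ε : Fin 3 → Bool) : {k : ℕ | k ∈ Finset.Icc 1 9 ∧
    ((B.T k : Set B.Z) ∩ Set.range (B.φ ε)).Nonempty}.ncard ≤ 5 := by
  refine (Set.ncard_le_ncard (t := (((Finset.Icc 1 9).filter fun k ↦ Meets ε (label k) :
    Finset ℕ) : Set ℕ)) ?_ (Finset.finite_toSet _)).trans ?_
  · rintro k ⟨hk, _, hx, y, rfl⟩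
    rw [Finset.mem_coe, Finset.mem_filter]
    exact ⟨hk, meets_of_mem ((B.φ_mem_T ε hk y).1 hx)⟩
  · rw [Set.ncard_coe_finset]
    exact card_meets_le ε

end BlowupTower

/-! ### The exceptional divisors as proper transforms -/

theorem z_mem_nonZeroDivisors (i : Fin 3) : z i ∈ nonZeroDivisors RingW := by
  rw [mem_nonZeroDivisors_iff_right]
  intro r hr
  obtain ⟨p, rfl⟩ := Ideal.Quotient.mk_surjective r
  rw [z, ← map_mul, Ideal.Quotient.eq_zero_iff_mem, Ideal.mem_span_singleton] at hr
  obtain ⟨q, hq⟩ := hr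
  have hX : Prime (MvPolynomial.X (Sum.inl i) : MvPolynomial (Fin 3 ⊕ Fin 3) ℂ) :=
    MvPolynomial.X_prime
  have h1 : (MvPolynomial.X (Sum.inl i) : MvPolynomial (Fin 3 ⊕ Fin 3) ℂ) ∣ q := by
    refine (hX.dvd_or_dvd (Dvd.intro_left p hq)).resolve_left fun h ↦ ?_
    have h2 := map_dvd (MvPolynomial.aeval (R := ℂ) (Sum.elim (0 : Fin 3 → ℂ) 1)) h
    simp [eqn] at h2
  obtain ⟨q', rfl⟩ := h1
  rw [Ideal.Quotient.eq_zero_iff_mem, Ideal.mem_span_singleton]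
  exact ⟨q', mul_right_cancel₀ hX.ne_zero (by rw [hq]; ring)⟩

/-- A morphism that is universal for a local condition is an isomorphism over an open subset on
which the condition holds already. -/
theorem IsUniversal.isIso_morphismRestrict {X Y : Scheme.{u}} {p : PointCondition X}
    (hp : p.IsLocal) {π : Y ⟶ X} (h : IsUniversal p π) (O : X.Opens)
    (hO : (O : Set X) ⊆ p (𝟙 X)) : IsIso (π ∣_ O) := by
  have h1 : IsUniversal (p.over O) (𝟙 _ ≫ O.ι) := by
    have h2 : IsUniversal (fun _ g ↦ p (g ≫ O.ι)) (𝟙 O.toScheme) := by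
      refine ⟨?_, fun g _ ↦ ⟨g, Category.comp_id g, fun l hl ↦ ?_⟩⟩
      · have := hp O.ι (𝟙 X)
        rw [Category.comp_id] at this
        rw [Category.id_comp, this]
        exact Set.eq_univ_of_forall fun v ↦ hO v.2
      · rw [← hl]; exact (Category.comp_id l).symm
    have h3 := h2.comp_isOpenImmersion O.ι
    rwa [show Set.range O.ι = O from O.range_ι] at h3
  have h4 : IsUniversal (p.over Set.univ) π := h.congr fun g ↦ by
    rw [PointCondition.over, Set.preimage_univ, Set.univ_inter]
  have h5 : IsUniversal (p.over O) ((π ⁻¹ᵁ O).ι ≫ π) := by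
    refine h4.restrict (PointCondition.isOpenIn_over hp O.isOpen _) (fun g hg ↦ ?_) _ ?_
    · refine Set.eq_univ_of_forall fun v ↦ ⟨trivial, (hg.ge (Set.mem_univ v)).2⟩
    · rw [PointCondition.over, h.self, Set.inter_univ]
      rfl
  obtain ⟨e, he⟩ := h5.exists_iso h1
  have : π ∣_ O = e.hom := by
    rw [← cancel_mono O.ι, morphismRestrict_ι, ← he, Category.id_comp]
  rw [this]
  infer_instance

/-- On `W` itself, if all `z_m` and `w_m` with `m ≠ i` are invertible, the equation of `W` makes
`w_i` a multiple of `z_i`. -/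
theorem mem_allPrincipal_id (i : Fin 3) (x : W)
    (h : ∀ m, m ≠ i → z m ∉ primeIdeal x ∧ w m ∉ primeIdeal x) : x ∈ AllPrincipal (𝟙 W) := by
  intro m
  refine Or.inl ⟨stalkHom_id_mem_nonZeroDivisors (z_mem_nonZeroDivisors m) x, ?_⟩
  by_cases hm : m = i
  · subst hm
    have h1 := prod_z_eq_prod_w
    rw [← Finset.mul_prod_erase _ _ (Finset.mem_univ m),
      ← Finset.mul_prod_erase _ _ (Finset.mem_univ m)] at h1
    have h2 : IsUnit (stalkHom (𝟙 W) x (∏ l ∈ Finset.univ.erase m, w l)) := by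
      rw [isUnit_stalkHom_id_iff, (isPrime_primeIdeal x).prod_mem_iff]
      rintro ⟨l, hl, hl'⟩
      exact (h l (Finset.ne_of_mem_erase hl)).2 hl'
    rw [← h2.dvd_mul_right, ← map_mul, ← h1, map_mul]
    exact dvd_mul_right _ _
  · exact ((isUnit_stalkHom_id_iff x _).2 (h m hm).1).dvd

namespace BlowupTower

variable (B : BlowupTower)

/-- `σ` is an isomorphism where all but one of the `z_m` and of the `w_m` are invertible. -/
theorem mem_isoLocus (i : Fin 3) (x : W)
    (h : ∀ m, m ≠ i → z m ∉ primeIdeal x ∧ w m ∉ primeIdeal x) : x ∈ isoLocus B.σ := by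
  let r : RingW := ∏ m ∈ Finset.univ.erase i, (z m * w m)
  have hr : ∀ y : W, r ∉ primeIdeal y ↔ ∀ m, m ≠ i → z m ∉ primeIdeal y ∧ w m ∉ primeIdeal y := by
    intro y
    have hp := isPrime_primeIdeal y
    simp only [r, hp.prod_mem_iff, hp.mul_mem_iff_mem_or_mem]
    simp
  have h1 := B.isUniversal.isIso_morphismRestrict AllPrincipal.isLocal
    (PrimeSpectrum.basicOpen r) fun y hy ↦ mem_allPrincipal_id i y ((hr y).1 hy)
  exact le_sSup (a := PrimeSpectrum.basicOpen r) h1 ((hr x).2 h)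

theorem isOpen_torus (i : Fin 3) :
    IsOpen {x : W | ∀ m, m ≠ i → z m ∉ primeIdeal x ∧ w m ∉ primeIdeal x} := by
  have h (r : RingW) : IsOpen {x : W | r ∉ primeIdeal x} := (PrimeSpectrum.basicOpen r).isOpen
  simp only [Set.ofPred_forall, Set.ofPred_and]
  exact isOpen_iInter_of_finite fun m ↦ isOpen_iInter_of_finite fun _ ↦ (h _).inter (h _)

/-- The divisor is irreducible and meets the locus where `σ` is an isomorphism, hence is the closure
of its intersection with it. -/
theorem T_eq_properTransform {k : ℕ} (hk : k ∈ Finset.Icc 1 9) {i : Fin 3}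
    (hi : label k = (i, i)) : B.T k = properTransform B.σ (prodY i i).support := by
  have hmem : ∀ x : B.Z, x ∈ B.T k ↔ B.σ x ∈ (prodY i i).support := by
    intro x
    obtain ⟨ε, y, rfl⟩ := B.exists_φ_eq x
    rw [σ_φ, φ_mem_T _ _ hk, hi, chartMap_mem_support, chartZ_chartW_mem_iff, chartI_le_iff]
    simp
  apply le_antisymm
  · have h1 : ((B.T k : Set B.Z) ∩ B.σ ⁻¹' {x : W | ∀ m, m ≠ i → z m ∉ primeIdeal x ∧
        w m ∉ primeIdeal x}).Nonempty := by
      obtain ⟨ε, hε⟩ := exists_meets (i, i)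
      refine ⟨B.φ ε (point (testS (i, i)) (testB (i, i)) (chartRel_testS hε)), ?_, ?_⟩
      · exact (B.φ_mem_T ε hk _).2 ((chartI_le_point_iff hε).2 hi.symm)
      · intro m hm
        have hb : b ε m ∉ primeIdeal (point (testS (i, i)) (testB (i, i)) (chartRel_testS hε)) := by
          rw [b_mem_point]; simp [testB, hm]
        have hs : s ε m ∉ primeIdeal (point (testS (i, i)) (testB (i, i)) (chartRel_testS hε)) := by
          rw [s_mem_point]; simp [testS]
        have hsb := (isPrime_primeIdeal _).mul_notMem hs hb
        rw [σ_φ, chartMap, primeIdeal_map, Ideal.mem_comap, Ideal.mem_comap, chartHom_z, chartHom_w,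
          chartZ, chartW]
        split_ifs
        exacts [⟨hb, hsb⟩, ⟨hsb, hb⟩]
    intro x hx
    refine closure_mono ?_ (subset_closure_inter_of_isPreirreducible_of_isOpen
      (B.isIrreducible_T hk).isPreirreducible ((isOpen_torus i).preimage B.σ.continuous) h1 hx)
    exact fun y hy ↦ ⟨(hmem y).1 hy.1, B.mem_isoLocus i _ hy.2⟩
  · exact closure_minimal (fun x hx ↦ (hmem x).2 hx.1) (B.T k).isClosed

end BlowupTower

/-! ### Disjoint unions of strata -/

/-- Equal ideal sheaves define isomorphic closed subschemes. -/
def subschemeIsoOfEq {Z : Scheme.{u}} {I J : Z.IdealSheafData} (h : I = J) :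
    I.subscheme ≅ J.subscheme := eqToIso (by rw [h])

theorem subschemeIsoOfEq_hom_ι {Z : Scheme.{u}} {I J : Z.IdealSheafData} (h : I = J) :
    (subschemeIsoOfEq h).hom ≫ J.subschemeι = I.subschemeι := by
  subst h
  exact Category.id_comp _

/-- A disjoint union of closed subschemes is unchanged when it is reindexed and empty subschemes
are added. -/
theorem exists_sigma_subscheme_iso {Z : Scheme.{u}} {ι κ : Type u} {I : ι → Z.IdealSheafData}
    {J : κ → Z.IdealSheafData} (e : ι → κ) (he : e.Injective) (h : ∀ i, I i = J (e i))
    (h' : ∀ k, k ∉ Set.range e → J k = ⊤) :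
    ∃ E : (∐ fun i ↦ (I i).subscheme) ≅ ∐ fun k ↦ (J k).subscheme,
      E.hom ≫ Sigma.desc (fun k ↦ (J k).subschemeι) = Sigma.desc fun i ↦ (I i).subschemeι := by
  classical
  let F : (∐ fun i ↦ (I i).subscheme) ⟶ ∐ fun k ↦ (J k).subscheme :=
    Sigma.desc fun i ↦ (subschemeIsoOfEq (h i)).hom ≫ Sigma.ι (fun k ↦ (J k).subscheme) (e i)
  have hF : ∀ i, Sigma.ι (fun i ↦ (I i).subscheme) i ≫ F =
      (subschemeIsoOfEq (h i)).hom ≫ Sigma.ι (fun k ↦ (J k).subscheme) (e i) := fun i ↦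
    Sigma.ι_desc _ _
  have hG (k : κ) : ∃ G : (J k).subscheme ⟶ ∐ fun i ↦ (I i).subscheme,
      (∀ i (hi : e i = k), G = (subschemeIsoOfEq ((h i).trans (congrArg J hi))).inv ≫
        Sigma.ι (fun i ↦ (I i).subscheme) i) ∧
      G ≫ F = Sigma.ι (fun k ↦ (J k).subscheme) k := by
    by_cases hk : k ∈ Set.range e
    · obtain ⟨i, rfl⟩ := hk
      refine ⟨(subschemeIsoOfEq (h i)).inv ≫ Sigma.ι (fun i ↦ (I i).subscheme) i,
        fun i' hi' ↦ ?_, ?_⟩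
      · obtain rfl := he hi'
        rfl
      · rw [Category.assoc, hF, Iso.inv_hom_id_assoc]
    · have : IsEmpty (J k).subscheme := by
        rw [h' k hk]
        infer_instance
      exact ⟨isInitialOfIsEmpty.to _, fun i hi ↦ absurd ⟨i, hi⟩ hk,
        isInitialOfIsEmpty.hom_ext _ _⟩
  choose G hG1 hG2 using hG
  refine ⟨⟨F, Sigma.desc G, Sigma.hom_ext _ _ fun i ↦ ?_, Sigma.hom_ext _ _ fun k ↦ ?_⟩,
    Sigma.hom_ext _ _ fun i ↦ ?_⟩
  · rw [← Category.assoc, hF, Category.assoc, Sigma.ι_desc, hG1 _ i rfl, Iso.hom_inv_id_assoc,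
      Category.comp_id]
  · rw [← Category.assoc, Sigma.ι_desc, hG2, Category.comp_id]
  · rw [← Category.assoc, hF, Category.assoc, Sigma.ι_desc, Sigma.ι_desc, subschemeIsoOfEq_hom_ι]

namespace BlowupTower

variable (B : BlowupTower)

theorem exists_interSum_iso {𝒥 𝒥' : Finset (Finset ℕ)} (h : 𝒥 ⊆ 𝒥')
    (h' : ∀ J ∈ 𝒥', J ∉ 𝒥 → B.inter J = ⊤) :
    ∃ e : B.interSum 𝒥 ≅ B.interSum 𝒥', e.hom ≫ B.interSumMap 𝒥' = B.interSumMap 𝒥 :=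
  exists_sigma_subscheme_iso (I := fun J : {J // J ∈ 𝒥} ↦ B.inter J.1)
    (J := fun J : {J // J ∈ 𝒥'} ↦ B.inter J.1) (fun J ↦ ⟨J.1, h J.2⟩)
    (fun _ _ e ↦ Subtype.ext (congrArg (fun J : {J // J ∈ 𝒥'} ↦ J.1) e)) (fun _ ↦ rfl)
    fun J hJ ↦ h' J.1 J.2 fun hJ' ↦ hJ ⟨⟨J.1, hJ'⟩, rfl⟩

theorem exists_stratum_iso (m : ℕ) :
    ∃ e : stratum B.fibre m ≅ B.interSum ((Finset.Icc 1 9).powersetCard m),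
      e.hom ≫ B.interSumMap _ = stratumMap B.fibre m := by
  classical
  have hT := B.bijOn_T
  obtain ⟨E, hE⟩ := exists_sigma_subscheme_iso
    (I := fun J : {J // J ∈ (Finset.Icc 1 9).powersetCard m} ↦ B.inter J.1)
    (J := fun s : StratumIndex B.fibre m ↦
      ⨆ C ∈ s.1, Scheme.IdealSheafData.vanishingIdeal C)
    (fun J ↦ ⟨J.1.image B.T, by
      have hJ := Finset.mem_powersetCard.1 J.2
      refine ⟨?_, fun C hC ↦ ?_⟩
      · rw [Finset.card_image_of_injOn (hT.injOn.mono (Finset.coe_subset.2 hJ.1)), hJ.2]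
      · obtain ⟨k, hk, rfl⟩ := Finset.mem_image.1 hC
        exact hT.mapsTo (hJ.1 hk)⟩)
    (fun J J' e ↦ by
      have hJ := Finset.mem_powersetCard.1 J.2
      have hJ' := Finset.mem_powersetCard.1 J'.2
      refine Subtype.ext (Finset.coe_injective ?_)
      have e1 := congrArg (fun s : StratumIndex B.fibre m ↦ (s.1 : Set (Closeds B.Z))) e
      simp only [Finset.coe_image] at e1
      exact (hT.injOn.image_eq_image_iff (Finset.coe_subset.2 hJ.1)
        (Finset.coe_subset.2 hJ'.1)).1 e1)
    (fun J ↦ by rw [inter, Finset.iSup_finset_image])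
    (fun s hs ↦ by
      refine absurd ⟨⟨(Finset.Icc 1 9).filter fun k ↦ B.T k ∈ s.1, ?_⟩, Subtype.ext ?_⟩ hs
      all_goals
        have h2 : ((Finset.Icc 1 9).filter fun k ↦ B.T k ∈ s.1).image B.T = s.1 := by
          ext C
          simp only [Finset.mem_image, Finset.mem_filter]
          refine ⟨fun ⟨k, hk, h⟩ ↦ h ▸ hk.2, fun hC ↦ ?_⟩
          obtain ⟨k, hk, rfl⟩ := hT.surjOn (s.2.2 C hC)
          exact ⟨k, ⟨hk, hC⟩, rfl⟩
      · refine Finset.mem_powersetCard.2 ⟨Finset.filter_subset _ _, ?_⟩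
        refine Eq.trans ?_ s.2.1
        rw [← congrArg Finset.card h2, Finset.card_image_of_injOn (hT.injOn.mono ?_)]
        exact Finset.coe_subset.2 (Finset.filter_subset _ _)
      · exact h2)
  exact ⟨E.symm, (Iso.inv_comp_eq E).2 hE.symm⟩

/-- Five components with a common point all meet a chart containing it, and so are among the listed
ones. -/
theorem inter_eq_top {J : Finset ℕ} (hJ : J ∈ (Finset.Icc 1 9).powersetCard 5)
    (hJ' : J ∉ sixPoints) : B.inter J = ⊤ := by
  rw [← Scheme.IdealSheafData.support_eq_bot_iff, ← SetLike.coe_injective.eq_iff]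
  refine Set.eq_empty_of_forall_notMem fun x hx ↦ hJ' ?_
  obtain ⟨hJ1, hJ2⟩ := Finset.mem_powersetCard.1 hJ
  obtain ⟨ε, y, rfl⟩ := B.exists_φ_eq x
  have h1 : J ⊆ (Finset.Icc 1 9).filter fun k ↦ Meets ε (label k) := by
    intro k hk
    refine Finset.mem_filter.2 ⟨hJ1 hk, meets_of_mem ((B.φ_mem_T ε (hJ1 hk) y).1 ?_)⟩
    have h2 : (B.inter J).support ≤ B.T k := by
      refine (Scheme.IdealSheafData.support_antitone (le_iSup₂_of_le (f := fun k (_ : k ∈ J) ↦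
        Scheme.IdealSheafData.vanishingIdeal (B.T k)) k hk le_rfl)).trans ?_
      exact (Scheme.IdealSheafData.coe_support_vanishingIdeal _).le
    exact h2 hx
  have h2 := Finset.eq_of_subset_of_card_le h1 (by rw [hJ2]; exact card_meets_le ε)
  rw [h2]
  exact meets_mem_sixPoints ε (by rw [← h2, hJ2])

theorem exists_stratum_five_iso : ∃ e : stratum B.fibre 5 ≅ B.interSum sixPoints,
    e.hom ≫ B.interSumMap _ = stratumMap B.fibre 5 := by
  obtain ⟨e, he⟩ := B.exists_stratum_iso 5
  obtain ⟨e', he'⟩ := B.exists_interSum_iso (𝒥 := sixPoints)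
    (𝒥' := (Finset.Icc 1 9).powersetCard 5)
    (by unfold sixPoints; decide) fun J h h' ↦ B.inter_eq_top h h'
  exact ⟨e ≪≫ e'.symm, by
    rw [Iso.trans_hom, Iso.symm_hom, Category.assoc, ← he, ← he', Iso.inv_hom_id_assoc]⟩

end BlowupTower

/-! ### Closed subschemes contained in one chart -/

theorem idealSheaf_le_iff {R : Type u} [CommRing R] {I J : Ideal R} :
    idealSheaf R I ≤ idealSheaf R J ↔ I ≤ J := by
  refine ⟨fun h ↦ ?_, idealSheaf_mono⟩
  have h1 := h ⟨⊤, isAffineOpen_top _⟩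
  rw [idealSheaf_ideal_top, idealSheaf_ideal_top] at h1
  have hb := ConcreteCategory.bijective_of_isIso (Scheme.ΓSpecIso (CommRingCat.of R)).inv
  have h2 := Ideal.comap_mono (f := (Scheme.ΓSpecIso (CommRingCat.of R)).inv.hom) h1
  rwa [Ideal.comap_map_of_bijective _ hb, Ideal.comap_map_of_bijective _ hb] at h2

theorem idealSheaf_iSup {R : Type u} [CommRing R] {ι : Sort*} (I : ι → Ideal R) :
    idealSheaf R (⨆ i, I i) = ⨆ i, idealSheaf R (I i) := by
  refine le_antisymm ?_ (iSup_le fun i ↦ idealSheaf_mono (le_iSup I i))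
  obtain ⟨K, hK⟩ := exists_eq_idealSheaf (⨆ i, idealSheaf R (I i))
  rw [hK]
  exact idealSheaf_mono (iSup_le fun i ↦
    idealSheaf_le_iff.1 (hK ▸ le_iSup (fun i ↦ idealSheaf R (I i)) i))

theorem ker_Spec_map {R A : Type u} [CommRing R] [CommRing A] (ψ : R →+* A) :
    (Spec.map (CommRingCat.ofHom ψ)).ker = idealSheaf R (RingHom.ker ψ) := by
  rw [Scheme.ker_of_isAffine, idealSheaf]
  congr 1
  have hR := ConcreteCategory.bijective_of_isIso (Scheme.ΓSpecIso (CommRingCat.of R)).inv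
  have hA := ConcreteCategory.bijective_of_isIso (Scheme.ΓSpecIso (CommRingCat.of A)).inv
  have key (r : R) : (Spec.map (CommRingCat.ofHom ψ)).appTop.hom
      ((Scheme.ΓSpecIso (CommRingCat.of R)).inv.hom r) =
      (Scheme.ΓSpecIso (CommRingCat.of A)).inv.hom (ψ r) := congr($(sections_map ψ) r)
  ext x
  obtain ⟨r, rfl⟩ := hR.2 x
  rw [Ideal.mem_map_iff_of_surjective _ hR.2]
  change (Spec.map (CommRingCat.ofHom ψ)).appTop.hom
      ((Scheme.ΓSpecIso (CommRingCat.of R)).inv.hom r) = 0 ↔ _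
  rw [key, map_eq_zero_iff _ hA.1]
  exact ⟨fun h ↦ ⟨r, h, rfl⟩, fun ⟨r', h, e⟩ ↦ hR.1 e ▸ h⟩

/-- The closed subscheme of an affine scheme given by the kernel of a surjection. -/
theorem exists_iso_subscheme_idealSheaf {R A : Type u} [CommRing R] [CommRing A] (ψ : R →+* A)
    (hψ : Function.Surjective ψ) {K : Ideal R} (hK : RingHom.ker ψ = K) :
    ∃ e : Spec (CommRingCat.of A) ≅ (idealSheaf R K).subscheme,
      e.hom ≫ (idealSheaf R K).subschemeι = Spec.map (CommRingCat.ofHom ψ) := by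
  have h1 : IsClosedImmersion (Spec.map (CommRingCat.ofHom ψ)) :=
    IsClosedImmersion.spec_of_surjective _ hψ
  have h2 : (idealSheaf R K).subschemeι.ker = (Spec.map (CommRingCat.ofHom ψ)).ker := by
    rw [Scheme.IdealSheafData.ker_subschemeι, ker_Spec_map, hK]
  have h3 := IsClosedImmersion.isIso_lift _ _ h2
  exact ⟨asIso (IsClosedImmersion.lift _ _ h2.le), IsClosedImmersion.lift_fac _ _ h2.le⟩

/-- A closed subscheme of a scheme whose support lies in an affine chart is described by its ideal
in the chart. -/
theorem exists_iso_subscheme {R A : Type u} [CommRing R] [CommRing A] (ψ : R →+* A)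
    (hψ : Function.Surjective ψ) {Z : Scheme.{u}} (φ : Spec (CommRingCat.of R) ⟶ Z)
    [IsOpenImmersion φ] {I : Z.IdealSheafData} (hI : I.comap φ = idealSheaf R (RingHom.ker ψ))
    (hs : (I.support : Set Z) ⊆ Set.range φ) :
    ∃ e : Spec (CommRingCat.of A) ≅ I.subscheme,
      e.hom ≫ I.subschemeι = Spec.map (CommRingCat.ofHom ψ) ≫ φ := by
  obtain ⟨e, he⟩ := exists_iso_subscheme_idealSheaf ψ hψ rfl
  have h1 : IsIso (pullback.snd φ I.subschemeι) := by
    refine (isIso_iff_isOpenImmersion_and_surjective _).2 ⟨inferInstance, ⟨fun x ↦ ?_⟩⟩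
    have hx : I.subschemeι x ∈ Set.range φ := hs (I.range_subschemeι ▸ ⟨x, rfl⟩)
    obtain ⟨y, hy⟩ := hx
    obtain ⟨p, -, hp⟩ := Scheme.Pullback.exists_preimage_pullback y x hy
    exact ⟨p, hp⟩
  refine ⟨e ≪≫ subschemeIsoOfEq hI.symm ≪≫ I.comapIso φ ≪≫ asIso (pullback.snd φ I.subschemeι), ?_⟩
  simp only [Iso.trans_hom, asIso_hom, Category.assoc]
  rw [← pullback.condition, Scheme.IdealSheafData.comapIso_hom_fst_assoc]
  rw [← Category.assoc (subschemeIsoOfEq hI.symm).hom, subschemeIsoOfEq_hom_ι, ← Category.assoc, he]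

/-! ### Subschemes of `Z` that map isomorphically to diagonals -/

theorem mvPolynomial_ker_eq_of_factor {A : Type*} [CommRing A] [Algebra ℂ A]
    {I : Ideal (MvPolynomial (Fin 3) ℂ)} (ψ : MvPolynomial (Fin 3) ℂ →ₐ[ℂ] A)
    (hψ : I ≤ RingHom.ker ψ.toRingHom) (θ : A →ₐ[ℂ] MvPolynomial (Fin 3) ℂ ⧸ I)
    (h : ∀ i, θ (ψ (MvPolynomial.X i)) = Ideal.Quotient.mk I (MvPolynomial.X i)) :
    RingHom.ker ψ.toRingHom = I := by
  refine le_antisymm (fun x hx ↦ ?_) hψ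
  have h : θ.comp ψ = Ideal.Quotient.mkₐ ℂ I := MvPolynomial.algHom_ext h
  have hx : ψ x = 0 := hx
  rw [← Ideal.Quotient.eq_zero_iff_mem, ← Ideal.Quotient.mkₐ_eq_mk ℂ, ← h, AlgHom.comp_apply, hx,
    map_zero]

namespace BlowupTower

variable (B : BlowupTower)

/-- A closed subscheme of `Z`, contained in a chart and parametrized there by `s_m = s' m` and
`b_m = b' m`, lies over the diagonal if `s' m * b' m = b' m` for all `m`. -/
theorem exists_iso_Y {ε : Fin 3 → Bool} {A : Type} [CommRing A] [Algebra ℂ A] (s' b' : Fin 3 → A)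
    (h : ChartRel ε s') {I : B.Z.IdealSheafData}
    (hI : I.comap (B.φ ε) = idealSheaf _ (RingHom.ker (liftU s' b' h).toRingHom))
    (hs : (I.support : Set B.Z) ⊆ Set.range (B.φ ε)) (hsb : ∀ m, s' m * b' m = b' m)
    (hsurj : Function.Surjective (MvPolynomial.aeval (R := ℂ) b')) {L : Finset (Fin 3)}
    (hL : RingHom.ker (MvPolynomial.aeval (R := ℂ) b').toRingHom =
      Ideal.span (MvPolynomial.X '' (L : Set (Fin 3)))) :
    ∃ e : I.subscheme ≅ (Y L).subscheme, e.hom ≫ Δ L = I.subschemeι ≫ B.σ := by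
  obtain ⟨e₁, h₁⟩ : ∃ e : Spec (CommRingCat.of A) ≅ (Y L).subscheme, e.hom ≫ (Y L).subschemeι =
      Spec.map (CommRingCat.ofHom (MvPolynomial.aeval (R := ℂ) b').toRingHom) :=
    exists_iso_subscheme_idealSheaf _ hsurj hL
  have hsurj' : Function.Surjective (liftU s' b' h).toRingHom := by
    have e : (liftU s' b' h).comp (MvPolynomial.aeval (R := ℂ) (b ε)) =
        MvPolynomial.aeval (R := ℂ) b' := MvPolynomial.algHom_ext fun i ↦ by
      rw [AlgHom.comp_apply, MvPolynomial.aeval_X, MvPolynomial.aeval_X, liftU_b]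
    intro a
    obtain ⟨p, rfl⟩ := hsurj a
    exact ⟨MvPolynomial.aeval (R := ℂ) (b ε) p, congr($e p)⟩
  obtain ⟨e₂, h₂⟩ := exists_iso_subscheme _ hsurj' (B.φ ε) hI hs
  have hring : (MvPolynomial.aeval (R := ℂ) b').toRingHom.comp
      (liftW (A := MvPolynomial (Fin 3) ℂ) MvPolynomial.X MvPolynomial.X rfl).toRingHom =
      (liftU s' b' h).toRingHom.comp (chartHom ε).toRingHom := by
    refine RingW.hom_ext (fun c ↦ ?_) (fun m ↦ ?_) fun m ↦ ?_
    · have e1 := ((MvPolynomial.aeval (R := ℂ) b').comp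
        (liftW (A := MvPolynomial (Fin 3) ℂ) MvPolynomial.X MvPolynomial.X rfl)).commutes c
      exact e1.trans (((liftU s' b' h).comp (chartHom ε)).commutes c).symm
    · refine Eq.trans ((congrArg _ (liftW_z _ _ _ m)).trans (MvPolynomial.aeval_X b' m))
        (Eq.trans ?_ (congrArg (liftU s' b' h) (chartHom_z ε m)).symm)
      rw [chartZ]
      split_ifs
      · rw [liftU_b]
      · rw [map_mul, liftU_b, liftU_s, hsb]
    · refine Eq.trans ((congrArg _ (liftW_w _ _ _ m)).trans (MvPolynomial.aeval_X b' m))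
        (Eq.trans ?_ (congrArg (liftU s' b' h) (chartHom_w ε m)).symm)
      rw [chartW]
      split_ifs
      · rw [map_mul, liftU_b, liftU_s, hsb]
      · rw [liftU_b]
  refine ⟨e₂.symm ≪≫ e₁, ?_⟩
  have h3 : e₁.hom ≫ Δ L = e₂.hom ≫ I.subschemeι ≫ B.σ := by
    rw [Δ, ← Category.assoc e₂.hom, h₂, Category.assoc, B.φ_σ, ← Category.assoc]
    refine (congrArg (· ≫ diagonal) h₁).trans ?_
    rw [diagonal, chartMap, ← Spec.map_comp, ← Spec.map_comp, ← CommRingCat.ofHom_comp,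
      ← CommRingCat.ofHom_comp, hring]
  rw [Iso.trans_hom, Iso.symm_hom, Category.assoc, h3, Iso.inv_hom_id_assoc]

theorem inter_comap (ε : Fin 3 → Bool) {J : Finset ℕ} (hJ : J ⊆ Finset.Icc 1 9) :
    (B.inter J).comap (B.φ ε) = idealSheaf (RingU ε) (⨆ k ∈ J, chartI ε (label k)) := by
  rw [inter, (Scheme.IdealSheafData.map_gc (B.φ ε)).l_iSup₂, idealSheaf_iSup]
  refine iSup_congr fun k ↦ ?_
  rw [idealSheaf_iSup]
  refine iSup_congr fun hk ↦ ?_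
  rw [B.vanishingIdeal_T_comap ε (hJ hk), chartT_eq ε (hJ hk)]

theorem mem_support_inter (J : Finset ℕ) (x : B.Z) :
    x ∈ (B.inter J).support ↔ ∀ k ∈ J, x ∈ B.T k := by
  simp [inter, Scheme.IdealSheafData.support_iSup]

end BlowupTower

theorem sixPoints_subset {J : Finset ℕ} (hJ : J ∈ sixPoints) : J ⊆ Finset.Icc 1 9 := by
  revert J; unfold sixPoints; decide

/-- Each of the six labels belongs to one chart. -/
theorem exists_chart_of_sixPoints {J : Finset ℕ} (hJ : J ∈ sixPoints) :
    ∃ ε : Fin 3 → Bool, (∀ k ∈ J, Meets ε (label k)) ∧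
      (∀ ε', (∀ k ∈ J, Meets ε' (label k)) → ε' = ε) ∧
      (∀ l, ∃ k ∈ J, label k = (l, l)) ∧
      ∀ l, ∃ k ∈ J, (label k).1 ≠ (label k).2 ∧ ((label k).1 = l ∨ (label k).2 = l) := by
  revert J; unfold sixPoints; decide

namespace BlowupTower

variable (B : BlowupTower)

theorem exists_sixPoints_iso {J : Finset ℕ} (hJ : J ∈ sixPoints) :
    ∃ e : (B.inter J).subscheme ≅ (Y Finset.univ).subscheme,
      e.hom ≫ Δ Finset.univ = (B.inter J).subschemeι ≫ B.σ := by
  have hJ' := sixPoints_subset hJ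
  obtain ⟨ε, h1, h2, h3, h4⟩ := exists_chart_of_sixPoints hJ
  have h0 : ChartRel ε (0 : Fin 3 → ℂ) := by
    obtain ⟨k, hk, hk', -⟩ := h4 0
    obtain ⟨h5, h6⟩ := (h1 k hk).resolve_left hk'
    exact chartRel_of_zero h5 h6 rfl rfl
  refine B.exists_iso_Y (ε := ε) (A := ℂ) 0 0 h0 ?_ ?_ (fun m ↦ zero_mul _)
    (fun a ↦ ⟨MvPolynomial.C a, by simp⟩) ?_
  · rw [B.inter_comap ε hJ']
    congr 1
    refine (RingU.ker_eq_of_factor _ ?_ (Algebra.ofId ℂ _) (fun l ↦ ?_) fun l ↦ ?_).symm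
    · refine iSup₂_le fun k hk ↦ ?_
      rw [chartI]
      split_ifs with h
      · rw [Ideal.span_le, Set.singleton_subset_iff]
        exact liftU_b _ _ _ _
      · rw [chartStrict, if_pos ((h1 k hk).resolve_left h), Ideal.span_le, Set.pair_subset_iff]
        exact ⟨liftU_s _ _ _ _, liftU_s _ _ _ _⟩
    · rw [liftU_s, Pi.zero_apply, map_zero, eq_comm, Ideal.Quotient.eq_zero_iff_mem]
      obtain ⟨k, hk, hk', hl⟩ := h4 l
      refine (le_iSup₂ (f := fun k (_ : k ∈ J) ↦ chartI ε (label k)) k hk) ?_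
      rw [chartI, if_neg hk', chartStrict, if_pos ((h1 k hk).resolve_left hk')]
      rcases hl with rfl | rfl <;> exact Ideal.subset_span (by simp)
    · rw [liftU_b, Pi.zero_apply, map_zero, eq_comm, Ideal.Quotient.eq_zero_iff_mem]
      obtain ⟨k, hk, hl⟩ := h3 l
      refine (le_iSup₂ (f := fun k (_ : k ∈ J) ↦ chartI ε (label k)) k hk) ?_
      rw [chartI, hl, if_pos rfl]
      exact Ideal.subset_span rfl
  · intro x hx
    obtain ⟨ε', y, rfl⟩ := B.exists_φ_eq x
    have := (B.mem_support_inter J _).1 hx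
    obtain rfl := h2 ε' fun k hk ↦ meets_of_mem ((B.φ_mem_T ε' (hJ' hk) y).1 (this k hk))
    exact ⟨y, rfl⟩
  · refine mvPolynomial_ker_eq_of_factor _ ?_ (Algebra.ofId ℂ _) fun i ↦ ?_
    · rw [Ideal.span_le]
      rintro _ ⟨i, -, rfl⟩
      exact MvPolynomial.aeval_X _ i
    · rw [MvPolynomial.aeval_X, Pi.zero_apply, map_zero, eq_comm, Ideal.Quotient.eq_zero_iff_mem]
      exact Ideal.subset_span ⟨i, by simp, rfl⟩

end BlowupTower

/-! ### The diagonal curves -/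

/-- The ideal of a diagonal curve in a chart that meets it is the kernel of a homomorphism to
`ℂ[x]`, the coordinate `x` being `b_l` for the third index `l`. -/
theorem exists_ker_eq_chartDelta {ε : Fin 3 → Bool} {i j : Fin 3} (hi : ε i = false)
    (hj : ε j = true) :
    ∃ h : ChartRel ε (fun m ↦ if m = i ∨ m = j then 0 else (1 : Polynomial ℂ)),
      RingHom.ker (liftU _ (fun m ↦ if m = i ∨ m = j then 0 else (Polynomial.X : Polynomial ℂ))
        h).toRingHom = chartDelta ε i j := by
  have hij := ne_of_chart hi hj
  obtain ⟨hl1, hl2⟩ := third_ne hij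
  refine ⟨chartRel_of_zero hi hj (by simp) (by simp), ?_⟩
  rw [show chartDelta ε i j = _ from if_pos ⟨hi, hj⟩]
  have hmem : ∀ a ∈ ({s ε i, s ε j, b ε i, b ε j} : Set (RingU ε)), Ideal.Quotient.mk
      (Ideal.span ({s ε i, s ε j, b ε i, b ε j} ∪
        {a | ∃ l, l ≠ i ∧ l ≠ j ∧ a = s ε l - 1})) a = 0 :=
    fun a ha ↦ Ideal.Quotient.eq_zero_iff_mem.2 (Ideal.subset_span (Or.inl ha))
  refine RingU.ker_eq_of_factor _ ?_ (Polynomial.aeval (Ideal.Quotient.mk _ (b ε (third i j))))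
    (fun l ↦ ?_) fun l ↦ ?_
  · rw [Ideal.span_le]
    rintro a (ha | ⟨l, hl, hl', rfl⟩)
    · simp only [Set.mem_insert_iff, Set.mem_singleton_iff] at ha
      change liftU _ _ _ a = 0
      rcases ha with rfl | rfl | rfl | rfl <;> simp
    · change liftU _ _ _ _ = 0
      rw [map_sub, liftU_s, map_one]
      simp [hl, hl']
  · rw [liftU_s]
    rcases eq_or_eq_third hij l with rfl | rfl | rfl
    · simp [hmem (s ε l) (by simp)]
    · simp [hmem (s ε l) (by simp)]
    · rw [if_neg (by simp [hl1, hl2]), map_one, eq_comm, ← sub_eq_zero]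
      exact Ideal.Quotient.eq_zero_iff_mem.2 (Ideal.subset_span (Or.inr ⟨_, hl1, hl2, rfl⟩))
  · rw [liftU_b]
    rcases eq_or_eq_third hij l with rfl | rfl | rfl
    · simp [hmem (b ε l) (by simp)]
    · simp [hmem (b ε l) (by simp)]
    · rw [if_neg (by simp [hl1, hl2]), Polynomial.aeval_X]

theorem chartDelta_isRadical (ε : Fin 3 → Bool) (i j : Fin 3) : (chartDelta ε i j).IsRadical := by
  by_cases h : ε i = false ∧ ε j = true
  · obtain ⟨h', e⟩ := exists_ker_eq_chartDelta h.1 h.2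
    rw [← e]
    exact (RingHom.ker_isPrime _).isRadical
  · rw [chartDelta, if_neg h]
    exact fun _ _ ↦ trivial

theorem chartDelta_le_iff {ε : Fin 3 → Bool} {i j : Fin 3} (hij : i ≠ j) (x : U ε) :
    chartDelta ε i j ≤ primeIdeal x ↔ chartI ε (i, j) ≤ primeIdeal x ∧
      chartI ε (i, i) ≤ primeIdeal x ∧ chartI ε (j, j) ≤ primeIdeal x ∧
      s ε (third i j) - 1 ∈ primeIdeal x := by
  rw [chartI_le_iff, chartI_le_iff, chartI_le_iff]
  by_cases h : ε i = false ∧ ε j = true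
  · rw [chartDelta, if_pos h, Ideal.span_le, Set.union_subset_iff]
    have h1 : {a | ∃ l, l ≠ i ∧ l ≠ j ∧ a = s ε l - 1} = {s ε (third i j) - 1} := by
      ext a
      refine ⟨?_, ?_⟩
      · rintro ⟨l, hl, hl', rfl⟩
        rw [((eq_or_eq_third hij l).resolve_left hl).resolve_left hl']
        rfl
      · rintro rfl
        exact ⟨_, (third_ne hij).1, (third_ne hij).2, rfl⟩
    rw [h1]
    simp only [Set.insert_subset_iff, Set.singleton_subset_iff, SetLike.mem_coe]
    simp [hij, h, and_assoc]
  · rw [chartDelta, if_neg h]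
    have : ¬ (⊤ ≤ primeIdeal x) := fun h ↦ (isPrime_primeIdeal x).ne_top (top_le_iff.1 h)
    simp only [this, false_iff]
    rintro ⟨⟨h1, -⟩ | ⟨-, h1, h2, -⟩, -⟩
    · exact hij h1
    · exact h ⟨h1, h2⟩

theorem b_mem_nonZeroDivisors (ε : Fin 3 → Bool) (i : Fin 3) : b ε i ∈ nonZeroDivisors (RingU ε) :=
  mem_nonZeroDivisors_of_ne_zero (b_ne_zero ε i)

namespace BlowupTower

variable (B : BlowupTower)

/-- The condition that `w_l / z_l` is regular with value `1` at a point of `Z`. -/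
def RatioOne (l : Fin 3) (p : B.Z) : Prop :=
  ∃ r : B.Z.presheaf.stalk p, ¬ IsUnit (r - 1) ∧
    stalkHom B.σ p (w l) = r * stalkHom B.σ p (z l)

theorem ratioOne_φ {ε : Fin 3 → Bool} (l : Fin 3) (y : U ε) :
    B.RatioOne l (B.φ ε y) ↔ s ε l - 1 ∈ primeIdeal y := by
  have he : Function.Bijective ((B.φ ε).stalkMap y) :=
    ConcreteCategory.bijective_of_isIso ((B.φ ε).stalkMap y)
  have hG (r : RingW) : (B.φ ε).stalkMap y (stalkHom B.σ (B.φ ε y) r) =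
      stalkHom (𝟙 (U ε)) y ((chartHom ε).toRingHom r) := by
    rw [← stalkHom_comp, B.φ_σ, chartMap, stalkHom_map]
  have h1 : B.RatioOne l (B.φ ε y) ↔ ∃ r : (U ε).presheaf.stalk y, ¬ IsUnit (r - 1) ∧
      stalkHom (𝟙 (U ε)) y (chartW ε l) = r * stalkHom (𝟙 (U ε)) y (chartZ ε l) := by
    have hu (r) : IsUnit ((B.φ ε).stalkMap y r) ↔ IsUnit r :=
      isUnit_map_iff ((B.φ ε).stalkMap y).hom r
    constructor
    · rintro ⟨r, hr, e⟩
      refine ⟨(B.φ ε).stalkMap y r, ?_, ?_⟩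
      · rwa [← map_one ((B.φ ε).stalkMap y).hom, ← map_sub, hu]
      · rw [← chartHom_w, ← chartHom_z, ← hG, ← hG, e, map_mul]
    · rintro ⟨r, hr, e⟩
      obtain ⟨r, rfl⟩ := he.2 r
      refine ⟨r, ?_, he.1 ?_⟩
      · rwa [← hu, map_sub, map_one]
      · rw [map_mul, hG, hG, chartHom_w, chartHom_z, e]
  have h2 : s ε l - 1 ∈ primeIdeal y ↔ ¬ IsUnit (stalkHom (𝟙 (U ε)) y (s ε l) - 1) := by
    rw [← map_one (stalkHom (𝟙 (U ε)) y), ← map_sub, isUnit_stalkHom_id_iff, not_not]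
  rw [h1, h2]
  generalize hA : stalkHom (𝟙 (U ε)) y = G
  have hb : G (b ε l) ∈ nonZeroDivisors _ :=
    hA ▸ stalkHom_id_mem_nonZeroDivisors (b_mem_nonZeroDivisors ε l) y
  unfold chartW chartZ
  split_ifs with h
  · simp only [map_mul, mul_cancel_right_mem_nonZeroDivisors hb]
    exact ⟨fun ⟨r, hr, e⟩ ↦ e ▸ hr, fun h ↦ ⟨_, h, rfl⟩⟩
  · have key (r : (U ε).presheaf.stalk y) : G (b ε l) = r * G (s ε l * b ε l) ↔
        r * G (s ε l) = 1 := by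
      rw [map_mul, ← mul_assoc]
      nth_rw 1 [← one_mul (G (b ε l))]
      rw [mul_cancel_right_mem_nonZeroDivisors hb, eq_comm]
    simp only [key]
    constructor
    · rintro ⟨r, hr, e⟩ h3
      refine hr ?_
      have h4 : r - 1 = - (r * (G (s ε l) - 1)) := by rw [mul_sub, e]; ring
      rw [h4]
      exact ((IsUnit.of_mul_eq_one _ e).mul h3).neg
    · intro h3
      have h4 : IsUnit (G (s ε l)) := by
        by_contra h4
        refine IsLocalRing.nonunits_add h4 (b := -(G (s ε l) - 1)) (fun h5 ↦ h3 ?_) ?_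
        · simpa using h5.neg
        · simp
      obtain ⟨r, hr⟩ := h4.exists_left_inv
      refine ⟨r, fun h5 ↦ h3 ?_, hr⟩
      have h6 : G (s ε l) - 1 = - (G (s ε l) * (r - 1)) := by rw [mul_sub, mul_comm _ r, hr]; ring
      rw [h6]
      exact (h4.mul h5).neg

/-- The points of the diagonal curve with indices `i`, `j`. -/
def diagSet (i j : Fin 3) : Set B.Z :=
  {x | (∀ k ∈ Finset.Icc 1 9, label k = (i, j) ∨ label k = (i, i) ∨ label k = (j, j) → x ∈ B.T k) ∧
    B.RatioOne (third i j) x}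

theorem φ_mem_diagSet {i j : Fin 3} (hij : i ≠ j) (ε : Fin 3 → Bool) (y : U ε) :
    B.φ ε y ∈ B.diagSet i j ↔ chartDelta ε i j ≤ primeIdeal y := by
  have key (p : Fin 3 × Fin 3) : (∀ k ∈ Finset.Icc 1 9, label k = p → B.φ ε y ∈ B.T k) ↔
      chartI ε p ≤ primeIdeal y := by
    constructor
    · intro h
      obtain ⟨k, hk, rfl⟩ := exists_label p
      exact (B.φ_mem_T ε hk y).1 (h k hk rfl)
    · rintro h k hk rfl
      exact (B.φ_mem_T ε hk y).2 h
  rw [diagSet, Set.mem_ofPred_eq, ratioOne_φ, chartDelta_le_iff hij, ← key, ← key, ← key]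
  constructor
  · rintro ⟨h1, h2⟩
    exact ⟨fun k hk e ↦ h1 k hk (Or.inl e), fun k hk e ↦ h1 k hk (Or.inr (Or.inl e)),
      fun k hk e ↦ h1 k hk (Or.inr (Or.inr e)), h2⟩
  · rintro ⟨h1, h2, h3, h4⟩
    refine ⟨fun k hk e ↦ ?_, h4⟩
    rcases e with e | e | e
    exacts [h1 k hk e, h2 k hk e, h3 k hk e]

theorem φ_preimage_diagSet {i j : Fin 3} (hij : i ≠ j) (ε : Fin 3 → Bool) :
    B.φ ε ⁻¹' B.diagSet i j = (idealSheaf _ (chartDelta ε i j)).support :=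
  Set.ext fun y ↦ (B.φ_mem_diagSet hij ε y).trans (mem_idealSheaf_support _ y).symm

theorem isClosed_diagSet {i j : Fin 3} (hij : i ≠ j) : IsClosed (B.diagSet i j) := by
  rw [← isOpen_compl_iff]
  have h : (B.diagSet i j)ᶜ = ⋃ ε, B.φ ε '' (B.φ ε ⁻¹' B.diagSet i j)ᶜ := by
    ext x
    rw [Set.mem_iUnion]
    constructor
    · intro hx
      obtain ⟨ε, y, rfl⟩ := B.exists_φ_eq x
      exact ⟨ε, y, hx, rfl⟩
    · rintro ⟨ε, y, hy, rfl⟩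
      exact hy
  rw [h]
  refine isOpen_iUnion fun ε ↦ (B.φ ε).isOpenEmbedding.isOpenMap _ ?_
  rw [B.φ_preimage_diagSet hij, isOpen_compl_iff]
  exact Closeds.isClosed _

/-- The diagonal curve with indices `i`, `j`. -/
def diagCurve (i j : Fin 3) : B.Z.IdealSheafData :=
  Scheme.IdealSheafData.vanishingIdeal (Closeds.closure (B.diagSet i j))

theorem coe_closure_diagSet {i j : Fin 3} (hij : i ≠ j) :
    (Closeds.closure (B.diagSet i j) : Set B.Z) = B.diagSet i j :=
  (B.isClosed_diagSet hij).closure_eq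

theorem diagCurve_comap {i j : Fin 3} (hij : i ≠ j) (ε : Fin 3 → Bool) :
    (B.diagCurve i j).comap (B.φ ε) = idealSheaf (RingU ε) (chartDelta ε i j) := by
  rw [diagCurve, vanishingIdeal_comap]
  refine vanishingIdeal_zeroLocus (chartDelta_isRadical ε i j) _ ?_
  rw [← idealSheaf_support, ← B.φ_preimage_diagSet hij]
  exact congrArg (B.φ ε ⁻¹' ·) (B.coe_closure_diagSet hij)

theorem inter_le_diagCurve {i j : Fin 3} (hij : i ≠ j) {J : Finset ℕ}
    (hJ : ∀ k ∈ J, k ∈ Finset.Icc 1 9 ∧ (label k = (i, j) ∨ label k = (i, i) ∨ label k = (j, j))) :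
    B.inter J ≤ B.diagCurve i j := by
  refine iSup₂_le fun k hk ↦ Scheme.IdealSheafData.vanishingIdeal_antimono fun x hx ↦ ?_
  have hx : x ∈ B.diagSet i j := (B.coe_closure_diagSet hij).le hx
  exact hx.1 k (hJ k hk).1 (hJ k hk).2

theorem exists_diagCurve_iso {i j : Fin 3} (hij : i ≠ j) :
    ∃ e : (B.diagCurve i j).subscheme ≅ (Y {i, j}).subscheme,
      e.hom ≫ Δ {i, j} = (B.diagCurve i j).subschemeι ≫ B.σ := by
  let ε : Fin 3 → Bool := fun m ↦ !decide (m = i)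
  have hi : ε i = false := by simp [ε]
  have hj : ε j = true := by simp [ε, hij.symm]
  obtain ⟨h, e⟩ := exists_ker_eq_chartDelta hi hj
  refine B.exists_iso_Y _ _ h (by rw [B.diagCurve_comap hij, e]) (fun x hx ↦ ?_) (fun m ↦ ?_) ?_ ?_
  · have hx : x ∈ B.diagSet i j := by
      rw [← B.coe_closure_diagSet hij,
        ← Scheme.IdealSheafData.coe_support_vanishingIdeal (Closeds.closure (B.diagSet i j))]
      exact hx
    obtain ⟨ε', y, rfl⟩ := B.exists_φ_eq x
    rw [B.φ_mem_diagSet hij, chartDelta_le_iff hij, chartI_le_iff] at hx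
    obtain ⟨h1, -, -, h2⟩ := hx
    obtain ⟨-, h3, h4, -⟩ := h1.resolve_left fun h ↦ hij h.1
    refine B.φ_mem_range fun l hl hs ↦ ?_
    rcases eq_or_eq_third hij l with rfl | rfl | rfl
    · exact hl (h3.trans hi.symm)
    · exact hl (h4.trans hj.symm)
    · exact (isPrime_primeIdeal y).ne_top ((Ideal.eq_top_iff_one _).2
        (by simpa using sub_mem hs h2))
  · split_ifs <;> simp
  · intro p
    refine ⟨Polynomial.aeval (MvPolynomial.X (third i j)) p, ?_⟩
    obtain ⟨h1, h2⟩ := third_ne hij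
    rw [← AlgHom.comp_apply]
    refine (congrArg (fun f : Polynomial ℂ →ₐ[ℂ] Polynomial ℂ ↦ f p)
      (?_ : _ = AlgHom.id ℂ (Polynomial ℂ)))
    refine Polynomial.algHom_ext ?_
    rw [AlgHom.comp_apply, Polynomial.aeval_X, MvPolynomial.aeval_X, if_neg (by simp [h1, h2])]
    rfl
  · refine mvPolynomial_ker_eq_of_factor _ ?_
      (Polynomial.aeval (Ideal.Quotient.mk _ (MvPolynomial.X (third i j)))) fun l ↦ ?_
    · rw [Ideal.span_le]
      rintro _ ⟨m, hm, rfl⟩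
      refine (MvPolynomial.aeval_X _ m).trans (if_pos ?_)
      simpa using hm
    · obtain ⟨h1, h2⟩ := third_ne hij
      have h0 (m : Fin 3) (hm : m = i ∨ m = j) : Ideal.Quotient.mk (Ideal.span
          (MvPolynomial.X '' ((({i, j} : Finset (Fin 3)) : Set (Fin 3))))) (MvPolynomial.X m) =
          (0 : MvPolynomial (Fin 3) ℂ ⧸ _) :=
        Ideal.Quotient.eq_zero_iff_mem.2 (Ideal.subset_span ⟨m, by simpa using hm, rfl⟩)
      rw [MvPolynomial.aeval_X]
      rcases eq_or_eq_third hij l with rfl | rfl | rfl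
      · rw [if_pos (Or.inl rfl), map_zero, h0 _ (Or.inl rfl)]
      · rw [if_pos (Or.inr rfl), map_zero, h0 _ (Or.inr rfl)]
      · rw [if_neg (by simp [h1, h2]), Polynomial.aeval_X]

end BlowupTower

/-! ### The hypersurface as a fibre product -/

/-- `RingW` is the pushout of two copies of `ℂ[x₁, x₂, x₃]` over `ℂ[t]`. -/
theorem exists_desc_ringW {A : Type} [CommRing A] (g₁ g₂ : MvPolynomial (Fin 3) ℂ →+* A)
    (h : g₁.comp (Polynomial.aeval (R := ℂ) (∏ i, MvPolynomial.X i)).toRingHom =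
      g₂.comp (Polynomial.aeval (R := ℂ) (∏ i, MvPolynomial.X i)).toRingHom) :
    ∃ χ : RingW →+* A, χ.comp (MvPolynomial.aeval (R := ℂ) z).toRingHom = g₁ ∧
      χ.comp (MvPolynomial.aeval (R := ℂ) w).toRingHom = g₂ := by
  have hC (c : ℂ) : g₁ (MvPolynomial.C c) = g₂ (MvPolynomial.C c) := by
    simpa using congr($h (Polynomial.C c))
  have hX : ∏ i, g₁ (MvPolynomial.X i) = ∏ i, g₂ (MvPolynomial.X i) := by
    simpa using congr($h Polynomial.X)
  let := (g₁.comp MvPolynomial.C).toAlgebra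
  have hχ (c : ℂ) : liftW _ _ hX (algebraMap ℂ RingW c) = g₁ (MvPolynomial.C c) :=
    (liftW _ _ hX).commutes c
  refine ⟨(liftW _ _ hX).toRingHom, MvPolynomial.ringHom_ext (fun c ↦ ?_) fun i ↦ ?_,
    MvPolynomial.ringHom_ext (fun c ↦ ?_) fun i ↦ ?_⟩
  · refine Eq.trans (congrArg (liftW _ _ hX) ((MvPolynomial.aeval (R := ℂ) z).commutes c)) (hχ c)
  · exact Eq.trans (congrArg (liftW _ _ hX) (MvPolynomial.aeval_X z i)) (liftW_z _ _ _ i)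
  · exact (Eq.trans (congrArg (liftW _ _ hX) ((MvPolynomial.aeval (R := ℂ) w).commutes c))
      (hχ c)).trans (hC c)
  · exact Eq.trans (congrArg (liftW _ _ hX) (MvPolynomial.aeval_X w i)) (liftW_w _ _ _ i)

theorem isPullback_W : IsPullback p₁ p₂ f f := by
  have h : IsPushout
      (CommRingCat.ofHom (Polynomial.aeval (R := ℂ)
        (∏ i, MvPolynomial.X i : MvPolynomial (Fin 3) ℂ)).toRingHom)
      (CommRingCat.ofHom (Polynomial.aeval (R := ℂ)
        (∏ i, MvPolynomial.X i : MvPolynomial (Fin 3) ℂ)).toRingHom)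
      (CommRingCat.ofHom (MvPolynomial.aeval (R := ℂ) z).toRingHom)
      (CommRingCat.ofHom (MvPolynomial.aeval (R := ℂ) w).toRingHom) := by
    have hw : (MvPolynomial.aeval (R := ℂ) z).toRingHom.comp (Polynomial.aeval (R := ℂ)
        (∏ i, MvPolynomial.X i : MvPolynomial (Fin 3) ℂ)).toRingHom =
        (MvPolynomial.aeval (R := ℂ) w).toRingHom.comp (Polynomial.aeval (R := ℂ)
        (∏ i, MvPolynomial.X i : MvPolynomial (Fin 3) ℂ)).toRingHom := by
      have : (MvPolynomial.aeval (R := ℂ) z).comp (Polynomial.aeval (R := ℂ)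
          (∏ i, MvPolynomial.X i : MvPolynomial (Fin 3) ℂ)) =
          (MvPolynomial.aeval (R := ℂ) w).comp (Polynomial.aeval (R := ℂ)
          (∏ i, MvPolynomial.X i : MvPolynomial (Fin 3) ℂ)) := by
        refine Polynomial.algHom_ext ?_
        simp only [AlgHom.comp_apply, Polynomial.aeval_X, map_prod, MvPolynomial.aeval_X]
        exact prod_z_eq_prod_w
      exact congrArg AlgHom.toRingHom this
    refine ⟨⟨by rw [← CommRingCat.ofHom_comp, ← CommRingCat.ofHom_comp, hw]⟩,
      ⟨PushoutCocone.IsColimit.mk _ (fun c ↦ CommRingCat.ofHom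
        (exists_desc_ringW c.inl.hom c.inr.hom
        (congrArg CommRingCat.Hom.hom c.condition)).choose) (fun c ↦ ?_) (fun c ↦ ?_)
        fun c m h₁ h₂ ↦ ?_⟩⟩
    · exact CommRingCat.hom_ext (exists_desc_ringW c.inl.hom c.inr.hom
        (congrArg CommRingCat.Hom.hom c.condition)).choose_spec.1
    · exact CommRingCat.hom_ext (exists_desc_ringW c.inl.hom c.inr.hom
        (congrArg CommRingCat.Hom.hom c.condition)).choose_spec.2
    · obtain ⟨h₃, h₄⟩ := (exists_desc_ringW c.inl.hom c.inr.hom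
        (congrArg CommRingCat.Hom.hom c.condition)).choose_spec
      refine CommRingCat.hom_ext ?_
      change m.hom = (exists_desc_ringW c.inl.hom c.inr.hom
        (congrArg CommRingCat.Hom.hom c.condition)).choose
      generalize (exists_desc_ringW c.inl.hom c.inr.hom
        (congrArg CommRingCat.Hom.hom c.condition)).choose = χ at h₃ h₄
      have k₁ := (congrArg CommRingCat.Hom.hom h₁).trans h₃.symm
      have k₂ := (congrArg CommRingCat.Hom.hom h₂).trans h₄.symm
      refine RingW.hom_ext (fun a ↦ ?_) (fun i ↦ ?_) fun i ↦ ?_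
      · have e := congr($k₁ (MvPolynomial.C a))
        simpa using e
      · have e := congr($k₁ (MvPolynomial.X i))
        simpa using e
      · have e := congr($k₂ (MvPolynomial.X i))
        simpa using e
  exact isPullback_SpecMap_of_isPushout _ _ _ _ h

/-! ### Smoothness -/

/-- The coordinate ring of the part of `X` over the punctured line. -/
abbrev Torus : Type := Localization.Away (∏ i, MvPolynomial.X i : MvPolynomial (Fin 3) ℂ)

/-- The homomorphism `t ↦ x₁x₂x₃` to the coordinate ring of the torus. -/
def toTorus : Polynomial ℂ →+* Torus :=
  (algebraMap (MvPolynomial (Fin 3) ℂ) Torus).comp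
    (Polynomial.aeval (∏ i, MvPolynomial.X i : MvPolynomial (Fin 3) ℂ)).toRingHom

/-- Formal smoothness is checked by lifting: units lift along nilpotent thickenings, and their
product is prescribed by solving for one of them. -/
theorem smooth_toTorus : toTorus.Smooth := by
  let := toTorus.toAlgebra
  have hC (c : ℂ) : algebraMap (Polynomial ℂ) Torus (Polynomial.C c) = algebraMap ℂ Torus c := by
    change algebraMap (MvPolynomial (Fin 3) ℂ) Torus
      (Polynomial.aeval (R := ℂ) _ (Polynomial.C c)) = _
    rw [Polynomial.aeval_C, ← IsScalarTower.algebraMap_apply]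
  have hX : algebraMap (Polynomial ℂ) Torus Polynomial.X =
      algebraMap _ Torus (∏ i, MvPolynomial.X i : MvPolynomial (Fin 3) ℂ) := by
    change algebraMap (MvPolynomial (Fin 3) ℂ) Torus (Polynomial.aeval (R := ℂ) _ Polynomial.X) = _
    rw [Polynomial.aeval_X]
  have htower : IsScalarTower ℂ (Polynomial ℂ) Torus := IsScalarTower.of_algebraMap_eq fun c ↦
    (hC c).symm
  change Algebra.Smooth (Polynomial ℂ) Torus
  have hfin : Algebra.FiniteType (Polynomial ℂ) Torus := by
    have : Algebra.FiniteType (MvPolynomial (Fin 3) ℂ) Torus :=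
      IsLocalization.finiteType_of_monoid_fg
        (Submonoid.powers (∏ i, MvPolynomial.X i : MvPolynomial (Fin 3) ℂ)) _
    have : Algebra.FiniteType ℂ Torus :=
      Algebra.FiniteType.trans (S := MvPolynomial (Fin 3) ℂ) inferInstance this
    exact Algebra.FiniteType.of_restrictScalars_finiteType ℂ _ _
  refine ⟨Algebra.FormallySmooth.of_comp_surjective fun B _ _ I hI g ↦ ?_,
    Algebra.FinitePresentation.of_finiteType.1 hfin⟩
  have hnil : IsNilpotent I := ⟨2, hI⟩
  let a (i : Fin 3) : B ⧸ I := g (algebraMap (MvPolynomial (Fin 3) ℂ) Torus (MvPolynomial.X i))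
  have ha (i : Fin 3) : IsUnit (a i) := by
    refine IsUnit.map g ?_
    refine isUnit_of_dvd_unit (map_dvd (algebraMap (MvPolynomial (Fin 3) ℂ) Torus)
      (Finset.dvd_prod_of_mem _ (Finset.mem_univ i)))
      (IsLocalization.map_units Torus (⟨∏ i, MvPolynomial.X i, Submonoid.mem_powers _⟩ :
        Submonoid.powers (∏ i, MvPolynomial.X i : MvPolynomial (Fin 3) ℂ)))
  have hlift (i : Fin 3) : ∃ c : B, Ideal.Quotient.mk I c = a i ∧ IsUnit c := by
    obtain ⟨c, hc⟩ := Ideal.Quotient.mk_surjective (a i)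
    exact ⟨c, hc, (IsNilpotent.isUnit_quotient_mk_iff hnil).1 (hc ▸ ha i)⟩
  choose c hc hcu using hlift
  obtain ⟨d, hd⟩ := ((hcu 1).mul (hcu 2)).exists_right_inv
  have hprod : ∏ i, a i = Ideal.Quotient.mk I (algebraMap (Polynomial ℂ) B Polynomial.X) := by
    rw [← map_prod, ← map_prod, ← hX, g.commutes]
    rfl
  -- two of the coordinates are lifted arbitrarily, which determines the lift of the third
  let c' : Fin 3 → B := ![algebraMap (Polynomial ℂ) B Polynomial.X * d, c 1, c 2]
  have hc'prod : ∏ i, c' i = algebraMap (Polynomial ℂ) B Polynomial.X := by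
    rw [Fin.prod_univ_three]
    change algebraMap (Polynomial ℂ) B Polynomial.X * d * c 1 * c 2 = _
    linear_combination algebraMap (Polynomial ℂ) B Polynomial.X * hd
  have hc' (i : Fin 3) : Ideal.Quotient.mk I (c' i) = a i := by
    fin_cases i
    · change Ideal.Quotient.mk I (algebraMap (Polynomial ℂ) B Polynomial.X * d) = a 0
      have h1 := congrArg (Ideal.Quotient.mk I) hd
      rw [map_mul, map_mul, hc, hc, map_one] at h1
      rw [map_mul, ← hprod, Fin.prod_univ_three]
      linear_combination a 0 * h1
    · exact hc 1
    · exact hc 2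
  let := ((algebraMap (Polynomial ℂ) B).comp Polynomial.C).toAlgebra
  have htowerB : IsScalarTower ℂ (Polynomial ℂ) B := IsScalarTower.of_algebraMap_eq fun _ ↦ rfl
  have hunit : IsUnit (MvPolynomial.aeval (R := ℂ) c' (∏ i, MvPolynomial.X i)) := by
    rw [← IsNilpotent.isUnit_quotient_mk_iff hnil]
    simp only [map_prod, MvPolynomial.aeval_X, hc']
    exact IsUnit.prod_univ_iff.2 ha
  let χ : Torus →ₐ[ℂ] B := IsLocalization.Away.liftAlgHom (∏ i, MvPolynomial.X i) hunit
  have hχ (p : MvPolynomial (Fin 3) ℂ) : χ (algebraMap _ Torus p) = MvPolynomial.aeval c' p :=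
    IsLocalization.Away.lift_eq _ hunit p
  let χ' : Torus →ₐ[Polynomial ℂ] B :=
    { χ with
      commutes' := by
        intro p
        change (χ.comp (IsScalarTower.toAlgHom ℂ (Polynomial ℂ) Torus)) p =
          IsScalarTower.toAlgHom ℂ (Polynomial ℂ) B p
        congr 1
        refine Polynomial.algHom_ext ?_
        change χ (algebraMap (Polynomial ℂ) Torus Polynomial.X) =
          algebraMap (Polynomial ℂ) B Polynomial.X
        rw [hX, hχ, map_prod]
        simp only [MvPolynomial.aeval_X]
        exact hc'prod }
  refine ⟨χ', AlgHom.coe_ringHom_injective (IsLocalization.ringHom_ext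
    (Submonoid.powers (∏ i, MvPolynomial.X i : MvPolynomial (Fin 3) ℂ))
      (MvPolynomial.ringHom_ext (fun r ↦ ?_) fun i ↦ ?_))⟩
  · change Ideal.Quotient.mk I (χ' (algebraMap _ Torus (algebraMap ℂ _ r))) =
      g (algebraMap _ Torus (algebraMap ℂ _ r))
    rw [← IsScalarTower.algebraMap_apply, ← hC, χ'.commutes, g.commutes]
    rfl
  · change Ideal.Quotient.mk I (χ (algebraMap _ Torus (MvPolynomial.X i))) = a i
    rw [hχ, MvPolynomial.aeval_X, hc']

/-- Smoothness over an open subset, tested on an open immersion onto its inverse image. -/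
theorem smooth_morphismRestrict {V X Y : Scheme.{u}} (g : X ⟶ Y) (O : Y.Opens) (j : V ⟶ X)
    [IsOpenImmersion j] (hj : Set.range j = g ⁻¹' O) [Smooth (j ≫ g)] : Smooth (g ∣_ O) := by
  have e : Set.range (g ⁻¹ᵁ O).ι = Set.range j := by
    rw [hj]
    exact (g ⁻¹ᵁ O).range_ι
  have h1 : Smooth (g ∣_ O ≫ O.ι) := by
    rw [morphismRestrict_ι, ← IsOpenImmersion.isoOfRangeEq_hom_fac _ _ e, Category.assoc]
    infer_instance
  have h2 : IsPullback (𝟙 _) (g ∣_ O) (g ∣_ O ≫ O.ι) O.ι := by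
    refine ⟨⟨Category.id_comp _⟩, ⟨PullbackCone.IsLimit.mk _ (fun s ↦ s.fst)
      (fun s ↦ Category.comp_id _) (fun s ↦ ?_) fun s m h₁ _ ↦ (Category.comp_id m).symm.trans h₁⟩⟩
    rw [← cancel_mono O.ι, Category.assoc]
    exact s.condition
  exact MorphismProperty.of_isPullback h2 h1

theorem mem_punctured (x : S) : x ∈ punctured ↔ Polynomial.X ∉ primeIdeal x := by
  change x ∉ origin.support ↔ _
  rw [origin, mem_idealSheaf_support, Ideal.span_singleton_le_iff_mem]

theorem smooth_f : Smooth (f ∣_ punctured) := by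
  let j : Spec (CommRingCat.of Torus) ⟶ X :=
    Spec.map (CommRingCat.ofHom (algebraMap (MvPolynomial (Fin 3) ℂ) Torus))
  have : IsOpenImmersion j := IsOpenImmersion.of_isLocalization (∏ i, MvPolynomial.X i)
  have : Smooth (j ≫ f) := by
    rw [f, ← Spec.map_comp, ← CommRingCat.ofHom_comp]
    exact HasRingHomProperty.Spec_iff.2 smooth_toTorus
  refine smooth_morphismRestrict _ _ j ?_
  refine (PrimeSpectrum.localization_away_comap_range Torus (∏ i, MvPolynomial.X i)).trans ?_
  refine Set.ext fun x : X ↦ ?_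
  change (∏ i, MvPolynomial.X i) ∉ primeIdeal x ↔ f x ∈ punctured
  rw [mem_punctured, f, primeIdeal_map, Ideal.mem_comap]
  have : (Polynomial.aeval (∏ i, MvPolynomial.X i : MvPolynomial (Fin 3) ℂ)).toRingHom
      Polynomial.X = (∏ i, MvPolynomial.X i : MvPolynomial (Fin 3) ℂ) :=
    Polynomial.aeval_X (R := ℂ) _
  rw [this]

/-- The first projection is smooth over the punctured line as a base change of `f`. -/
theorem smooth_p₁ : Smooth (p₁ ∣_ (f ⁻¹ᵁ punctured)) := by
  have e : p₁ ⁻¹ᵁ f ⁻¹ᵁ punctured = p₁ ⁻¹ᵁ f ⁻¹ᵁ punctured ⊓ p₂ ⁻¹ᵁ f ⁻¹ᵁ punctured := by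
    rw [← Scheme.Hom.comp_preimage, ← Scheme.Hom.comp_preimage, ← isPullback_W.w, inf_idem]
  have h := Scheme.Hom.isPullback_resLE isPullback_W (US := punctured) (UT := f ⁻¹ᵁ punctured)
    (UX := f ⁻¹ᵁ punctured) le_rfl le_rfl e
  have h1 : Smooth (f.resLE punctured (f ⁻¹ᵁ punctured) le_rfl) := by
    rw [Scheme.Hom.resLE_eq_morphismRestrict]
    exact smooth_f
  rw [← Scheme.Hom.resLE_eq_morphismRestrict]
  exact MorphismProperty.of_isPullback h.flip h1

/-- A chart is an open subscheme of affine 5-space. -/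
theorem smooth_ringU (ε : Fin 3 → Bool) : Algebra.Smooth ℂ (RingU ε) := by
  obtain ⟨l, hl⟩ := exists_lone ε
  have : Algebra.Smooth RingP (Localization.Away (denom ε l)) :=
    Algebra.Smooth.of_isLocalization_Away (denom ε l)
  have : Algebra.Smooth ℂ RingP :=
    ⟨inferInstance, Algebra.FinitePresentation.mvPolynomial _ _ _⟩
  have : Algebra.Smooth ℂ (Localization.Away (denom ε l)) := Algebra.Smooth.comp ℂ RingP _
  exact Algebra.Smooth.of_equiv (chartEquiv hl).symm

namespace BlowupTower

variable (B : BlowupTower)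

/-- The cover of `Z` by its eight charts. -/
def chartCover : B.Z.OpenCover :=
  Scheme.Cover.mkOfCovers (Fin 3 → Bool) U B.φ B.exists_φ_eq fun _ ↦ inferInstance

theorem φ_h_SToC (ε : Fin 3 → Bool) : B.φ ε ≫ B.h ≫ SToC =
    Spec.map (CommRingCat.ofHom (algebraMap ℂ (RingU ε))) := by
  rw [← Category.assoc, φ_h, SToC, ← Spec.map_comp, ← CommRingCat.ofHom_comp]
  congr 2
  exact (Polynomial.aeval (R := ℂ) (∏ i, chartZ ε i)).comp_algebraMap

theorem smooth_h_SToC : Smooth (B.h ≫ SToC) := by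
  have : IsZariskiLocalAtSource @Smooth.{0} :=
    HasRingHomProperty.instIsZariskiLocalAtSource
  refine (IsZariskiLocalAtSource.iff_of_openCover (P := @Smooth) B.chartCover).2 fun ε ↦ ?_
  have e := B.φ_h_SToC ε
  have h1 : (algebraMap ℂ (RingU ε)).Smooth := RingHom.smooth_algebraMap.2 (smooth_ringU ε)
  change Smooth (B.φ ε ≫ B.h ≫ SToC)
  refine e ▸ HasRingHomProperty.Spec_iff.2 h1

/-- Over the punctured line all `z_i` are invertible, so that `σ` is an isomorphism there. -/
theorem smooth_h_punctured : Smooth (B.h ∣_ punctured) := by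
  have h1 : IsIso (B.σ ∣_ ((p₁ ≫ f) ⁻¹ᵁ punctured)) := by
    refine B.isUniversal.isIso_morphismRestrict AllPrincipal.isLocal _ fun x hx ↦ ?_
    have hx : (p₁ ≫ f) x ∈ punctured := hx
    have e : (p₁ ≫ f) = Spec.map (CommRingCat.ofHom
        (Polynomial.aeval (R := ℂ) (∏ i, z i)).toRingHom) := by
      rw [p₁, f, ← Spec.map_comp, ← CommRingCat.ofHom_comp]
      congr 2
      have : (MvPolynomial.aeval (R := ℂ) z).comp (Polynomial.aeval (R := ℂ)
          (∏ i, MvPolynomial.X i : MvPolynomial (Fin 3) ℂ)) =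
          Polynomial.aeval (R := ℂ) (∏ i, z i) := by
        refine Polynomial.algHom_ext ?_
        simp only [AlgHom.comp_apply, Polynomial.aeval_X, map_prod, MvPolynomial.aeval_X]
      exact congrArg AlgHom.toRingHom this
    have e' : (Polynomial.aeval (R := ℂ) (∏ i, z i)).toRingHom Polynomial.X = ∏ i, z i :=
      Polynomial.aeval_X _
    rw [e, mem_punctured, primeIdeal_map, Ideal.mem_comap, e'] at hx
    have hx' := hx
    rw [prod_z_eq_prod_w] at hx'
    exact mem_allPrincipal_id 0 x fun m _ ↦
      ⟨fun h ↦ hx (Ideal.mem_of_dvd _ (Finset.dvd_prod_of_mem _ (Finset.mem_univ m)) h),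
        fun h ↦ hx' (Ideal.mem_of_dvd _ (Finset.dvd_prod_of_mem _ (Finset.mem_univ m)) h)⟩
  have h2 := smooth_p₁
  have h3 := smooth_f
  have h4 : Smooth (B.σ ∣_ ((p₁ ≫ f) ⁻¹ᵁ punctured)) := inferInstance
  rw [h, morphismRestrict_comp, morphismRestrict_comp]
  exact MorphismProperty.comp_mem @Smooth _ _ h4 (MorphismProperty.comp_mem @Smooth _ _ h2 h3)

/-- The curve `s = 1`, `b = (t, 1, 1)` in the chart with all `ε_i = true` is a section of `h`. -/
theorem surjective_h : Surjective B.h := by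
  let ε : Fin 3 → Bool := fun _ ↦ true
  let b' : Fin 3 → Polynomial ℂ := ![Polynomial.X, 1, 1]
  let g : S ⟶ B.Z := Spec.map (CommRingCat.ofHom (liftU 1 b' (chartRel_one ε)).toRingHom) ≫ B.φ ε
  have hg : g ≫ B.h = 𝟙 S := by
    have e : (liftU 1 b' (chartRel_one ε)).comp (Polynomial.aeval (R := ℂ) (∏ i, chartZ ε i)) =
        AlgHom.id ℂ (Polynomial ℂ) := by
      refine Polynomial.algHom_ext ?_
      rw [AlgHom.comp_apply, Polynomial.aeval_X, map_prod, Fin.prod_univ_three]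
      simp [chartZ, ε, b']
    have e' : (liftU 1 b' (chartRel_one ε)).toRingHom.comp
        (Polynomial.aeval (R := ℂ) (∏ i, chartZ ε i)).toRingHom = RingHom.id (Polynomial ℂ) :=
      congrArg AlgHom.toRingHom e
    rw [Category.assoc, φ_h, ← Spec.map_comp, ← CommRingCat.ofHom_comp, e']
    exact Spec.map_id _
  refine ⟨fun x ↦ ⟨g x, ?_⟩⟩
  rw [← Scheme.Hom.comp_apply, hg]
  rfl

end BlowupTower

/-! ### The local form of `t` -/

section PolynomialRing

variable {τ : Type} (a : τ → ℂ)

/-- The maximal ideal of a point of affine space. -/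
def evalIdeal : Ideal (MvPolynomial τ ℂ) := RingHom.ker (MvPolynomial.aeval (R := ℂ) a).toRingHom

instance : (evalIdeal a).IsPrime := RingHom.ker_isPrime _

theorem evalIdeal_eq_span :
    evalIdeal a = Ideal.span (Set.range fun i ↦ MvPolynomial.X i - MvPolynomial.C (a i)) := by
  set I := Ideal.span
    (Set.range fun i ↦ (MvPolynomial.X i - MvPolynomial.C (a i) : MvPolynomial τ ℂ))
  refine le_antisymm (fun p hp ↦ ?_) ?_
  · have h : (Algebra.ofId ℂ (MvPolynomial τ ℂ ⧸ I)).comp (MvPolynomial.aeval (R := ℂ) a) =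
        Ideal.Quotient.mkₐ ℂ I := by
      refine MvPolynomial.algHom_ext fun i ↦ ?_
      rw [AlgHom.comp_apply, MvPolynomial.aeval_X, Ideal.Quotient.mkₐ_eq_mk]
      have h1 : (MvPolynomial.X i - MvPolynomial.C (a i) : MvPolynomial τ ℂ) ∈ I :=
        Ideal.subset_span ⟨i, rfl⟩
      exact (Ideal.Quotient.eq.2 h1).symm
    have hp : MvPolynomial.aeval a p = 0 := hp
    rw [← Ideal.Quotient.eq_zero_iff_mem, ← Ideal.Quotient.mkₐ_eq_mk ℂ, ← h, AlgHom.comp_apply, hp,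
      map_zero]
  · rw [Ideal.span_le]
    rintro _ ⟨i, rfl⟩
    change MvPolynomial.aeval a _ = 0
    simp

variable [Fintype τ]

open Classical in
/-- The height of the maximal ideal of a point is at least the number of variables: the ideals of
the linear subspaces through the point on which more and more coordinates are fixed form a chain. -/
theorem card_le_height_evalIdeal : (Fintype.card τ : ℕ∞) ≤ (evalIdeal a).height := by
  let ev (T : Finset τ) : MvPolynomial τ ℂ →ₐ[ℂ] MvPolynomial τ ℂ :=
    MvPolynomial.aeval fun i ↦ if i ∈ T then MvPolynomial.C (a i) else MvPolynomial.X i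
  let P (T : Finset τ) : Ideal (MvPolynomial τ ℂ) := RingHom.ker (ev T).toRingHom
  have hprime (T : Finset τ) : (P T).IsPrime := RingHom.ker_isPrime _
  have hfac (T : Finset τ) (b : τ) : (ev (insert b T)).comp (ev T) = ev (insert b T) := by
    refine MvPolynomial.algHom_ext fun i ↦ ?_
    rw [AlgHom.comp_apply, MvPolynomial.aeval_X, MvPolynomial.aeval_X]
    split_ifs with h1 h2 h2
    · exact MvPolynomial.aeval_C _ _
    · exact absurd (Finset.mem_insert_of_mem h1) h2
    · rw [MvPolynomial.aeval_X, if_pos h2]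
    · rw [MvPolynomial.aeval_X, if_neg h2]
  have hlt (T : Finset τ) (b : τ) (hb : b ∉ T) : P T < P (insert b T) := by
    refine lt_of_le_of_ne (fun p hp ↦ ?_) fun h ↦ ?_
    · have hp : ev T p = 0 := hp
      change ev (insert b T) p = 0
      rw [← hfac, AlgHom.comp_apply, hp, map_zero]
    · have h1 : MvPolynomial.X b - MvPolynomial.C (a b) ∈ P T := by
        rw [h]
        change ev (insert b T) _ = 0
        rw [map_sub, MvPolynomial.aeval_X, if_pos (Finset.mem_insert_self _ _)]
        exact sub_eq_zero.2 (MvPolynomial.aeval_C _ _).symm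
      have h1 : ev T (MvPolynomial.X b - MvPolynomial.C (a b)) = 0 := h1
      rw [map_sub, MvPolynomial.aeval_X, if_neg hb] at h1
      have h2 := congrArg (MvPolynomial.aeval (R := ℂ) fun i ↦ a i + 1) h1
      have h3 : ev T (MvPolynomial.C (a b)) = MvPolynomial.C (a b) := MvPolynomial.aeval_C _ _
      rw [h3] at h2
      simp at h2
  have hle (T : Finset τ) : P T ≤ evalIdeal a := by
    intro p hp
    have hp : ev T p = 0 := hp
    have h : (MvPolynomial.aeval (R := ℂ) a).comp (ev T) = MvPolynomial.aeval (R := ℂ) a := by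
      refine MvPolynomial.algHom_ext fun i ↦ ?_
      rw [AlgHom.comp_apply, MvPolynomial.aeval_X]
      split_ifs <;> simp
    change MvPolynomial.aeval a p = 0
    rw [← h, AlgHom.comp_apply, hp, map_zero]
  have hcard (T : Finset τ) : (T.card : ℕ∞) ≤ (P T).height := by
    induction T using Finset.induction_on with
    | empty => simp
    | insert b T hb ih =>
      rw [Finset.card_insert_of_notMem hb, Nat.cast_add, Nat.cast_one]
      exact (add_le_add_left ih 1).trans (Ideal.height_add_one_le_of_lt_of_isPrime (hlt T b hb))
  exact (hcard Finset.univ).trans (Ideal.height_mono (hle _))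

theorem height_evalIdeal : (evalIdeal a).height = Fintype.card τ := by
  refine le_antisymm ?_ (card_le_height_evalIdeal a)
  refine (Ideal.height_le_spanFinrank _ Ideal.IsPrime.ne_top').trans ?_
  rw [evalIdeal_eq_span]
  refine (Submodule.spanFinrank_span_le_encard _).trans ?_
  rw [← Set.image_univ]
  refine (Set.encard_image_le _ _).trans ?_
  rw [Set.encard_univ, ENat.card_eq_coe_fintype_card]

/-- An element of a local ring is a monomial, up to a unit, in a regular system of parameters. -/
def IsMonomialInParameters {L : Type*} [CommRing L] [IsLocalRing L] (t : L) : Prop :=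
  ∃ (n : ℕ) (u : Fin n → L) (e : Fin n → ℕ) (v : Lˣ), ringKrullDim L = n ∧
    Ideal.span (Set.range u) = IsLocalRing.maximalIdeal L ∧ t = v * ∏ i, u i ^ e i

theorem IsMonomialInParameters.map {L L' : Type*} [CommRing L] [IsLocalRing L] [CommRing L']
    [IsLocalRing L'] (E : L ≃+* L') {t : L} (h : IsMonomialInParameters t) :
    IsMonomialInParameters (E t) := by
  obtain ⟨n, u, e, v, h1, h2, h3⟩ := h
  refine ⟨n, E ∘ u, e, Units.map E.toMonoidHom v, (ringKrullDim_eq_of_ringEquiv E).symm.trans h1,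
    ?_, ?_⟩
  · have h4 := congrArg (Ideal.map E) h2
    rw [Ideal.map_span, ← Set.range_comp] at h4
    exact h4.trans (IsLocalRing.map_ringEquiv_maximalIdeal E)
  · rw [h3, map_mul, map_prod]
    simp

/-- In the local ring of a point of affine space each monomial in the coordinates is, up to a unit,
a monomial in the coordinates centred at the point: the coordinates that do not vanish at the point
are units. -/
theorem isMonomialInParameters_monomial {L : Type} [CommRing L] [IsLocalRing L]
    [Algebra (MvPolynomial τ ℂ) L] [IsLocalization.AtPrime L (evalIdeal a)] (e : τ → ℕ) :
    IsMonomialInParameters (algebraMap (MvPolynomial τ ℂ) L (∏ i, MvPolynomial.X i ^ e i)) := by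
  classical
  let E := Fintype.equivFin τ
  let u (i : τ) : L := algebraMap (MvPolynomial τ ℂ) L (MvPolynomial.X i - MvPolynomial.C (a i))
  have hu (i : τ) : ∃ (v : Lˣ) (k : ℕ),
      algebraMap (MvPolynomial τ ℂ) L (MvPolynomial.X i) ^ e i = v * u i ^ k := by
    by_cases hi : a i = 0
    · exact ⟨1, e i, by simp [u, hi]⟩
    · have h1 : IsUnit (algebraMap (MvPolynomial τ ℂ) L (MvPolynomial.X i)) := by
        rw [IsLocalization.AtPrime.isUnit_to_map_iff L (evalIdeal a)]
        intro h
        have h : MvPolynomial.aeval a (MvPolynomial.X i) = 0 := h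
        rw [MvPolynomial.aeval_X] at h
        exact hi h
      exact ⟨(h1.pow (e i)).unit, 0, by simp⟩
  choose v k hv using hu
  refine ⟨Fintype.card τ, u ∘ E.symm, k ∘ E.symm, ∏ i, v i, ?_, ?_, ?_⟩
  · rw [IsLocalization.AtPrime.ringKrullDim_eq_height (evalIdeal a) L, height_evalIdeal]
    rfl
  · rw [Set.range_comp, E.symm.surjective.range_eq, Set.image_univ,
      ← IsLocalization.AtPrime.map_eq_maximalIdeal (evalIdeal a) L, evalIdeal_eq_span,
      Ideal.map_span, ← Set.range_comp]
    rfl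
  · have h1 : ∏ i, (u ∘ E.symm) i ^ (k ∘ E.symm) i = ∏ i, u i ^ k i :=
      Equiv.prod_comp E.symm fun i ↦ u i ^ k i
    rw [h1, map_prod, Units.coe_prod, ← Finset.prod_mul_distrib]
    exact Finset.prod_congr rfl fun i _ ↦ by rw [map_pow, hv]

end PolynomialRing

/-- The function `t` in a chart is a monomial in the coordinates. -/
theorem prod_chartZ {ε : Fin 3 → Bool} {l : Fin 3} (hl : ε (l + 1) = ε (l + 2)) :
    ∏ i, chartZ ε i = polyToU ε l (numer ε l * ∏ i, MvPolynomial.X (Sum.inr i)) := by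
  have h1 : ∀ i, chartZ ε i = (if ε i = true then 1 else s ε i) * b ε i := by
    intro i; unfold chartZ; split_ifs <;> simp
  have h2 : ∏ i, b ε i = polyToU ε l (∏ i, MvPolynomial.X (Sum.inr i)) := by
    rw [map_prod]
    simp [polyToU]
  rw [map_mul, ← h2]
  simp only [h1, Finset.prod_mul_distrib]
  congr 1
  have h3 : ∀ f : Fin 3 → RingU ε, ∏ i, f i = f l * (f (l + 1) * f (l + 2)) := fun f ↦ by
    rw [Fin.prod_univ_three]
    fin_cases l <;> simp <;> ring
  have h4 := (chartRel_iff hl (s ε)).1 (chart_relation ε)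
  rw [h3]
  unfold numer polyToU
  rcases h : ε l <;> rcases h' : ε (l + 2) <;> simp [h, hl, h'] at h4 ⊢
  · exact h4
  · exact h4

theorem numer_eq_monomial (ε : Fin 3 → Bool) (l : Fin 3) :
    ∃ e : Fin 2 ⊕ Fin 3 → ℕ, numer ε l * ∏ i, MvPolynomial.X (Sum.inr i) =
      ∏ i, (MvPolynomial.X i : RingP) ^ e i := by
  refine ⟨Sum.elim (fun _ ↦ if ε l = ε (l + 1) then 0 else 1) fun _ ↦ 1, ?_⟩
  rw [Fintype.prod_sum_type, numer]
  split_ifs <;> simp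

/-- The ideal of a closed point of a chart consists of the functions whose values vanish there. -/
theorem exists_eval_of_isMaximal {ε : Fin 3 → Bool} (p : Ideal (RingU ε)) [p.IsMaximal] :
    ∃ ψ : RingU ε →ₐ[ℂ] ℂ, RingHom.ker ψ.toRingHom = p := by
  let := Ideal.Quotient.field p
  have h1 : Module.Finite ℂ (RingU ε ⧸ p) := finite_of_finite_type_of_isJacobsonRing _ _
  have h2 : Function.Bijective (algebraMap ℂ (RingU ε ⧸ p)) :=
    IsAlgClosed.algebraMap_bijective_of_isIntegral
  let E : ℂ ≃ₐ[ℂ] RingU ε ⧸ p := AlgEquiv.ofBijective (Algebra.ofId _ _) h2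
  refine ⟨E.symm.toAlgHom.comp (Ideal.Quotient.mkₐ ℂ p), ?_⟩
  ext x
  change E.symm (Ideal.Quotient.mk p x) = 0 ↔ _
  rw [map_eq_zero_iff _ E.symm.injective, Ideal.Quotient.eq_zero_iff_mem]

/-- A chart is an open subscheme of an affine space on which `t` is a monomial in the
coordinates. -/
theorem isMonomialInParameters_chart {ε : Fin 3 → Bool} (p : Ideal (RingU ε)) [p.IsMaximal]
    {L : Type} [CommRing L] [IsLocalRing L] [Algebra (RingU ε) L] [IsLocalization.AtPrime L p] :
    IsMonomialInParameters (algebraMap (RingU ε) L (∏ i, chartZ ε i)) := by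
  obtain ⟨l, hl⟩ := exists_lone ε
  obtain ⟨ψ, hψ⟩ := exists_eval_of_isMaximal p
  let := (polyToU ε l).toRingHom.toAlgebra
  let := ((algebraMap (RingU ε) L).comp (algebraMap RingP (RingU ε))).toAlgebra
  have : IsScalarTower RingP (RingU ε) L := IsScalarTower.of_algebraMap_eq fun _ ↦ rfl
  have h1 : IsLocalization (Submonoid.powers (denom ε l)) (RingU ε) := by
    let E : Localization.Away (denom ε l) ≃ₐ[RingP] RingU ε :=
      { (chartEquiv hl).symm with
        commutes' := fun q ↦ by
          change (chartEquiv hl).symm (algebraMap _ _ q) = polyToU ε l q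
          rw [← chartEquiv_polyToU hl, AlgEquiv.symm_apply_apply] }
    exact IsLocalization.isLocalization_of_algEquiv _ E
  have h2 := IsLocalization.isLocalization_isLocalization_atPrime_isLocalization
    (Submonoid.powers (denom ε l)) L p
  let a : Fin 2 ⊕ Fin 3 → ℂ := fun i ↦ ψ (polyToU ε l (MvPolynomial.X i))
  have h3 : p.comap (algebraMap RingP (RingU ε)) = evalIdeal a := by
    ext q
    rw [Ideal.mem_comap, ← hψ]
    have e : ψ.comp (polyToU ε l) = MvPolynomial.aeval a :=
      MvPolynomial.algHom_ext fun i ↦ by rw [AlgHom.comp_apply, MvPolynomial.aeval_X]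
    change ψ.comp (polyToU ε l) q = 0 ↔ MvPolynomial.aeval a q = 0
    rw [e]
  simp only [h3] at h2
  obtain ⟨e, he⟩ := numer_eq_monomial ε l
  rw [prod_chartZ hl, he]
  exact isMonomialInParameters_monomial (L := L) a e

namespace BlowupTower

variable (B : BlowupTower)

theorem local_form (x : B.Z) (hx : IsClosed ({x} : Set B.Z)) :
    IsMonomialInParameters ((B.Z.presheaf.germ ⊤ x trivial).hom (parameter B.h)) := by
  obtain ⟨ε, y, rfl⟩ := B.exists_φ_eq x
  have hy : IsClosed ({y} : Set (U ε)) := by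
    have := hx.preimage (B.φ ε).continuous
    rwa [← Set.image_singleton, Set.preimage_image_eq _ (B.φ ε).injective] at this
  have h1 : (primeIdeal y).IsMaximal := (PrimeSpectrum.isClosed_singleton_iff_isMaximal y).1 hy
  let := (stalkHom (𝟙 (U ε)) y).toAlgebra
  have h2 : IsLocalization.AtPrime ((U ε).presheaf.stalk y) (primeIdeal y) :=
    isLocalization_stalkHom_id (R := CommRingCat.of (RingU ε)) y
  have h3 := isMonomialInParameters_chart (L := (U ε).presheaf.stalk y) (primeIdeal y)
  let E := (asIso ((B.φ ε).stalkMap y)).commRingCatIsoToRingEquiv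
  have h4 : (B.φ ε).stalkMap y (stalkHom B.h (B.φ ε y) Polynomial.X) =
      stalkHom (𝟙 (U ε)) y (∏ i, chartZ ε i) := by
    rw [← stalkHom_comp, B.φ_h, stalkHom_map]
    exact congrArg _ (Polynomial.aeval_X (R := ℂ) _)
  have h5 : E.symm (stalkHom (𝟙 (U ε)) y (∏ i, chartZ ε i)) =
      stalkHom B.h (B.φ ε y) Polynomial.X := by
    rw [RingEquiv.symm_apply_eq]
    exact h4.symm
  have h6 := h3.map E.symm
  change IsMonomialInParameters (E.symm (stalkHom (𝟙 (U ε)) y (∏ i, chartZ ε i))) at h6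
  rw [h5] at h6
  exact h6

theorem isNormalCrossingsDegeneration : IsNormalCrossingsDegeneration B.h where
  nonsingular := B.smooth_h_SToC
  surjective := B.surjective_h
  smooth_punctured := B.smooth_h_punctured
  local_form x hx _ := B.local_form x hx

end BlowupTower

/-! ### The standard charts of the projective line -/

/-- The ring of functions on the open subset of the projective line where `x_i` is invertible. -/
abbrev P1Ring (i : Fin 2) : Type :=
  HomogeneousLocalization.Away grading (MvPolynomial.X i : MvPolynomial (Fin 2) ℂ)

theorem X_mem_grading (i : Fin 2) : (MvPolynomial.X i : MvPolynomial (Fin 2) ℂ) ∈ grading 1 :=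
  MvPolynomial.isHomogeneous_X ℂ i

/-- The function `x_j / x_i`. -/
def P1Ring.coord (i j : Fin 2) : P1Ring i :=
  HomogeneousLocalization.Away.isLocalizationElem (X_mem_grading i) (X_mem_grading j)

/-- Setting `x_i = 1`. -/
def P1Ring.dehomogenize (i : Fin 2) : P1Ring i →+* Polynomial ℂ :=
  (Localization.awayLift (MvPolynomial.aeval (R := ℂ)
    (fun k : Fin 2 ↦ if k = i then (1 : Polynomial ℂ) else Polynomial.X)).toRingHom
    (MvPolynomial.X i : MvPolynomial (Fin 2) ℂ) (by simp)).comp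
  (algebraMap (P1Ring i) (Localization.Away (MvPolynomial.X i : MvPolynomial (Fin 2) ℂ)))

/-- Substituting `x_j / x_i` for the variable. -/
def P1Ring.homogenize (i j : Fin 2) : Polynomial ℂ →+* P1Ring i :=
  Polynomial.eval₂RingHom ((HomogeneousLocalization.fromZeroRingHom grading _).comp
    (algebraMap ℂ (grading 0))) (P1Ring.coord i j)

theorem P1Ring.dehomogenize_mk (i : Fin 2) (n : ℕ) (a : MvPolynomial (Fin 2) ℂ)
    (ha : a ∈ grading (n • 1)) :
    dehomogenize i (HomogeneousLocalization.Away.mk grading (X_mem_grading i) n a ha) =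
      MvPolynomial.aeval (R := ℂ)
        (fun k : Fin 2 ↦ if k = i then (1 : Polynomial ℂ) else Polynomial.X) a := by
  rw [dehomogenize, RingHom.comp_apply, HomogeneousLocalization.algebraMap_apply,
    HomogeneousLocalization.Away.val_mk, Localization.mk_eq_mk', Localization.awayLift,
    IsLocalization.Away.lift, IsLocalization.lift_mk'_spec]
  simp

theorem P1Ring.dehomogenize_comp_homogenize {i j : Fin 2} (h : j ≠ i) :
    (dehomogenize i).comp (homogenize i j) = RingHom.id _ := by
  refine Polynomial.ringHom_ext (fun c ↦ ?_) ?_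
  · simp only [homogenize, RingHom.comp_apply, Polynomial.coe_eval₂RingHom, Polynomial.eval₂_C]
    exact (dehomogenize_mk i 0 (MvPolynomial.C c) (MvPolynomial.isHomogeneous_C _ c)).trans
      (MvPolynomial.aeval_C _ c)
  · simp only [homogenize, RingHom.comp_apply, Polynomial.coe_eval₂RingHom, Polynomial.eval₂_X,
      coord, dehomogenize_mk]
    simp [h]

/-- A homogeneous polynomial scales with its variables. -/
theorem map_of_isHomogeneous {σ A : Type*} [CommRing A] {θ η : MvPolynomial σ ℂ →+* A} {r : A}
    (hC : ∀ c, η (MvPolynomial.C c) = θ (MvPolynomial.C c))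
    (hX : ∀ k, η (MvPolynomial.X k) = θ (MvPolynomial.X k) * r) {n : ℕ} {a : MvPolynomial σ ℂ}
    (ha : a.IsHomogeneous n) : η a = θ a * r ^ n := by
  conv_lhs => rw [a.as_sum]
  conv_rhs => rw [a.as_sum]
  rw [map_sum, map_sum, Finset.sum_mul]
  refine Finset.sum_congr rfl fun d hd ↦ ?_
  have hn : d.degree = n := by
    by_contra hn
    exact MvPolynomial.mem_support_iff.1 hd (ha.coeff_eq_zero hn)
  rw [MvPolynomial.monomial_eq, map_mul, map_mul, hC, mul_assoc, Finsupp.prod, map_prod, map_prod,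
    ← hn, Finsupp.degree_apply, ← Finset.prod_pow_eq_pow_sum, ← Finset.prod_mul_distrib]
  congr 1
  exact Finset.prod_congr rfl fun k _ ↦ by rw [map_pow, map_pow, hX, mul_pow]

theorem P1Ring.homogenize_comp_dehomogenize {i j : Fin 2} (h : j ≠ i) :
    (homogenize i j).comp (dehomogenize i) = RingHom.id _ := by
  ext x
  obtain ⟨n, a, ha, rfl⟩ := HomogeneousLocalization.Away.mk_surjective grading (X_mem_grading i) x
  rw [RingHom.comp_apply, dehomogenize_mk, RingHom.id_apply]
  let x : Localization.Away (MvPolynomial.X i : MvPolynomial (Fin 2) ℂ) :=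
    algebraMap _ _ (MvPolynomial.X i : MvPolynomial (Fin 2) ℂ)
  have hx : IsUnit x := IsLocalization.Away.algebraMap_isUnit _
  let θ : MvPolynomial (Fin 2) ℂ →+* Localization.Away
      (MvPolynomial.X i : MvPolynomial (Fin 2) ℂ) := ((algebraMap (P1Ring i)
    (Localization.Away (MvPolynomial.X i : MvPolynomial (Fin 2) ℂ))).comp (homogenize i j)).comp
    (MvPolynomial.aeval (R := ℂ)
      (fun k : Fin 2 ↦ if k = i then (1 : Polynomial ℂ) else Polynomial.X)).toRingHom
  have e := map_of_isHomogeneous (θ := θ) (η := algebraMap _ _) (r := x) (fun c ↦ ?_) (fun k ↦ ?_)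
    (show a.IsHomogeneous (n • 1) from ha)
  · rw [HomogeneousLocalization.Away.val_mk, Localization.mk_eq_mk',
      IsLocalization.eq_mk'_iff_mul_eq, e, smul_eq_mul, mul_one]
    exact congrArg (_ * ·) (map_pow _ _ _)
  · have h1 : MvPolynomial.aeval (R := ℂ)
      (fun k : Fin 2 ↦ if k = i then (1 : Polynomial ℂ) else Polynomial.X) (MvPolynomial.C c) =
      Polynomial.C c := MvPolynomial.aeval_C _ c
    change _ = algebraMap (P1Ring i) _ (homogenize i j (MvPolynomial.aeval (R := ℂ)
      (fun k : Fin 2 ↦ if k = i then (1 : Polynomial ℂ) else Polynomial.X) (MvPolynomial.C c)))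
    rw [h1, homogenize, Polynomial.coe_eval₂RingHom, Polynomial.eval₂_C]
    exact (Localization.mk_one_eq_algebraMap (M := Submonoid.powers
      (MvPolynomial.X i : MvPolynomial (Fin 2) ℂ)) (MvPolynomial.C c)).symm
  · have h1 : MvPolynomial.aeval (R := ℂ)
      (fun k : Fin 2 ↦ if k = i then (1 : Polynomial ℂ) else Polynomial.X) (MvPolynomial.X k) =
      if k = i then (1 : Polynomial ℂ) else Polynomial.X := MvPolynomial.aeval_X _ k
    change _ = algebraMap (P1Ring i) _ (homogenize i j (MvPolynomial.aeval (R := ℂ)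
      (fun k : Fin 2 ↦ if k = i then (1 : Polynomial ℂ) else Polynomial.X) (MvPolynomial.X k))) * x
    rw [h1]
    by_cases hk : k = i
    · rw [if_pos hk, map_one, map_one, one_mul, hk]
    · have hkj : k = j := by omega
      rw [if_neg hk, homogenize, Polynomial.coe_eval₂RingHom, Polynomial.eval₂_X, coord,
        HomogeneousLocalization.algebraMap_apply, HomogeneousLocalization.Away.val_mk,
        Localization.mk_eq_mk', eq_comm, ← pow_one x]
      refine (congrArg (_ * ·) (map_pow (algebraMap (MvPolynomial (Fin 2) ℂ) _) _ 1).symm).trans ?_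
      refine (IsLocalization.mk'_spec _ _ _).trans ?_
      rw [pow_one, hkj]

theorem P1Ring.dehomogenize_bijective (i : Fin 2) : Function.Bijective (dehomogenize i) := by
  have h : 1 - i ≠ i := by revert i; decide
  refine ⟨fun x y e ↦ ?_, fun x ↦ ⟨homogenize i (1 - i) x, ?_⟩⟩
  · rw [← RingHom.id_apply x, ← RingHom.id_apply y, ← homogenize_comp_dehomogenize h]
    exact congrArg (homogenize i (1 - i)) e
  · exact congr($(dehomogenize_comp_homogenize h) x)

theorem P1Ring.dehomogenize_coord {i j : Fin 2} (h : j ≠ i) :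
    dehomogenize i (coord i j) = Polynomial.X := by
  simp [coord, dehomogenize_mk, h]

/-- The chart of the projective line on which `x_i` is invertible; its coordinate is the quotient
of the other homogeneous coordinate by `x_i`. -/
def P1.chart (i : Fin 2) : Spec (CommRingCat.of (Polynomial ℂ)) ⟶ P1 :=
  Spec.map (CommRingCat.ofHom (P1Ring.dehomogenize i)) ≫
    Proj.awayι grading _ (X_mem_grading i) one_pos

instance (i : Fin 2) : IsOpenImmersion (P1.chart i) := by
  have : IsIso (CommRingCat.ofHom (P1Ring.dehomogenize i)) :=
    (ConcreteCategory.isIso_iff_bijective _).2 (P1Ring.dehomogenize_bijective i)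
  unfold P1.chart
  infer_instance

theorem P1.opensRange_chart (i : Fin 2) :
    (P1.chart i).opensRange = Proj.basicOpen grading (MvPolynomial.X i) := by
  have : IsIso (CommRingCat.ofHom (P1Ring.dehomogenize i)) :=
    (ConcreteCategory.isIso_iff_bijective _).2 (P1Ring.dehomogenize_bijective i)
  have h := Scheme.Hom.opensRange_comp_of_isIso (Spec.map (CommRingCat.ofHom
    (P1Ring.dehomogenize i))) (Proj.awayι grading _ (X_mem_grading i) one_pos)
  rw [Proj.opensRange_awayι] at h
  exact h

theorem mem_pointP1 (i : Fin 2) (x : P1) :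
    x ∈ pointP1 i ↔ MvPolynomial.X i ∈ x.asHomogeneousIdeal :=
  Set.singleton_subset_iff

theorem P1.range_chart (i : Fin 2) : Set.range (P1.chart i) = (pointP1 i : Set P1)ᶜ := by
  rw [← Scheme.Hom.coe_opensRange, P1.opensRange_chart]
  ext x
  exact (mem_pointP1 i x).not.symm

theorem P1.chart_mem_pointP1 {i j : Fin 2} (h : j ≠ i) (x : Spec (CommRingCat.of (Polynomial ℂ))) :
    P1.chart i x ∈ pointP1 j ↔ Polynomial.X ∈ primeIdeal x := by
  have h1 : P1.chart i x ∈ pointP1 j ↔ ¬ P1.chart i x ∈ Proj.basicOpen grading (MvPolynomial.X j) :=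
    (mem_pointP1 j _).trans not_not.symm
  have h2 := Proj.awayι_preimage_basicOpen grading (X_mem_grading i) one_pos (X_mem_grading j)
    one_pos
  have h3 : P1.chart i x ∈ Proj.basicOpen grading (MvPolynomial.X j) ↔
      Spec.map (CommRingCat.ofHom (P1Ring.dehomogenize i)) x ∈
        PrimeSpectrum.basicOpen (P1Ring.coord i j) := by
    rw [P1Ring.coord, ← h2]
    rfl
  rw [h1, h3, not_iff_comm, ← P1Ring.dehomogenize_coord h]
  rfl

theorem P1.exists_chart_eq (x : P1) : ∃ i y, P1.chart i y = x := by
  have h := Proj.iSup_basicOpen_eq_top' grading (MvPolynomial.X : Fin 2 → MvPolynomial (Fin 2) ℂ)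
    (fun i ↦ ⟨1, X_mem_grading i⟩) (by
      have h1 := MvPolynomial.adjoin_range_X (R := ℂ) (σ := Fin 2)
      refine top_le_iff.1 fun p _ ↦ ?_
      have hp : p ∈ Algebra.adjoin ℂ
          (Set.range (MvPolynomial.X : Fin 2 → MvPolynomial (Fin 2) ℂ)) :=
        h1 ▸ Algebra.mem_top
      induction hp using Algebra.adjoin_induction with
      | mem x hx => exact Algebra.subset_adjoin hx
      | algebraMap c => exact Subalgebra.algebraMap_mem _ (algebraMap ℂ (grading 0) c)
      | add x y _ _ hx hy => exact add_mem (hx trivial) (hy trivial)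
      | mul x y _ _ hx hy => exact mul_mem (hx trivial) (hy trivial))
  obtain ⟨i, hi⟩ := Opens.mem_iSup.1 (h.ge (show x ∈ ⊤ from trivial))
  rw [← P1.opensRange_chart] at hi
  exact ⟨i, hi⟩

theorem P1.chart_toC (i : Fin 2) :
    P1.chart i ≫ P1ToC = Spec.map (CommRingCat.ofHom (algebraMap ℂ (Polynomial ℂ))) := by
  rw [P1.chart, P1ToC, Category.assoc, Proj.awayι_toSpecZero_assoc, ← Spec.map_comp,
    ← Spec.map_comp]
  congr 1
  refine CommRingCat.hom_ext (RingHom.ext fun c ↦ ?_)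
  exact (P1Ring.dehomogenize_mk i 0 (MvPolynomial.C c) (MvPolynomial.isHomogeneous_C _ c)).trans
    (MvPolynomial.aeval_C _ c)

theorem P1Ring.awayMap_coord_mul {i j : Fin 2} :
    HomogeneousLocalization.awayMap grading (X_mem_grading j) rfl (coord i j) *
      HomogeneousLocalization.awayMap grading (X_mem_grading i) (mul_comm _ _) (coord j i) = 1 := by
  rw [coord, coord, HomogeneousLocalization.Away.isLocalizationElem,
    HomogeneousLocalization.Away.isLocalizationElem, HomogeneousLocalization.awayMap_mk,
    HomogeneousLocalization.awayMap_mk]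
  ext
  rw [HomogeneousLocalization.val_mul, HomogeneousLocalization.Away.val_mk,
    HomogeneousLocalization.Away.val_mk, HomogeneousLocalization.val_one, Localization.mk_mul,
    ← Localization.mk_one, Localization.mk_eq_mk_iff, Localization.r_iff_exists]
  refine ⟨1, ?_⟩
  simp
  ring

theorem P1Ring.overlap (i j : Fin 2) {x : MvPolynomial (Fin 2) ℂ}
    (hx : x = MvPolynomial.X i * MvPolynomial.X j) (hx' : x = MvPolynomial.X j * MvPolynomial.X i) :
    Spec.map (CommRingCat.ofHom (HomogeneousLocalization.awayMap grading (X_mem_grading j) hx)) ≫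
      Proj.awayι grading _ (X_mem_grading i) one_pos =
    Spec.map (CommRingCat.ofHom (HomogeneousLocalization.awayMap grading (X_mem_grading i) hx')) ≫
      Proj.awayι grading _ (X_mem_grading j) one_pos :=
  (Proj.SpecMap_awayMap_awayι grading (X_mem_grading i) one_pos (X_mem_grading j) hx).trans
    (Proj.SpecMap_awayMap_awayι grading (X_mem_grading j) one_pos (X_mem_grading i) hx').symm

theorem comp_Spec_map_eq {R A B C : Type u} [CommRing R] [CommRing A] [CommRing B] [CommRing C]
    {V P : Scheme.{u}} {g g' : V ⟶ Spec (CommRingCat.of R)} (α : A →+* R) (β : B →+* R)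
    {m₁ : A →+* C} {m₂ : B →+* C} {i : Spec (CommRingCat.of A) ⟶ P}
    {j : Spec (CommRingCat.of B) ⟶ P}
    (h : Spec.map (CommRingCat.ofHom m₁) ≫ i = Spec.map (CommRingCat.ofHom m₂) ≫ j)
    (χ : C →+* Γ(V, ⊤)) (h₁ : χ.comp m₁ = (sections g).comp α)
    (h₂ : χ.comp m₂ = (sections g').comp β) :
    g ≫ Spec.map (CommRingCat.ofHom α) ≫ i = g' ≫ Spec.map (CommRingCat.ofHom β) ≫ j := by
  obtain ⟨l, hl⟩ := exists_sections_eq χ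
  have e₁ : g ≫ Spec.map (CommRingCat.ofHom α) = l ≫ Spec.map (CommRingCat.ofHom m₁) :=
    hom_ext_sections (by rw [sections_comp_map, sections_comp_map, hl]; exact h₁.symm)
  have e₂ : g' ≫ Spec.map (CommRingCat.ofHom β) = l ≫ Spec.map (CommRingCat.ofHom m₂) :=
    hom_ext_sections (by rw [sections_comp_map, sections_comp_map, hl]; exact h₂.symm)
  rw [reassoc_of% e₁, reassoc_of% e₂, h]

/-- On the overlap of the two charts of the projective line the coordinates are inverse to each
other. -/
theorem P1.comp_chart_eq {i j : Fin 2} (hij : j ≠ i) {V : Scheme.{0}}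
    {g g' : V ⟶ Spec (CommRingCat.of (Polynomial ℂ))}
    (hC : ∀ c, sections g (Polynomial.C c) = sections g' (Polynomial.C c))
    (hX : sections g Polynomial.X * sections g' Polynomial.X = 1) :
    g ≫ P1.chart i = g' ≫ P1.chart j := by
  let A := HomogeneousLocalization.Away grading
    (MvPolynomial.X i * MvPolynomial.X j : MvPolynomial (Fin 2) ℂ)
  let m₁ : P1Ring i →+* A := HomogeneousLocalization.awayMap grading (X_mem_grading j) rfl
  let m₂ : P1Ring j →+* A :=
    HomogeneousLocalization.awayMap grading (X_mem_grading i) (mul_comm _ _)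
  have hm : m₁ (P1Ring.coord i j) * m₂ (P1Ring.coord j i) = 1 := P1Ring.awayMap_coord_mul
  algebraize [m₁]
  have hloc : IsLocalization.Away (P1Ring.coord i j) A :=
    HomogeneousLocalization.Away.isLocalization_mul (X_mem_grading i) (X_mem_grading j) rfl
      one_ne_zero
  let a : P1Ring i →+* Γ(V, ⊤) := (sections g).comp (P1Ring.dehomogenize i)
  have ha : a (P1Ring.coord i j) = sections g Polynomial.X :=
    congrArg (sections g) (P1Ring.dehomogenize_coord hij)
  let χ : A →+* Γ(V, ⊤) := IsLocalization.Away.lift (P1Ring.coord i j) (g := a)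
    (ha ▸ IsUnit.of_mul_eq_one _ hX)
  have h₁ : χ.comp m₁ = a := IsLocalization.Away.lift_comp _ _
  have h₂ : χ.comp m₂ = (sections g').comp (P1Ring.dehomogenize j) := by
    have key : (χ.comp m₂).comp (P1Ring.homogenize j i) = sections g' := by
      refine Polynomial.ringHom_ext (fun c ↦ ?_) ?_
      · have h3 : ∀ i j, P1Ring.homogenize i j (Polynomial.C c) =
            HomogeneousLocalization.fromZeroRingHom grading _ (algebraMap ℂ (grading 0) c) :=
          fun i j ↦ by simp [P1Ring.homogenize]
        have h4 : m₂ (P1Ring.homogenize j i (Polynomial.C c)) =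
            m₁ (P1Ring.homogenize i j (Polynomial.C c)) := by
          rw [h3, h3]
          exact (HomogeneousLocalization.awayMap_fromZeroRingHom grading _ _ _).trans
            (HomogeneousLocalization.awayMap_fromZeroRingHom grading _ _ _).symm
        have h5 := congr($(P1Ring.dehomogenize_comp_homogenize hij) (Polynomial.C c))
        rw [RingHom.comp_apply, RingHom.comp_apply, h4, ← hC]
        exact (congr($h₁ (P1Ring.homogenize i j (Polynomial.C c)))).trans
          (congrArg (sections g) h5)
      · have e : P1Ring.homogenize j i Polynomial.X = P1Ring.coord j i := by
          simp [P1Ring.homogenize]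
        rw [RingHom.comp_apply, e]
        have h3 := congrArg χ hm
        rw [map_mul, map_one] at h3
        have h4 : χ (m₁ (P1Ring.coord i j)) = sections g Polynomial.X :=
          (congr($h₁ (P1Ring.coord i j))).trans ha
        rw [h4] at h3
        exact left_inv_eq_right_inv ((mul_comm _ _).trans h3) hX
    rw [← key, RingHom.comp_assoc, P1Ring.homogenize_comp_dehomogenize hij.symm, RingHom.comp_id]
  exact comp_Spec_map_eq _ _ (P1Ring.overlap i j rfl (mul_comm _ _)) χ h₁ h₂

/-! ### The morphisms `[z_i : w_i]` to the projective line -/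

theorem sections_mem_nonZeroDivisors {R : Type u} [CommRing R] {r : R} (hr : r ∈ nonZeroDivisors R)
    {V : Scheme.{u}} (p : V ⟶ Spec (CommRingCat.of R)) [IsOpenImmersion p] :
    sections p r ∈ nonZeroDivisors Γ(V, ⊤) := by
  refine mem_nonZeroDivisors_of_germ _ fun x _ ↦ ?_
  have h := PreservesNonZeroDivisors.of_isOpenImmersion p x _
    (stalkHom_id_mem_nonZeroDivisors hr (p x))
  rw [← stalkHom_comp, Category.comp_id] at h
  exact h

/-- The index of the homogeneous coordinate among `z_i, w_i` which generates the ideal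
`(z_i, w_i)` on a chart. -/
def unitIndex (c : Bool) : Fin 2 := if c = true then 0 else 1

/-- The morphism `[z_i : w_i]` on a chart: it is `[1 : s_i]` or `[s_i : 1]`. -/
def chartRatio (ε : Fin 3 → Bool) (i : Fin 3) : U ε ⟶ P1 :=
  Spec.map (CommRingCat.ofHom (Polynomial.aeval (R := ℂ) (s ε i)).toRingHom) ≫
    P1.chart (unitIndex (ε i))

/-- The morphisms `[z_i : w_i]` on the charts agree on overlaps: there `z_i` and `w_i` agree, and
one of them is a nonzerodivisor. -/
theorem comp_chartRatio_eq {ε ε' : Fin 3 → Bool} {V : Scheme.{0}} {p : V ⟶ U ε} [IsOpenImmersion p]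
    {q : V ⟶ U ε'} (h : p ≫ chartMap ε = q ≫ chartMap ε') (i : Fin 3) :
    p ≫ chartRatio ε i = q ≫ chartRatio ε' i := by
  have h' := congrArg sections h
  rw [chartMap, chartMap, sections_comp_map, sections_comp_map] at h'
  have hc : ∀ c : ℂ, sections p (algebraMap ℂ (RingU ε) c) =
      sections q (algebraMap ℂ (RingU ε') c) := fun c ↦ by
    have := congr($h' (algebraMap ℂ RingW c))
    have e : ∀ (ε : Fin 3 → Bool) (χ : RingU ε →+* Γ(V, ⊤)), (χ.comp (chartHom ε).toRingHom)
        (algebraMap ℂ RingW c) = χ (algebraMap ℂ (RingU ε) c) := fun ε χ ↦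
      congrArg χ ((chartHom ε).commutes c)
    exact (e ε _).symm.trans (this.trans (e ε' _))
  have hz : sections p (chartZ ε i) = sections q (chartZ ε' i) := by
    rw [← chartHom_z, ← chartHom_z]
    exact congr($h' (z i))
  have hw : sections p (chartW ε i) = sections q (chartW ε' i) := by
    rw [← chartHom_w, ← chartHom_w]
    exact congr($h' (w i))
  have hb := sections_mem_nonZeroDivisors (b_mem_nonZeroDivisors ε i) p
  have hs : ∀ {ε : Fin 3 → Bool} (p : V ⟶ U ε), sections (p ≫ Spec.map (CommRingCat.ofHom
      (Polynomial.aeval (R := ℂ) (s ε i)).toRingHom)) Polynomial.X = sections p (s ε i) := by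
    intro ε p
    rw [sections_comp_map]
    exact congrArg (sections p) (Polynomial.aeval_X _)
  have hC : ∀ {ε : Fin 3 → Bool} (p : V ⟶ U ε) (c : ℂ), sections (p ≫ Spec.map (CommRingCat.ofHom
      (Polynomial.aeval (R := ℂ) (s ε i)).toRingHom)) (Polynomial.C c) =
      sections p (algebraMap ℂ _ c) := by
    intro ε p c
    rw [sections_comp_map]
    exact congrArg (sections p) (Polynomial.aeval_C _ c)
  rw [chartRatio, chartRatio, ← Category.assoc, ← Category.assoc]
  rw [chartZ, chartZ] at hz
  rw [chartW, chartW] at hw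
  generalize he : ε i = c at *
  generalize he' : ε' i = c' at *
  by_cases hcc : c = c'
  · subst hcc
    congr 1
    refine hom_ext_sections (Polynomial.ringHom_ext (fun a ↦ ?_) ?_)
    · rw [hC, hC, hc]
    · rw [hs, hs]
      refine (mul_cancel_right_mem_nonZeroDivisors hb).1 ?_
      cases c <;> simp only [Bool.false_eq_true, if_true, if_false, map_mul] at hz hw
      · linear_combination hz - sections q (s ε' i) * hw
      · linear_combination hw - sections q (s ε' i) * hz
  · have hcc' : ∀ c c' : Bool, c ≠ c' → unitIndex c' ≠ unitIndex c := by decide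
    refine P1.comp_chart_eq (hcc' c c' hcc) (fun a ↦ ?_) ?_
    · rw [hC, hC, hc]
    · rw [hs, hs]
      refine (mul_cancel_right_mem_nonZeroDivisors hb).1 ?_
      cases c <;> cases c' <;> first | exact absurd rfl hcc | skip
      all_goals simp only [Bool.false_eq_true, if_true, if_false, map_mul] at hz hw
      · linear_combination sections q (s ε' i) * hz - hw
      · linear_combination sections q (s ε' i) * hw - hz

theorem chartRatio_toC (ε : Fin 3 → Bool) (i : Fin 3) : chartRatio ε i ≫ P1ToC =
    Spec.map (CommRingCat.ofHom (algebraMap ℂ (RingU ε))) := by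
  rw [chartRatio, Category.assoc, P1.chart_toC, ← Spec.map_comp, ← CommRingCat.ofHom_comp]
  congr 2
  exact (Polynomial.aeval (R := ℂ) (s ε i)).comp_algebraMap

namespace BlowupTower

variable (B : BlowupTower)

theorem fst_comp_chartRatio (ε ε' : Fin 3 → Bool) (i : Fin 3) :
    pullback.fst (B.φ ε) (B.φ ε') ≫ chartRatio ε i =
      pullback.snd (B.φ ε) (B.φ ε') ≫ chartRatio ε' i :=
  comp_chartRatio_eq (by rw [← B.φ_σ, ← B.φ_σ, pullback.condition_assoc]) i

/-- The morphism `[z_i : w_i] : Z ⟶ ℙ¹`. -/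
def ratio (i : Fin 3) : B.Z ⟶ P1 :=
  B.chartCover.glueMorphisms (fun ε ↦ chartRatio ε i) fun ε ε' ↦
    B.fst_comp_chartRatio ε ε' i

theorem φ_ratio (ε : Fin 3 → Bool) (i : Fin 3) : B.φ ε ≫ B.ratio i = chartRatio ε i :=
  B.chartCover.ι_glueMorphisms _ _ ε

theorem ratio_toC (i : Fin 3) : B.ratio i ≫ P1ToC = B.h ≫ SToC := by
  refine B.chartCover.hom_ext _ _ fun ε ↦ ?_
  let ε : Fin 3 → Bool := ε
  have h : B.φ ε ≫ B.ratio i ≫ P1ToC = B.φ ε ≫ B.h ≫ SToC := by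
    rw [B.φ_h_SToC, ← Category.assoc, φ_ratio, chartRatio_toC]
  exact h

end BlowupTower

/-! ### Affine charts of the product of two projective lines -/

/-- The `i`-th projection from the affine plane to the affine line. -/
def planeProj (i : Fin 2) :
    Spec (CommRingCat.of (MvPolynomial (Fin 2) ℂ)) ⟶ Spec (CommRingCat.of (Polynomial ℂ)) :=
  Spec.map (CommRingCat.ofHom (Polynomial.aeval (R := ℂ)
    (MvPolynomial.X i : MvPolynomial (Fin 2) ℂ)).toRingHom)

theorem planeProj_toC (i : Fin 2) :
    planeProj i ≫ Spec.map (CommRingCat.ofHom (algebraMap ℂ (Polynomial ℂ))) =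
      Spec.map (CommRingCat.ofHom (algebraMap ℂ (MvPolynomial (Fin 2) ℂ))) := by
  rw [planeProj, ← Spec.map_comp, ← CommRingCat.ofHom_comp]
  congr 2
  exact (Polynomial.aeval (R := ℂ)
    (MvPolynomial.X i : MvPolynomial (Fin 2) ℂ)).comp_algebraMap

theorem sections_planeProj {V : Scheme.{0}} (g : V ⟶ Spec (CommRingCat.of (MvPolynomial (Fin 2) ℂ)))
    (i : Fin 2) : sections (g ≫ planeProj i) Polynomial.X = sections g (MvPolynomial.X i) := by
  rw [planeProj, sections_comp_map]
  exact congrArg (sections g) (Polynomial.aeval_X _)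

theorem sections_planeProj_C {V : Scheme.{0}}
    (g : V ⟶ Spec (CommRingCat.of (MvPolynomial (Fin 2) ℂ))) (i : Fin 2) (c : ℂ) :
    sections (g ≫ planeProj i) (Polynomial.C c) = sections g (MvPolynomial.C c) := by
  rw [planeProj, sections_comp_map]
  exact congrArg (sections g) (Polynomial.aeval_C _ c)

/-- The affine plane is the product of two affine lines. -/
theorem isPullback_planeProj : IsPullback (planeProj 0) (planeProj 1)
    (Spec.map (CommRingCat.ofHom (algebraMap ℂ (Polynomial ℂ))))
    (Spec.map (CommRingCat.ofHom (algebraMap ℂ (Polynomial ℂ)))) := by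
  refine ⟨⟨by rw [planeProj_toC, planeProj_toC]⟩, ⟨PullbackCone.IsLimit.mk _ (fun c ↦
    (exists_sections_eq (MvPolynomial.eval₂Hom ((sections c.fst).comp Polynomial.C)
      ![sections c.fst Polynomial.X, sections c.snd Polynomial.X])).choose) ?_ ?_ ?_⟩⟩
  · intro c
    have h := (exists_sections_eq (MvPolynomial.eval₂Hom ((sections c.fst).comp Polynomial.C)
      ![sections c.fst Polynomial.X, sections c.snd Polynomial.X])).choose_spec
    refine hom_ext_sections (Polynomial.ringHom_ext (fun a ↦ ?_) ?_)
    · rw [sections_planeProj_C, h]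
      simp
    · rw [sections_planeProj, h]
      simp
  · intro c
    have h := (exists_sections_eq (MvPolynomial.eval₂Hom ((sections c.fst).comp Polynomial.C)
      ![sections c.fst Polynomial.X, sections c.snd Polynomial.X])).choose_spec
    have h' := congrArg sections c.condition
    rw [sections_comp_map, sections_comp_map] at h'
    refine hom_ext_sections (Polynomial.ringHom_ext (fun a ↦ ?_) ?_)
    · rw [sections_planeProj_C, h]
      simpa using congr($h' a)
    · rw [sections_planeProj, h]
      simp
  · intro c m h₀ h₁
    have h := (exists_sections_eq (MvPolynomial.eval₂Hom ((sections c.fst).comp Polynomial.C)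
      ![sections c.fst Polynomial.X, sections c.snd Polynomial.X])).choose_spec
    refine hom_ext_sections (h.symm ▸ MvPolynomial.ringHom_ext (fun a ↦ ?_) fun i ↦ ?_)
    · rw [← sections_planeProj_C m 0, h₀]
      simp
    · rw [← sections_planeProj m i]
      fin_cases i
      · exact (congr(sections $h₀ Polynomial.X)).trans (by simp)
      · exact (congr(sections $h₁ Polynomial.X)).trans (by simp)

/-- The chart of `ℙ¹ × ℙ¹` which is the product of two charts of `ℙ¹`. -/
def P1P1.chart (i j : Fin 2) : Spec (CommRingCat.of (MvPolynomial (Fin 2) ℂ)) ⟶ P1P1 :=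
  pullback.lift (planeProj 0 ≫ P1.chart i) (planeProj 1 ≫ P1.chart j) (by
    rw [Category.assoc, Category.assoc, P1.chart_toC, P1.chart_toC, isPullback_planeProj.w])

theorem P1P1.chart_fst (i j : Fin 2) :
    P1P1.chart i j ≫ pullback.fst P1ToC P1ToC = planeProj 0 ≫ P1.chart i := pullback.lift_fst _ _ _

theorem P1P1.chart_snd (i j : Fin 2) :
    P1P1.chart i j ≫ pullback.snd P1ToC P1ToC = planeProj 1 ≫ P1.chart j := pullback.lift_snd _ _ _

/-- The product of two open immersions into `ℙ¹`, up to the identification of the affine plane with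
the product of two affine lines. -/
theorem P1P1.chart_eq (i j : Fin 2) : ∃ e : Spec (CommRingCat.of (MvPolynomial (Fin 2) ℂ)) ≅
    pullback (P1.chart i ≫ P1ToC) (P1.chart j ≫ P1ToC), P1P1.chart i j = e.hom ≫
      pullback.map (P1.chart i ≫ P1ToC) (P1.chart j ≫ P1ToC) P1ToC P1ToC (P1.chart i) (P1.chart j)
        (𝟙 _) (by simp) (by simp) := by
  have h := isPullback_planeProj
  rw [← P1.chart_toC i] at h
  nth_rw 2 [P1.chart_toC i] at h
  rw [← P1.chart_toC j] at h
  refine ⟨h.isoPullback, pullback.hom_ext ?_ ?_⟩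
  · rw [P1P1.chart_fst, Category.assoc, pullback.lift_fst, h.isoPullback_hom_fst_assoc]
  · rw [P1P1.chart_snd, Category.assoc, pullback.lift_snd, h.isoPullback_hom_snd_assoc]

instance (i j : Fin 2) : IsOpenImmersion (P1P1.chart i j) := by
  obtain ⟨e, he⟩ := P1P1.chart_eq i j
  rw [he]
  infer_instance

theorem P1P1.range_chart (i j : Fin 2) : Set.range (P1P1.chart i j) =
    pullback.fst P1ToC P1ToC ⁻¹' Set.range (P1.chart i) ∩
      pullback.snd P1ToC P1ToC ⁻¹' Set.range (P1.chart j) := by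
  obtain ⟨e, he⟩ := P1P1.chart_eq i j
  rw [he, ← Scheme.Pullback.range_map (P1.chart i ≫ P1ToC) (P1.chart j ≫ P1ToC) P1ToC P1ToC
    (P1.chart i) (P1.chart j) (𝟙 _) (by simp) (by simp)]
  exact Set.ext fun x ↦ ⟨fun ⟨y, hy⟩ ↦ ⟨e.hom y, hy⟩, fun ⟨y, hy⟩ ↦ ⟨e.inv y, by simpa using hy⟩⟩

theorem P1P1.exists_chart_eq (x : P1P1) : ∃ i j, x ∈ Set.range (P1P1.chart i j) := by
  obtain ⟨i, hi⟩ := P1.exists_chart_eq (pullback.fst P1ToC P1ToC x)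
  obtain ⟨j, hj⟩ := P1.exists_chart_eq (pullback.snd P1ToC P1ToC x)
  exact ⟨i, j, by rw [P1P1.range_chart]; exact ⟨hi, hj⟩⟩

/-- The part of the equation `∏ z_i` or `∏ w_i` which involves the first two indices, in a chart
of `ℙ¹ × ℙ¹`: the product of the homogeneous coordinates with index `k` of the two factors. -/
def planeEqn (i j k : Fin 2) : MvPolynomial (Fin 2) ℂ :=
  (if i = k then 1 else MvPolynomial.X 0) * if j = k then 1 else MvPolynomial.X 1

theorem planeEqn_ideal_isRadical (i j : Fin 2) :
    (Ideal.span {planeEqn i j 0, planeEqn i j 1}).IsRadical := by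
  by_cases hij : i = j
  · have : Ideal.span {planeEqn i j 0, planeEqn i j 1} = ⊤ := by
      rw [Ideal.eq_top_iff_one]
      refine Ideal.subset_span ?_
      subst hij
      fin_cases i <;> simp [planeEqn]
    rw [this]
    exact fun _ _ ↦ trivial
  · have : Ideal.span {planeEqn i j 0, planeEqn i j 1} =
        Ideal.span {MvPolynomial.X 0, MvPolynomial.X 1} := by
      fin_cases i <;> fin_cases j <;> simp [planeEqn] at hij ⊢
      rw [Set.pair_comm]
    rw [this]
    have h : Ideal.span {MvPolynomial.X 0, MvPolynomial.X 1} =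
        RingHom.ker (MvPolynomial.constantCoeff : MvPolynomial (Fin 2) ℂ →+* ℂ) := by
      set K : Ideal (MvPolynomial (Fin 2) ℂ) := Ideal.span {MvPolynomial.X 0, MvPolynomial.X 1}
        with hK
      refine le_antisymm (Ideal.span_le.2 ?_) fun p hp ↦ ?_
      · rintro _ (rfl | rfl) <;> exact MvPolynomial.constantCoeff_X _ _
      · have e : Ideal.Quotient.mk K = ((Ideal.Quotient.mk K).comp MvPolynomial.C).comp
            (MvPolynomial.constantCoeff : MvPolynomial (Fin 2) ℂ →+* ℂ) := by
          refine MvPolynomial.ringHom_ext (fun c ↦ by simp) fun i ↦ ?_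
          rw [RingHom.comp_apply, MvPolynomial.constantCoeff_X, map_zero,
            Ideal.Quotient.eq_zero_iff_mem]
          fin_cases i <;> exact Ideal.subset_span (by simp)
        rw [← Ideal.Quotient.eq_zero_iff_mem, e, RingHom.comp_apply, hp, map_zero]
    rw [h]
    exact (RingHom.ker_isPrime _).isRadical

/-- The two points are the zeros of the two bihomogeneous forms that `planeEqn` dehomogenizes. -/
theorem twoPoints_comap_chart (i j : Fin 2) : twoPoints.comap (P1P1.chart i j) =
    idealSheaf (MvPolynomial (Fin 2) ℂ) (Ideal.span {planeEqn i j 0, planeEqn i j 1}) := by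
  rw [twoPoints, vanishingIdeal_comap]
  refine vanishingIdeal_zeroLocus (planeEqn_ideal_isRadical i j) _ (Set.ext fun x ↦ ?_)
  have hx := isPrime_primeIdeal x
  have h1 : Ideal.span {planeEqn i j 0, planeEqn i j 1} ≤ primeIdeal x ↔
      planeEqn i j 0 ∈ primeIdeal x ∧ planeEqn i j 1 ∈ primeIdeal x := by
    rw [Ideal.span_le, Set.pair_subset_iff]
    rfl
  have key : ∀ (i k l : Fin 2), P1.chart i (planeProj l x) ∈ pointP1 k ↔
      (if i = k then 1 else MvPolynomial.X l : MvPolynomial (Fin 2) ℂ) ∈ primeIdeal x := by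
    intro i k l
    split_ifs with h
    · subst h
      have h2 : P1.chart i (planeProj l x) ∈ (pointP1 i : Set P1)ᶜ :=
        P1.range_chart i ▸ ⟨_, rfl⟩
      exact iff_of_false h2 fun h3 ↦ hx.ne_top ((Ideal.eq_top_iff_one _).2 h3)
    · rw [P1.chart_mem_pointP1 (Ne.symm h), planeProj, primeIdeal_map, Ideal.mem_comap]
      exact iff_of_eq (congrArg (· ∈ primeIdeal x) (Polynomial.aeval_X _))
  have k1 : ∀ k, pullback.fst P1ToC P1ToC (P1P1.chart i j x) ∈ pointP1 k ↔
      (if i = k then 1 else MvPolynomial.X 0 : MvPolynomial (Fin 2) ℂ) ∈ primeIdeal x := fun k ↦ by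
    rw [← key, ← Scheme.Hom.comp_apply, P1P1.chart_fst, Scheme.Hom.comp_apply]
  have k2 : ∀ k, pullback.snd P1ToC P1ToC (P1P1.chart i j x) ∈ pointP1 k ↔
      (if j = k then 1 else MvPolynomial.X 1 : MvPolynomial (Fin 2) ℂ) ∈ primeIdeal x := fun k ↦ by
    rw [← key, ← Scheme.Hom.comp_apply, P1P1.chart_snd, Scheme.Hom.comp_apply]
  have h2 : ((pullback.fst P1ToC P1ToC (P1P1.chart i j x) ∈ pointP1 0 ∧
      pullback.snd P1ToC P1ToC (P1P1.chart i j x) ∈ pointP1 1) ∨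
      (pullback.fst P1ToC P1ToC (P1P1.chart i j x) ∈ pointP1 1 ∧
      pullback.snd P1ToC P1ToC (P1P1.chart i j x) ∈ pointP1 0)) ↔
      Ideal.span {planeEqn i j 0, planeEqn i j 1} ≤ primeIdeal x := by
    rw [h1, k1, k1, k2, k2, planeEqn, planeEqn, hx.mul_mem_iff_mem_or_mem,
      hx.mul_mem_iff_mem_or_mem]
    have h3 : (1 : MvPolynomial (Fin 2) ℂ) ∉ primeIdeal x := fun h ↦
      hx.ne_top ((Ideal.eq_top_iff_one _).2 h)
    fin_cases i <;> fin_cases j <;> simp [h3]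
    exact and_comm
  exact h2

/-! ### The locus where an ideal sheaf is invertible -/

/-- The points at which the inverse image of an ideal sheaf is generated by a nonzerodivisor. -/
def InvertibleAt {X : Scheme.{u}} (I : X.IdealSheafData) : PointCondition X :=
  fun V g ↦ {v | ∃ U : V.affineOpens, v ∈ U.1 ∧
    ∃ a ∈ nonZeroDivisors Γ(V, U.1), (I.comap g).ideal U = Ideal.span {a}}

/-- Blow-ups as universal objects, for ideal sheaves that are not globally generated by two
functions. -/
theorem isBlowup_iff_isUniversal {X Y : Scheme.{u}} (I : X.IdealSheafData) (π : Y ⟶ X) :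
    IsBlowup I π ↔ IsUniversal (InvertibleAt I) π := by
  have e : ∀ {V : Scheme.{u}} (g : V ⟶ X), IsInvertible (I.comap g) ↔
      InvertibleAt I g = Set.univ := fun g ↦ Set.eq_univ_iff_forall.symm
  exact ⟨fun h ↦ ⟨(e _).1 h.1, fun g hg ↦ h.2 _ g ((e _).2 hg)⟩,
    fun h ↦ ⟨(e _).2 h.1, fun _ g hg ↦ h.2 g ((e _).1 hg)⟩⟩

theorem InvertibleAt.isLocal {X : Scheme.{u}} (I : X.IdealSheafData) :
    (InvertibleAt I).IsLocal := by
  intro V' V j _ g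
  ext v
  have key : ∀ U : V'.affineOpens, (∃ a ∈ nonZeroDivisors Γ(V', U.1),
      (I.comap (j ≫ g)).ideal U = Ideal.span {a}) ↔
      ∃ a ∈ nonZeroDivisors Γ(V, j ''ᵁ U.1), (I.comap g).ideal ⟨j ''ᵁ U.1,
        U.2.image_of_isOpenImmersion j⟩ = Ideal.span {a} := by
    intro U
    rw [Scheme.IdealSheafData.comap_comp, Scheme.IdealSheafData.ideal_comap_of_isOpenImmersion]
    let e := (j.appIso U.1).symm.commRingCatIsoToRingEquiv
    have he : ∀ K : Ideal Γ(V, j ''ᵁ U.1), K.comap (j.appIso U.1).inv.hom = K.map e.symm := fun K ↦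
      (Ideal.map_symm e).symm
    rw [he]
    constructor
    · rintro ⟨a, ha, h⟩
      refine ⟨e a, (mem_nonZeroDivisors_equiv_iff e).2 ha, ?_⟩
      have h1 := congrArg (Ideal.map e) h
      rw [Ideal.map_span, Set.image_singleton] at h1
      rw [← h1]
      exact (Ideal.map_of_equiv e.symm).symm
    · rintro ⟨a, ha, h⟩
      refine ⟨e.symm a, (mem_nonZeroDivisors_equiv_iff e.symm).2 ha, ?_⟩
      rw [h, Ideal.map_span, Set.image_singleton]
  constructor
  · rintro ⟨U, hv, h⟩
    exact ⟨⟨j ''ᵁ U.1, U.2.image_of_isOpenImmersion j⟩, ⟨v, hv, rfl⟩, (key U).1 h⟩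
  · rintro ⟨U, hv, a, ha, h⟩
    obtain ⟨_, ⟨U', hU', rfl⟩, hvU', hle⟩ := V'.isBasis_affineOpens.exists_subset_of_mem_open
      (show v ∈ (j ⁻¹ᵁ U.1 : Set V') from hv) (j ⁻¹ᵁ U.1).isOpen
    have hU' : IsAffineOpen U' := hU'
    have hle' : j ''ᵁ U' ≤ U.1 := by
      rintro _ ⟨x, hx, rfl⟩
      exact hle hx
    refine ⟨⟨U', hU'⟩, hvU', (key ⟨U', hU'⟩).2 ⟨V.presheaf.map (homOfLE hle').op a, ?_, ?_⟩⟩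
    · refine mem_nonZeroDivisors_of_germ _ fun x hx ↦ ?_
      rw [TopCat.Presheaf.germ_res_apply]
      exact germ_mem_nonZeroDivisors U.2 ha x (hle' hx)
    · have h1 := (I.comap g).map_ideal (U := ⟨j ''ᵁ U', hU'.image_of_isOpenImmersion j⟩)
        (V := U) hle'
      rw [← h1, h, Ideal.map_span, Set.image_singleton]
      rfl

/-! ### The charts of the surface `T₇₈₉` -/

/-- An affine chart of a scheme restricts to an affine chart of a closed subscheme. -/
theorem exists_chart_subscheme {R A : Type u} [CommRing R] [CommRing A] (ψ : R →+* A)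
    (hψ : Function.Surjective ψ) {Z : Scheme.{u}} (φ : Spec (CommRingCat.of R) ⟶ Z)
    [IsOpenImmersion φ] {I : Z.IdealSheafData} (hI : I.comap φ = idealSheaf R (RingHom.ker ψ)) :
    ∃ τ : Spec (CommRingCat.of A) ⟶ I.subscheme, IsOpenImmersion τ ∧
      τ ≫ I.subschemeι = Spec.map (CommRingCat.ofHom ψ) ≫ φ ∧
      Set.range τ = I.subschemeι ⁻¹' Set.range φ := by
  obtain ⟨e, he⟩ := exists_iso_subscheme_idealSheaf ψ hψ rfl
  let e' := e ≪≫ subschemeIsoOfEq hI.symm ≪≫ I.comapIso φ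
  refine ⟨e'.hom ≫ pullback.snd φ I.subschemeι, inferInstance, ?_, ?_⟩
  · simp only [e', Iso.trans_hom, Category.assoc]
    rw [← pullback.condition, Scheme.IdealSheafData.comapIso_hom_fst_assoc]
    rw [← Category.assoc (subschemeIsoOfEq hI.symm).hom, subschemeIsoOfEq_hom_ι,
      ← Category.assoc, he]
  · ext x
    constructor
    · rintro ⟨y, rfl⟩
      refine ⟨pullback.fst φ I.subschemeι (e'.hom y), ?_⟩
      rw [← Scheme.Hom.comp_apply, pullback.condition]
      rfl
    · rintro ⟨y, hy⟩
      obtain ⟨q, -, hq⟩ := Scheme.Pullback.exists_preimage_pullback y x hy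
      exact ⟨e'.inv q, by simpa using hq⟩

/-- The coordinate ring of a chart of `T₇₈₉`. -/
abbrev RingT (ε : Fin 3 → Bool) : Type := RingU ε ⧸ Ideal.span (b ε '' Set.univ)

instance (ε : Fin 3 → Bool) : (Ideal.span (b ε '' Set.univ)).IsPrime := isPrime_span_b ε _

/-- The coordinates of a chart of `T₇₈₉`. -/
def t (ε : Fin 3 → Bool) (i : Fin 3) : RingT ε := Ideal.Quotient.mk _ (s ε i)

/-- The morphism from a chart of `T₇₈₉` to a chart of `ℙ¹ × ℙ¹`. -/
def planeToT (ε : Fin 3 → Bool) : MvPolynomial (Fin 2) ℂ →ₐ[ℂ] RingT ε :=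
  MvPolynomial.aeval (R := ℂ) ![t ε 0, t ε 1]

/-- The relation of a chart expresses that its third coordinate is a quotient of the two generators
of the ideal of the two points. -/
theorem chartRel_iff_planeEqn {A : Type*} [CommRing A] (ε : Fin 3 → Bool)
    (ψ : MvPolynomial (Fin 2) ℂ →+* A) (c : A) :
    ChartRel ε ![ψ (MvPolynomial.X 0), ψ (MvPolynomial.X 1), c] ↔
      ψ (planeEqn (unitIndex (ε 0)) (unitIndex (ε 1)) (1 - unitIndex (ε 2))) * c =
        ψ (planeEqn (unitIndex (ε 0)) (unitIndex (ε 1)) (unitIndex (ε 2))) := by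
  rw [ChartRel, Fin.prod_univ_three, Fin.prod_univ_three]
  cases ε 0 <;> cases ε 1 <;> cases ε 2 <;> simp [planeEqn, unitIndex]
  all_goals try rw [eq_comm]

theorem planeToT_ne_zero (ε : Fin 3 → Bool) (i j k : Fin 2) :
    planeToT ε (planeEqn i j k) ≠ 0 := by
  let χ : RingU ε →ₐ[ℂ] ℂ := liftU 1 0 (chartRel_one ε)
  have hχ : ∀ x ∈ Ideal.span (b ε '' Set.univ), χ x = 0 := fun x hx ↦ by
    have : Ideal.span (b ε '' Set.univ) ≤ RingHom.ker χ := Ideal.span_le.2 (by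
      rintro _ ⟨i, -, rfl⟩
      exact liftU_b _ _ _ i)
    exact this hx
  intro h
  have h1 := congrArg (Ideal.Quotient.liftₐ _ χ hχ) h
  have h2 : (Ideal.Quotient.liftₐ _ χ hχ).comp (planeToT ε) =
      MvPolynomial.aeval (R := ℂ) (1 : Fin 2 → ℂ) := by
    refine MvPolynomial.algHom_ext fun i ↦ ?_
    rw [AlgHom.comp_apply, planeToT, MvPolynomial.aeval_X, MvPolynomial.aeval_X]
    fin_cases i
    exacts [liftU_s _ _ (chartRel_one ε) 0, liftU_s _ _ (chartRel_one ε) 1]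
  have h3 := (congr($h2 (planeEqn i j k))).symm.trans h1
  rw [map_zero, planeEqn] at h3
  split_ifs at h3 <;> simp at h3

theorem planeToT_relation (ε : Fin 3 → Bool) :
    planeToT ε (planeEqn (unitIndex (ε 0)) (unitIndex (ε 1)) (1 - unitIndex (ε 2))) * t ε 2 =
      planeToT ε (planeEqn (unitIndex (ε 0)) (unitIndex (ε 1)) (unitIndex (ε 2))) := by
  have h := ChartRel.map (B := RingT ε) (chartRel_s ε)
    (Ideal.Quotient.mk (Ideal.span (b ε '' Set.univ)))
  refine (chartRel_iff_planeEqn ε (planeToT ε).toRingHom (t ε 2)).1 ?_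
  convert h using 1
  funext i
  fin_cases i
  · exact MvPolynomial.aeval_X _ _
  · exact MvPolynomial.aeval_X _ _
  · rfl

/-- A chart of `T₇₈₉` adjoins to the polynomial ring in two variables the quotient of the two
generators of the ideal of the two points. -/
theorem isUniversal_planeToT (ε : Fin 3 → Bool) : IsUniversal
    (Divides (planeEqn (unitIndex (ε 0)) (unitIndex (ε 1)) (1 - unitIndex (ε 2)))
      (planeEqn (unitIndex (ε 0)) (unitIndex (ε 1)) (unitIndex (ε 2))))
    (Spec.map (CommRingCat.ofHom (S := RingT ε) (planeToT ε).toRingHom)) := by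
  refine IsUniversal.congr (q := Divides (planeEqn (unitIndex (ε 0)) (unitIndex (ε 1))
    (1 - unitIndex (ε 2))) (planeEqn (unitIndex (ε 0)) (unitIndex (ε 1)) (unitIndex (ε 2))))
    (isUniversal_Spec (ι := Unit) (A := RingT ε) (planeToT ε).toRingHom
    (fun _ ↦ planeEqn (unitIndex (ε 0)) (unitIndex (ε 1)) (1 - unitIndex (ε 2)))
    (fun _ ↦ planeEqn (unitIndex (ε 0)) (unitIndex (ε 1)) (unitIndex (ε 2)))
    (fun _ ↦ mem_nonZeroDivisors_of_ne_zero (planeToT_ne_zero ε _ _ _))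
    (fun _ ↦ ⟨_, (planeToT_relation ε).symm⟩) ?_) fun g ↦ by simp
  intro A _ ψ h1 h2
  obtain ⟨c, hc⟩ := h2 ()
  let _ := (ψ.comp MvPolynomial.C).toAlgebra
  have hrel := (chartRel_iff_planeEqn ε ψ c).2 hc.symm
  let χ : RingU ε →ₐ[ℂ] A := liftU _ 0 hrel
  have hχ : ∀ x ∈ Ideal.span (b ε '' Set.univ), χ x = 0 := fun x hx ↦ by
    have : Ideal.span (b ε '' Set.univ) ≤ RingHom.ker χ := Ideal.span_le.2 (by
      rintro _ ⟨i, -, rfl⟩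
      exact liftU_b _ _ _ i)
    exact this hx
  have e : ∀ χ' : RingT ε →+* A, χ'.comp (planeToT ε).toRingHom = ψ ↔
      (∀ a : ℂ, χ' (Ideal.Quotient.mk _ (algebraMap ℂ (RingU ε) a)) = ψ (MvPolynomial.C a)) ∧
        χ' (t ε 0) = ψ (MvPolynomial.X 0) ∧ χ' (t ε 1) = ψ (MvPolynomial.X 1) := by
    intro χ'
    have e0 : ∀ a : ℂ, planeToT ε (MvPolynomial.C a) =
        Ideal.Quotient.mk _ (algebraMap ℂ (RingU ε) a) :=
      fun a ↦ (planeToT ε).commutes a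
    have e1 : planeToT ε (MvPolynomial.X 0) = t ε 0 := MvPolynomial.aeval_X _ _
    have e2 : planeToT ε (MvPolynomial.X 1) = t ε 1 := MvPolynomial.aeval_X _ _
    rw [← e1, ← e2]
    constructor
    · rintro rfl
      exact ⟨fun a ↦ (congrArg χ' (e0 a)).symm, rfl, rfl⟩
    · rintro ⟨h0, h1, h2⟩
      refine MvPolynomial.ringHom_ext (fun a ↦ (congrArg χ' (e0 a)).trans (h0 a)) fun i ↦ ?_
      fin_cases i
      exacts [h1, h2]
  refine ⟨(Ideal.Quotient.liftₐ _ χ hχ).toRingHom, (e _).2 ⟨fun a ↦ χ.commutes a,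
    liftU_s _ _ hrel 0, liftU_s _ _ hrel 1⟩, fun χ' hχ' ↦ ?_⟩
  obtain ⟨h3, h4, h5⟩ := (e _).1 hχ'
  have h6 : χ' (t ε 2) = c := by
    refine (mul_cancel_left_mem_nonZeroDivisors (h1 ())).1 ?_
    rw [← hc, ← hχ', RingHom.comp_apply, RingHom.comp_apply, ← map_mul]
    exact congrArg χ' (planeToT_relation ε)
  refine Ideal.Quotient.ringHom_ext (RingU.hom_ext (fun a ↦ ?_) (fun i ↦ ?_) fun i ↦ ?_)
  · exact (h3 a).trans (χ.commutes a).symm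
  · refine Eq.trans ?_ (liftU_s _ _ hrel i).symm
    fin_cases i
    exacts [h4, h5, h6]
  · refine Eq.trans ?_ (liftU_b _ _ hrel i).symm
    have : Ideal.Quotient.mk (Ideal.span (b ε '' Set.univ)) (b ε i) = 0 :=
      Ideal.Quotient.eq_zero_iff_mem.2 (Ideal.subset_span ⟨i, trivial, rfl⟩)
    exact (congrArg χ' this).trans (map_zero χ')

/-- A version of `IsUniversal.of_cover` for open immersions instead of open subschemes. -/
theorem IsUniversal.of_charts {X Y : Scheme.{u}} {ι : Type*} {p : PointCondition X}
    (hp : p.IsLocal) (pc : ι → PointCondition X) (hpc : ∀ c, (pc c).IsLocal)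
    (hopen : ∀ {V : Scheme.{u}} (g : V ⟶ X), p g = Set.univ → ∀ c, IsOpen (pc c g))
    (hcover : ∀ {V : Scheme.{u}} (g : V ⟶ X), p g = Set.univ → ∀ v, ∃ c, v ∈ pc c g)
    {π : Y ⟶ X} (hπ : p π = Set.univ) {Y' : ι → Scheme.{u}} (i : ∀ c, Y' c ⟶ Y)
    [∀ c, IsOpenImmersion (i c)] (hO : ∀ c, IsUniversal (pc c) (i c ≫ π))
    (htrans : ∀ {V : Scheme.{u}} (l : V ⟶ Y) c, p (l ≫ π) = Set.univ →
      pc c (l ≫ π) ⊆ l ⁻¹' Set.range (i c)) : IsUniversal p π := by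
  refine .of_cover hp pc hpc hopen hcover hπ (fun c ↦ (i c).opensRange) (fun c ↦ ?_) htrans
  have := (hO c).of_iso (hpc c) (i c).isoOpensRange.symm
  rw [Iso.symm_hom, Scheme.Hom.isoOpensRange_inv_comp_assoc] at this
  exact this

namespace BlowupTower

variable (B : BlowupTower)

theorem exists_chart_T (ε : Fin 3 → Bool) :
    ∃ τ : Spec (CommRingCat.of (RingT ε)) ⟶ (B.inter {7, 8, 9}).subscheme, IsOpenImmersion τ ∧
      τ ≫ (B.inter {7, 8, 9}).subschemeι =
        Spec.map (CommRingCat.ofHom (Ideal.Quotient.mk (Ideal.span (b ε '' Set.univ)))) ≫ B.φ ε ∧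
      Set.range τ = (B.inter {7, 8, 9}).subschemeι ⁻¹' Set.range (B.φ ε) := by
  refine exists_chart_subscheme _ Ideal.Quotient.mk_surjective (B.φ ε) ?_
  rw [inter_comap _ _ (by decide), Ideal.mk_ker]
  congr 1
  have h : ∀ k ∈ ({7, 8, 9} : Finset ℕ), ∃ i, label k = (i, i) := by decide
  have h' : ∀ i, ∃ k ∈ ({7, 8, 9} : Finset ℕ), label k = (i, i) := by decide
  refine le_antisymm (iSup₂_le fun k hk ↦ ?_) (Ideal.span_le.2 ?_)
  · obtain ⟨i, hi⟩ := h k hk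
    rw [hi, chartI, if_pos rfl]
    exact Ideal.span_mono (Set.singleton_subset_iff.2 ⟨i, trivial, rfl⟩)
  · rintro _ ⟨i, -, rfl⟩
    obtain ⟨k, hk, hi⟩ := h' i
    have h1 := le_iSup₂ (f := fun k (_ : k ∈ ({7, 8, 9} : Finset ℕ)) ↦ chartI ε (label k)) k hk
    refine h1 ?_
    rw [hi, chartI, if_pos rfl]
    exact Ideal.mem_span_singleton_self _

/-- The chart of `T₇₈₉` contained in the chart of `Z` with the given index. -/
def τ (ε : Fin 3 → Bool) : Spec (CommRingCat.of (RingT ε)) ⟶ (B.inter {7, 8, 9}).subscheme :=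
  (B.exists_chart_T ε).choose

instance (ε : Fin 3 → Bool) : IsOpenImmersion (B.τ ε) := (B.exists_chart_T ε).choose_spec.1

theorem τ_ι (ε : Fin 3 → Bool) : B.τ ε ≫ (B.inter {7, 8, 9}).subschemeι =
    Spec.map (CommRingCat.ofHom (Ideal.Quotient.mk (Ideal.span (b ε '' Set.univ)))) ≫ B.φ ε :=
  (B.exists_chart_T ε).choose_spec.2.1

theorem range_τ (ε : Fin 3 → Bool) :
    Set.range (B.τ ε) = (B.inter {7, 8, 9}).subschemeι ⁻¹' Set.range (B.φ ε) :=
  (B.exists_chart_T ε).choose_spec.2.2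

theorem exists_τ_eq (x : (B.inter {7, 8, 9}).subscheme) : ∃ ε, ∃ y, B.τ ε y = x := by
  obtain ⟨ε, y, hy⟩ := B.exists_φ_eq ((B.inter {7, 8, 9}).subschemeι x)
  have : x ∈ Set.range (B.τ ε) := by
    rw [range_τ]
    exact ⟨y, hy⟩
  exact ⟨ε, this⟩

theorem τ_mem_range {ε ε' : Fin 3 → Bool} {x : Spec (CommRingCat.of (RingT ε))}
    (h : ∀ l, ε l ≠ ε' l → t ε l ∉ primeIdeal x) : B.τ ε x ∈ Set.range (B.τ ε') := by
  rw [range_τ, Set.mem_preimage, ← Scheme.Hom.comp_apply, τ_ι, Scheme.Hom.comp_apply]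
  exact B.φ_mem_range h

/-- The morphism `T₇₈₉ ⟶ ℙ¹ × ℙ¹` with components `[z_1 : w_1]` and `[z_2 : w_2]`. -/
def toP1P1 : (B.inter {7, 8, 9}).subscheme ⟶ P1P1 :=
  pullback.lift ((B.inter {7, 8, 9}).subschemeι ≫ B.ratio 0)
    ((B.inter {7, 8, 9}).subschemeι ≫ B.ratio 1)
    (by rw [Category.assoc, Category.assoc, ratio_toC, ratio_toC])

theorem τ_toP1P1 (ε : Fin 3 → Bool) : B.τ ε ≫ B.toP1P1 =
    Spec.map (CommRingCat.ofHom (S := RingT ε) (planeToT ε).toRingHom) ≫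
      P1P1.chart (unitIndex (ε 0)) (unitIndex (ε 1)) := by
  have h : ∀ (i : Fin 3) (j : Fin 2), ![t ε 0, t ε 1] j = t ε i →
      B.τ ε ≫ (B.inter {7, 8, 9}).subschemeι ≫ B.ratio i =
      Spec.map (CommRingCat.ofHom (S := RingT ε) (planeToT ε).toRingHom) ≫ planeProj j ≫
        P1.chart (unitIndex (ε i)) := by
    intro i j hij
    have e : (Ideal.Quotient.mk (Ideal.span (b ε '' Set.univ))).comp
        (Polynomial.aeval (R := ℂ) (s ε i)).toRingHom = (planeToT ε).toRingHom.comp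
        (Polynomial.aeval (R := ℂ) (MvPolynomial.X j : MvPolynomial (Fin 2) ℂ)).toRingHom := by
      refine Polynomial.ringHom_ext (fun a ↦ ?_) ?_
      · exact (congrArg (Ideal.Quotient.mk (Ideal.span (b ε '' Set.univ)))
          (Polynomial.aeval_C (s ε i) a)).trans ((planeToT ε).commutes a).symm |>.trans
          (congrArg (planeToT ε) (Polynomial.aeval_C
            (MvPolynomial.X j : MvPolynomial (Fin 2) ℂ) a)).symm
      · exact (congrArg (Ideal.Quotient.mk (Ideal.span (b ε '' Set.univ)))
          (Polynomial.aeval_X (s ε i))).trans ((MvPolynomial.aeval_X _ _).trans hij).symm |>.trans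
          (congrArg (planeToT ε) (Polynomial.aeval_X
            (MvPolynomial.X j : MvPolynomial (Fin 2) ℂ))).symm
    rw [← Category.assoc, τ_ι, Category.assoc, φ_ratio, chartRatio, planeProj, ← Category.assoc,
      ← Category.assoc, ← Spec.map_comp, ← Spec.map_comp, ← CommRingCat.ofHom_comp,
      ← CommRingCat.ofHom_comp, e]
  refine pullback.hom_ext ?_ ?_
  · rw [Category.assoc, Category.assoc, toP1P1, pullback.lift_fst, P1P1.chart_fst]
    exact h 0 0 rfl
  · rw [Category.assoc, Category.assoc, toP1P1, pullback.lift_snd, P1P1.chart_snd]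
    exact h 1 1 rfl

end BlowupTower

/-! ### The surface `T₇₈₉` as a blow-up -/

theorem PointCondition.mem_over {X V : Scheme.{u}} {p : PointCondition X} {U : Set X} {g : V ⟶ X}
    {v : V} : v ∈ p.over U g ↔ g v ∈ U ∧ v ∈ p g := Iff.rfl

namespace BlowupTower

variable (B : BlowupTower)

theorem range_τ_subset (ε : Fin 3 → Bool) : Set.range (B.τ ε) ⊆
    B.toP1P1 ⁻¹' Set.range (P1P1.chart (unitIndex (ε 0)) (unitIndex (ε 1))) := by
  rintro _ ⟨x, rfl⟩
  rw [Set.mem_preimage, ← Scheme.Hom.comp_apply, τ_toP1P1, Scheme.Hom.comp_apply]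
  exact ⟨_, rfl⟩

/-- The part of `T₇₈₉` over a chart of `ℙ¹ × ℙ¹` is covered by two charts. -/
theorem exists_mem_range_τ (c : Fin 2 → Bool) {x : (B.inter {7, 8, 9}).subscheme}
    (hx : B.toP1P1 x ∈ Set.range (P1P1.chart (unitIndex (c 0)) (unitIndex (c 1)))) :
    ∃ d, x ∈ Set.range (B.τ ![c 0, c 1, d]) := by
  obtain ⟨ε, y, rfl⟩ := B.exists_τ_eq x
  refine ⟨ε 2, B.τ_mem_range fun l hl ↦ ?_⟩
  rw [← Scheme.Hom.comp_apply, τ_toP1P1, Scheme.Hom.comp_apply, P1P1.range_chart] at hx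
  have hu : ∀ a b : Bool, a ≠ b → unitIndex b ≠ unitIndex a := by decide
  have key : ∀ (a b : Bool) (j : Fin 2) (l : Fin 3), a ≠ b → ![t ε 0, t ε 1] j = t ε l →
      P1.chart (unitIndex a) (planeProj j (Spec.map (CommRingCat.ofHom (S := RingT ε)
        (planeToT ε).toRingHom) y)) ∈ Set.range (P1.chart (unitIndex b)) →
        t ε l ∉ primeIdeal y := by
    intro a b j l hab hl h
    rw [P1.range_chart] at h
    have h1 := (P1.chart_mem_pointP1 (hu a b hab) _).not.1 h
    rw [planeProj, primeIdeal_map, primeIdeal_map, Ideal.mem_comap, Ideal.mem_comap] at h1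
    have e : (planeToT ε).toRingHom ((Polynomial.aeval (R := ℂ)
        (MvPolynomial.X j : MvPolynomial (Fin 2) ℂ)).toRingHom Polynomial.X) = t ε l :=
      (congrArg (planeToT ε) (Polynomial.aeval_X _)).trans ((MvPolynomial.aeval_X _ _).trans hl)
    exact e ▸ h1
  obtain ⟨h1, h2⟩ := hx
  rw [Set.mem_preimage, ← Scheme.Hom.comp_apply, P1P1.chart_fst, Scheme.Hom.comp_apply] at h1
  rw [Set.mem_preimage, ← Scheme.Hom.comp_apply, P1P1.chart_snd, Scheme.Hom.comp_apply] at h2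
  fin_cases l
  · exact key _ _ 0 0 hl rfl h1
  · exact key _ _ 1 1 hl rfl h2
  · exact absurd rfl hl

/-- The part of `T₇₈₉` over a chart of `ℙ¹ × ℙ¹`. -/
def overChart (c : Fin 2 → Bool) : (B.inter {7, 8, 9}).subscheme.Opens :=
  B.toP1P1 ⁻¹ᵁ (P1P1.chart (unitIndex (c 0)) (unitIndex (c 1))).opensRange

theorem mem_overChart (c : Fin 2 → Bool) (x : (B.inter {7, 8, 9}).subscheme) :
    x ∈ B.overChart c ↔
      B.toP1P1 x ∈ Set.range (P1P1.chart (unitIndex (c 0)) (unitIndex (c 1))) := Iff.rfl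

/-- The restriction of `T₇₈₉ ⟶ ℙ¹ × ℙ¹` over a chart. -/
def toPlane (c : Fin 2 → Bool) : (B.overChart c).toScheme ⟶
    Spec (CommRingCat.of (MvPolynomial (Fin 2) ℂ)) :=
  IsOpenImmersion.lift (P1P1.chart (unitIndex (c 0)) (unitIndex (c 1)))
    ((B.overChart c).ι ≫ B.toP1P1) (by rintro _ ⟨x, rfl⟩; exact x.2)

theorem toPlane_chart (c : Fin 2 → Bool) :
    B.toPlane c ≫ P1P1.chart (unitIndex (c 0)) (unitIndex (c 1)) =
      (B.overChart c).ι ≫ B.toP1P1 := IsOpenImmersion.lift_fac _ _ _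

/-- A chart of `T₇₈₉`, as a chart of the part over a chart of `ℙ¹ × ℙ¹`. -/
def τOver (c : Fin 2 → Bool) (d : Bool) :
    Spec (CommRingCat.of (RingT ![c 0, c 1, d])) ⟶ (B.overChart c).toScheme :=
  IsOpenImmersion.lift (B.overChart c).ι (B.τ ![c 0, c 1, d]) (by
    rw [Scheme.Opens.range_ι]
    exact B.range_τ_subset ![c 0, c 1, d])

theorem τOver_ι (c : Fin 2 → Bool) (d : Bool) :
    B.τOver c d ≫ (B.overChart c).ι = B.τ ![c 0, c 1, d] := IsOpenImmersion.lift_fac _ _ _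

instance (c : Fin 2 → Bool) (d : Bool) : IsOpenImmersion (B.τOver c d) := by
  have : IsOpenImmersion (B.τOver c d ≫ (B.overChart c).ι) := by
    rw [τOver_ι]
    infer_instance
  exact IsOpenImmersion.of_comp _ (B.overChart c).ι

theorem mem_range_τOver (c : Fin 2 → Bool) (d : Bool) (x : (B.overChart c).toScheme) :
    x ∈ Set.range (B.τOver c d) ↔ (B.overChart c).ι x ∈ Set.range (B.τ ![c 0, c 1, d]) := by
  constructor
  · rintro ⟨y, rfl⟩
    exact ⟨y, by rw [← τOver_ι]; rfl⟩
  · rintro ⟨y, hy⟩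
    refine ⟨y, (B.overChart c).ι.isOpenEmbedding.injective ?_⟩
    rw [← hy, ← τOver_ι]
    rfl

theorem τOver_toPlane (c : Fin 2 → Bool) (d : Bool) : B.τOver c d ≫ B.toPlane c =
    Spec.map (CommRingCat.ofHom (S := RingT ![c 0, c 1, d])
      (planeToT ![c 0, c 1, d]).toRingHom) := by
  rw [← cancel_mono (P1P1.chart (unitIndex (c 0)) (unitIndex (c 1))), Category.assoc, toPlane_chart,
    ← Category.assoc, τOver_ι]
  exact B.τ_toP1P1 ![c 0, c 1, d]

/-- The condition represented by a chart of `T₇₈₉`: one generator of the ideal of the two points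
divides the other. -/
def PlaneCondition (c : Fin 2 → Bool) (d : Bool) :
    PointCondition (Spec (CommRingCat.of (MvPolynomial (Fin 2) ℂ))) :=
  Divides (planeEqn (unitIndex (c 0)) (unitIndex (c 1)) (1 - unitIndex d))
    (planeEqn (unitIndex (c 0)) (unitIndex (c 1)) (unitIndex d))

theorem isUniversal_τOver (c : Fin 2 → Bool) (d : Bool) :
    IsUniversal (PlaneCondition c d) (B.τOver c d ≫ B.toPlane c) := by
  rw [τOver_toPlane]
  exact isUniversal_planeToT ![c 0, c 1, d]

theorem planeCondition_isOpenIn (c : Fin 2 → Bool) (d : Bool) : (PlaneCondition c d).IsOpenIn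
    (Principal (planeEqn (unitIndex (c 0)) (unitIndex (c 1)) 0)
      (planeEqn (unitIndex (c 0)) (unitIndex (c 1)) 1)) := by
  cases d
  · exact Divides.isOpenIn _ _
  · have e : Principal (planeEqn (unitIndex (c 0)) (unitIndex (c 1)) 0)
        (planeEqn (unitIndex (c 0)) (unitIndex (c 1)) 1) =
        Principal (planeEqn (unitIndex (c 0)) (unitIndex (c 1)) 1)
          (planeEqn (unitIndex (c 0)) (unitIndex (c 1)) 0) := by
      ext V g : 2
      exact Set.union_comm _ _
    rw [e]
    exact Divides.isOpenIn _ _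

theorem principal_toPlane (c : Fin 2 → Bool) :
    Principal (planeEqn (unitIndex (c 0)) (unitIndex (c 1)) 0)
      (planeEqn (unitIndex (c 0)) (unitIndex (c 1)) 1) (B.toPlane c) = Set.univ := by
  refine Set.eq_univ_of_forall fun x ↦ ?_
  obtain ⟨d, hd⟩ := B.exists_mem_range_τ c x.2
  obtain ⟨y, rfl⟩ := (B.mem_range_τOver c d x).2 hd
  have h := (B.isUniversal_τOver c d).self.ge (Set.mem_univ y)
  rw [(planeCondition_isOpenIn c d).isLocal] at h
  cases d
  · exact Or.inl h
  · exact Or.inr h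

/-- Where the two generators of the ideal of the two points divide each other, the third coordinate
of a chart is invertible. -/
theorem mem_range_of_planeCondition (c : Fin 2 → Bool) (d : Bool) {x : (B.overChart c).toScheme}
    (hx : x ∈ PlaneCondition c d (B.toPlane c)) : x ∈ Set.range (B.τOver c d) := by
  obtain ⟨d', hd'⟩ := B.exists_mem_range_τ c x.2
  by_cases h : d' = d
  · exact h ▸ (B.mem_range_τOver c d' x).2 hd'
  obtain ⟨y, rfl⟩ := (B.mem_range_τOver c d' x).2 hd'
  rw [mem_range_τOver, ← Scheme.Hom.comp_apply, τOver_ι]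
  refine B.τ_mem_range fun l hl ↦ ?_
  have hl2 : l = 2 := by
    fin_cases l
    exacts [absurd rfl hl, absurd rfl hl, rfl]
  subst hl2
  have h1 : y ∈ PlaneCondition c d (B.τOver c d' ≫ B.toPlane c) := by
    rw [(planeCondition_isOpenIn c d).isLocal]
    exact hx
  have h2 := (B.isUniversal_τOver c d').self.ge (Set.mem_univ y)
  rw [τOver_toPlane] at h1 h2
  obtain ⟨-, h3⟩ := h1
  obtain ⟨h4, -⟩ := h2
  have h5 : ∀ d d' : Bool, ¬ d' = d → 1 - unitIndex d = unitIndex d' ∧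
      unitIndex d = 1 - unitIndex d' := by decide
  have h5 := h5 d d' h
  rw [h5.1, h5.2, stalkHom_map (A := RingT ![c 0, c 1, d']),
    stalkHom_map (A := RingT ![c 0, c 1, d'])] at h3
  rw [stalkHom_map (A := RingT ![c 0, c 1, d'])] at h4
  have h6 := planeToT_relation ![c 0, c 1, d']
  rw [← isUnit_stalkHom_id_iff]
  generalize stalkHom (𝟙 (Spec (CommRingCat.of (RingT ![c 0, c 1, d'])))) y = G at h3 h4 ⊢
  obtain ⟨k, hk⟩ := h3
  have h7 : G (planeToT ![c 0, c 1, d'] (planeEqn (unitIndex (c 0)) (unitIndex (c 1))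
      (1 - unitIndex d'))) * G (t ![c 0, c 1, d'] 2) =
      G (planeToT ![c 0, c 1, d'] (planeEqn (unitIndex (c 0)) (unitIndex (c 1)) (unitIndex d'))) :=
    (map_mul G _ _).symm.trans (congrArg G h6)
  refine IsUnit.of_mul_eq_one k ((mul_cancel_left_mem_nonZeroDivisors h4).1 ?_)
  rw [← mul_assoc, mul_one]
  exact (congrArg (· * k) h7).trans hk.symm

/-- Over a chart of `ℙ¹ × ℙ¹` the surface is glued from two affine charts, in each of which one
generator of the ideal of the two points divides the other. -/
theorem isUniversal_toPlane (c : Fin 2 → Bool) :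
    IsUniversal (Principal (planeEqn (unitIndex (c 0)) (unitIndex (c 1)) 0)
      (planeEqn (unitIndex (c 0)) (unitIndex (c 1)) 1)) (B.toPlane c) := by
  refine IsUniversal.of_charts (Principal.isLocal _ _) (PlaneCondition c)
    (fun d ↦ (planeCondition_isOpenIn c d).isLocal)
    (fun g hg d ↦ (planeCondition_isOpenIn c d).isOpen g hg) (fun g hg v ↦ ?_)
    (B.principal_toPlane c) (B.τOver c) (B.isUniversal_τOver c) fun l d hl v hv ↦ ?_
  · exact (hg.ge (Set.mem_univ v)).elim (fun h ↦ ⟨false, h⟩) fun h ↦ ⟨true, h⟩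
  · rw [(planeCondition_isOpenIn c d).preimage l _ (B.principal_toPlane c) hl] at hv
    exact B.mem_range_of_planeCondition c d hv

/-- The morphism `T₇₈₉ ⟶ ℙ¹ × ℙ¹` is the blow-up of the two points. -/
theorem isBlowup_toP1P1 : IsBlowup twoPoints B.toP1P1 := by
  rw [isBlowup_iff_isUniversal]
  have hloc := InvertibleAt.isLocal twoPoints
  have hc : ∀ x : P1P1, ∃ c : Fin 2 → Bool,
      x ∈ Set.range (P1P1.chart (unitIndex (c 0)) (unitIndex (c 1))) := fun x ↦ by
    obtain ⟨i, j, h⟩ := P1P1.exists_chart_eq x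
    have hs : Function.Surjective unitIndex := by decide
    obtain ⟨a, rfl⟩ := hs i
    obtain ⟨b, rfl⟩ := hs j
    exact ⟨![a, b], h⟩
  let pc : (Fin 2 → Bool) → PointCondition P1P1 := fun c ↦ (InvertibleAt twoPoints).over
    (Set.range (P1P1.chart (unitIndex (c 0)) (unitIndex (c 1))))
  have hu : ∀ c, IsUniversal (pc c) ((B.overChart c).ι ≫ B.toP1P1) := fun c ↦ by
    rw [← toPlane_chart]
    refine IsUniversal.comp_isOpenImmersion _ ((B.isUniversal_toPlane c).congr fun g ↦ ?_)
    rw [← isInvertible_comap_iff, ← twoPoints_comap_chart, ← Scheme.IdealSheafData.comap_comp]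
    exact Set.eq_univ_iff_forall.symm
  have hself : InvertibleAt twoPoints B.toP1P1 = Set.univ := by
    refine Set.eq_univ_of_forall fun x ↦ ?_
    obtain ⟨c, hx⟩ := hc (B.toP1P1 x)
    have h := ((hu c).self.ge (Set.mem_univ ⟨x, hx⟩)).2
    rw [hloc] at h
    exact h
  have hopen : ∀ {V : Scheme.{0}} (g : V ⟶ P1P1), InvertibleAt twoPoints g = Set.univ →
      ∀ c, IsOpen (pc c g) := fun g hg c ↦ by
    change IsOpen ((InvertibleAt twoPoints).over _ g)
    rw [PointCondition.over, hg, Set.inter_univ]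
    exact (P1P1.chart (unitIndex (c 0)) (unitIndex (c 1))).opensRange.isOpen.preimage g.continuous
  have hcover : ∀ {V : Scheme.{0}} (g : V ⟶ P1P1), InvertibleAt twoPoints g = Set.univ →
      ∀ v, ∃ c, v ∈ pc c g := fun g hg v ↦ by
    obtain ⟨c, hx⟩ := hc (g v)
    exact ⟨c, hx, hg.ge (Set.mem_univ v)⟩
  refine IsUniversal.of_cover hloc pc (fun c ↦ hloc.over _) hopen hcover hself B.overChart hu ?_
  intro V l c _ v hv
  obtain ⟨h, -⟩ := PointCondition.mem_over.1 hv
  rw [Scheme.Hom.comp_apply] at h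
  exact (B.mem_overChart c (l v)).2 h

theorem exists_isBlowup_iso :
    ∃ (Bl : Scheme.{0}) (π : Bl ⟶ P1P1) (e : (B.inter {7, 8, 9}).subscheme ≅ Bl),
      IsBlowup twoPoints π ∧ e.hom ≫ π ≫ pullback.fst P1ToC P1ToC ≫ P1ToC =
        (B.inter {7, 8, 9}).subschemeι ≫ B.h ≫ SToC := by
  refine ⟨_, B.toP1P1, Iso.refl _, B.isBlowup_toP1P1, ?_⟩
  rw [Iso.refl_hom, Category.id_comp, toP1P1, pullback.lift_fst_assoc, Category.assoc, ratio_toC]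

end BlowupTower

end

end TriplePoint

open TriplePoint in
theorem mainTheorem7 :
    -- the hypersurface `z₁z₂z₃ = w₁w₂w₃` is `X ×_S X`
    IsPullback p₁ p₂ f f ∧
    -- the blow-ups exist
    Nonempty BlowupTower ∧
    ∀ B : BlowupTower,
      -- `h` is normal-crossings, with special fibre the union of its nine components `T_k`
      IsNormalCrossingsDegeneration B.h ∧
      ((B.fibre : Set B.Z) = ⋃ k ∈ Finset.Icc 1 9, (B.T k : Set B.Z)) ∧
      Set.BijOn B.T (Finset.Icc 1 9 : Finset ℕ) (components B.fibre) ∧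
      -- the exceptional divisors are the proper transforms of the `Y_i × Y_i`
      B.T 7 = properTransform B.σ (prodY 0 0).support ∧
      B.T 8 = properTransform B.σ (prodY 1 1).support ∧
      B.T 9 = properTransform B.σ (prodY 2 2).support ∧
      -- `T̃^(m)` is the disjoint union of the `T_J` with `#J = m`; for `m = 1`, of the `T_k`
      (∀ m : ℕ, ∃ e : stratum B.fibre m ≅ B.interSum ((Finset.Icc 1 9).powersetCard m),
        e.hom ≫ B.interSumMap _ = stratumMap B.fibre m) ∧
      -- the eight affine charts
      (∃ φ : ∀ ε : Fin 3 → Bool, U ε ⟶ B.Z,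
        (∀ ε, IsOpenImmersion (φ ε)) ∧
        (∀ ε, φ ε ≫ B.σ = chartMap ε) ∧
        (∀ x : B.Z, ∃ ε, x ∈ Set.range (φ ε)) ∧
        (∀ ε, ∀ k ∈ Finset.Icc 1 9,
          (Scheme.IdealSheafData.vanishingIdeal (B.T k)).comap (φ ε) =
            idealSheaf (RingU ε) (chartT ε k)) ∧
        (∀ ε, {k : ℕ | k ∈ Finset.Icc 1 9 ∧
          ((B.T k : Set B.Z) ∩ Set.range (φ ε)).Nonempty}.ncard ≤ 5) ∧
        -- the diagonal curves: `δ i j` is `δ̃_ij` for `i < j` and `δ_ji` for `i > j`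
        ∃ δ : Fin 3 → Fin 3 → B.Z.IdealSheafData,
          (∀ i j, i ≠ j → ∀ ε, (δ i j).comap (φ ε) = idealSheaf (RingU ε) (chartDelta ε i j)) ∧
          B.inter {1, 7, 8} ≤ δ 0 1 ∧ B.inter {3, 7, 8} ≤ δ 1 0 ∧
          B.inter {2, 7, 9} ≤ δ 0 2 ∧ B.inter {5, 7, 9} ≤ δ 2 0 ∧
          B.inter {4, 8, 9} ≤ δ 1 2 ∧ B.inter {6, 8, 9} ≤ δ 2 1 ∧
          ∀ i j, i ≠ j → ∃ e : (δ i j).subscheme ≅ (Y {i, j}).subscheme,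
            e.hom ≫ Δ {i, j} = (δ i j).subschemeι ≫ B.σ) ∧
      -- `T_789` is the blow-up of `ℙ¹ × ℙ¹` at two points, over `Spec ℂ`
      (∃ (Bl : Scheme.{0}) (π : Bl ⟶ P1P1) (e : (B.inter {7, 8, 9}).subscheme ≅ Bl),
        IsBlowup twoPoints π ∧
        e.hom ≫ π ≫ pullback.fst P1ToC P1ToC ≫ P1ToC =
          (B.inter {7, 8, 9}).subschemeι ≫ B.h ≫ SToC) ∧
      -- `T̃^(5)` consists of six points, each isomorphic to `Y_123` through the diagonal
      (∃ e : stratum B.fibre 5 ≅ B.interSum sixPoints,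
        e.hom ≫ B.interSumMap _ = stratumMap B.fibre 5) ∧
      (∀ J ∈ sixPoints, ∃ e : (B.inter J).subscheme ≅ (Y Finset.univ).subscheme,
        e.hom ≫ Δ Finset.univ = (B.inter J).subschemeι ≫ B.σ) := by
  refine ⟨isPullback_W, exists_blowupTower, fun B ↦ ?_⟩
  refine ⟨B.isNormalCrossingsDegeneration, B.fibre_eq, B.bijOn_T, ?_, ?_, ?_,
    fun m ↦ B.exists_stratum_iso m, ?_, B.exists_isBlowup_iso, B.exists_stratum_five_iso,
    fun J hJ ↦ B.exists_sixPoints_iso hJ⟩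
  · exact B.T_eq_properTransform (by decide) rfl
  · exact B.T_eq_properTransform (by decide) rfl
  · exact B.T_eq_properTransform (by decide) rfl
  refine ⟨B.φ, fun ε ↦ inferInstance, B.φ_σ, B.exists_mem_range_φ,
    fun ε k hk ↦ B.vanishingIdeal_T_comap ε hk, B.ncard_le_five, B.diagCurve,
    fun i j hij ε ↦ B.diagCurve_comap hij ε, ?_, ?_, ?_, ?_, ?_, ?_,
    fun i j hij ↦ B.exists_diagCurve_iso hij⟩
  all_goals exact B.inter_le_diagCurve (by decide) (by decide)
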